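/- Let $(M,g)$ be a smooth Riemannian manifold of dimension $n\ge 3$; write $V_{,ij}$ for the covariant Hessian and $\Delta$ for the Laplacian of $g$. A (second order maximally) superintegrable system on $(M,g)$ consists of a Hamiltonian $H=g^{ij}p_ip_j+V$ together with the space spanned by $2n-1$ smooth constants of motion $F^{(\alpha)}=K^{(\alpha)}_{ij}p^ip^j+W^{(\alpha)}$, $p^i=g^{ij}p_j$, with $K^{(\alpha)}$ symmetric tensor fields, $V,W^{(\alpha)}$ functions on $M$, $\{F^{(\alpha)},H\}=0$, one of the $F^{(\alpha)}$ equal to $H$, and the differentials $dF^{(\alpha)}$ linearly independent almost everywhere on $T^*M$. Its Killing tensors are the linear combinations of the $K^{(\alpha)}$. The system is *irreducible* if at no point of $M$ the Killing tensors, regarded as endomorphisms of the tangent space, have a non-trivial common invariant subspace. A *structure tensor* of the system is a smooth tensor field $T_{ijk}=T_{jik}$ with $g^{ij}T_{ijk}=0$ such that the potential $f=V$ satisfies $$f_{,ij}=T_{ij}{}^{m}f_{,m}+\tfrac1n g_{ij}\,\Delta f .\qquad(\ast)$$ A *potential of the system* on an open set $O$ is a smooth solution $f$ of $(\ast)$ on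 $O$ which is compatible with all Killing tensors $K$ of the system, i.e. $d(K\,df)=0$ on $O$. The system with structure tensor $T$ is *non-degenerate* if every point has a connected open neighbourhood on which there is an $(n+2)$-dimensional space of potentials of the system. Let two irreducible non-degenerate superintegrable systems on $(M,g)$, with structure tensors $T_1,T_2$ and potentials $V_1,V_2$, be given, let $x_0\in M$, and suppose that the two spaces of Killing tensors have the same set of values at $x_0$ and that $T_1(x_0)=T_2(x_0)$. Then: 1. $\nabla T_1(x_0)=\nabla T_2(x_0)$. 2. There is a connected open neighbourhood $U$ of $x_0$ such that: the two spaces of Killing tensors coincide on $U$, and a Killing tensor of the first system and one of the second which agree at $x_0$ agree on $U$; $T_1=T_2$ on $U$; and on every open $O\subseteq U$ the two systems have the same potentials. If moreover $V_1$ and $V_2$ have the same value, differential and Laplacian at $x_0$, then $V_1=V_2$ on $U$, and any two constants of motion $K+W$ of the first and $K'+W'$ of the second system with $K(x_0)=K'(x_0)$ satisfy $K=K'$ and $W=W'+\mathrm{const}$ on $U$. -/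

import Mathlib

open scoped Manifold ContDiff Topology
open MeasureTheory

noncomputable section

namespace Superintegrable

/-- The model space `ℝⁿ`. -/
abbrev Model (n : ℕ) : Type := EuclideanSpace ℝ (Fin n)

/-- The tangent space of the manifold `M` at `x`. -/
abbrev TS (n : ℕ) {M : Type*} [TopologicalSpace M] [ChartedSpace (Model n) M] (x : M) : Type :=
  TangentSpace (𝓡 n) x

/-- A smooth Riemannian metric on `M`. -/
abbrev Metric (n : ℕ) (M : Type*) [TopologicalSpace M] [ChartedSpace (Model n) M]
    [IsManifold (𝓡 n) ∞ M] : Type _ :=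
  Bundle.ContMDiffRiemannianMetric (𝓡 n) ∞ (Model n) (fun x : M => TangentSpace (𝓡 n) x)

/-- Bilinear forms on the tangent space at `x`. -/
abbrev Form2 (n : ℕ) {M : Type*} [TopologicalSpace M] [ChartedSpace (Model n) M] (x : M) : Type :=
  TS n x →L[ℝ] TS n x →L[ℝ] ℝ

/-- Trilinear forms on the tangent space at `x`. -/
abbrev Form3 (n : ℕ) {M : Type*} [TopologicalSpace M] [ChartedSpace (Model n) M] (x : M) : Type :=
  TS n x →L[ℝ] TS n x →L[ℝ] TS n x →L[ℝ] ℝ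

/-- The smooth charts of `M`. -/
abbrev smoothCharts (n : ℕ) (M : Type*) [TopologicalSpace M] [ChartedSpace (Model n) M] :
    Set (OpenPartialHomeomorph M (Model n)) :=
  IsManifold.maximalAtlas (𝓡 n) ∞ M

/-- The partial derivative `∂ᵢ f` of a function on `ℝⁿ`. -/
def pd {n : ℕ} (i : Fin n) (f : Model n → ℝ) (q : Model n) : ℝ :=
  fderiv ℝ f q (EuclideanSpace.single i 1)

section Coordinates

variable {n : ℕ} {M : Type*} [TopologicalSpace M] [ChartedSpace (Model n) M]
  (e : OpenPartialHomeomorph M (Model n))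

/-- The `i`-th coordinate vector field of the chart `e`, at the point with coordinates `q`. -/
def coordVec (i : Fin n) (q : Model n) : TS n (e.symm q) :=
  mfderiv (𝓡 n) (𝓡 n) e.symm q (EuclideanSpace.single i (1 : ℝ) : Model n)

/-- The components `K_{ij}` of a tensor field in the chart `e`. -/
def comp2 (K : ∀ x : M, Form2 n x) (i j : Fin n) (q : Model n) : ℝ :=
  K (e.symm q) (coordVec e i q) (coordVec e j q)

/-- The components `T_{ijk}` of a tensor field in the chart `e`. -/
def comp3 (T : ∀ x : M, Form3 n x) (i j k : Fin n) (q : Model n) : ℝ :=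
  T (e.symm q) (coordVec e i q) (coordVec e j q) (coordVec e k q)

/-- Smoothness of a tensor field: its components in every smooth chart are smooth. -/
def IsSmooth2 (K : ∀ x : M, Form2 n x) : Prop :=
  ∀ e ∈ smoothCharts n M, ∀ i j, ContDiffOn ℝ ∞ (comp2 e K i j) e.target

/-- Smoothness of a tensor field: its components in every smooth chart are smooth. -/
def IsSmooth3 (T : ∀ x : M, Form3 n x) : Prop :=
  ∀ e ∈ smoothCharts n M, ∀ i j k, ContDiffOn ℝ ∞ (comp3 e T i j k) e.target

variable [IsManifold (𝓡 n) ∞ M] (g : Metric n M)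

/-- The components `g^{ij}` of the inverse metric. -/
def ginv (i j : Fin n) (q : Model n) : ℝ :=
  (Matrix.of fun a b => comp2 e g.inner a b q)⁻¹ i j

/-- The Christoffel symbols `Γ^k_{ij}` of the Levi-Civita connection. -/
def christoffel (k i j : Fin n) (q : Model n) : ℝ :=
  (1 / 2) * ∑ l, ginv e g k l q *
    (pd i (comp2 e g.inner j l) q + pd j (comp2 e g.inner i l) q - pd l (comp2 e g.inner i j) q)

/-- The covariant Hessian `f_{,ij}` of a function. -/
def hess (f : M → ℝ) (i j : Fin n) (q : Model n) : ℝ :=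
  pd i (pd j (f ∘ e.symm)) q - ∑ k, christoffel e g k i j q * pd k (f ∘ e.symm) q

/-- The Laplacian `Δf = g^{ij} f_{,ij}`. -/
def lap (f : M → ℝ) (q : Model n) : ℝ :=
  ∑ i, ∑ j, ginv e g i j q * hess e g f i j q

/-- The components `T_{ijk,l}` of the covariant derivative of a tensor field. -/
def covDeriv3 (T : ∀ x : M, Form3 n x) (i j k l : Fin n) (q : Model n) : ℝ :=
  pd l (comp3 e T i j k) q
    - ∑ a, christoffel e g a l i q * comp3 e T a j k q
    - ∑ a, christoffel e g a l j q * comp3 e T i a k q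
    - ∑ a, christoffel e g a l k q * comp3 e T i j a q

/-- The components of the 1-form `K df`, i.e. `K_j{}^m ∂_m f`. -/
def applyForm (K : ∀ x : M, Form2 n x) (f : M → ℝ) (j : Fin n) (q : Model n) : ℝ :=
  ∑ a, ∑ m, comp2 e K j a q * ginv e g a m q * pd m (f ∘ e.symm) q

/-- The function `K_{ij} pⁱ pʲ + W` on phase space, in the canonical coordinates `z = (q, p)`
of the cotangent bundle over the chart `e`; here `pⁱ = g^{ia} p_a`. -/
def phaseFun (K : ∀ x : M, Form2 n x) (W : M → ℝ) (z : Model n × Model n) : ℝ :=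
  (∑ i, ∑ j, comp2 e K i j z.1 *
    (∑ a, ginv e g i a z.1 * z.2 a) * (∑ b, ginv e g j b z.1 * z.2 b)) + W (e.symm z.1)

end Coordinates

/-- The canonical Poisson bracket of functions of `(q, p)`. -/
def poisson {n : ℕ} (F G : Model n × Model n → ℝ) (z : Model n × Model n) : ℝ :=
  ∑ i, (fderiv ℝ F z (EuclideanSpace.single i 1, 0) * fderiv ℝ G z (0, EuclideanSpace.single i 1)
    - fderiv ℝ G z (EuclideanSpace.single i 1, 0) * fderiv ℝ F z (0, EuclideanSpace.single i 1))

section Systems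

variable {n : ℕ} {M : Type*} [TopologicalSpace M] [ChartedSpace (Model n) M]
  [IsManifold (𝓡 n) ∞ M]

/-- A second order maximally superintegrable system on the Riemannian manifold `(M, g)`: the
Hamiltonian `H = g + V` together with `2n - 1` constants of motion `F α = K α + W α`,
functionally independent, one of which is `H`. -/
structure System (g : Metric n M) where
  /-- the potential -/
  V : M → ℝ
  /-- the quadratic parts of the constants of motion -/
  K : Fin (2 * n - 1) → ∀ x : M, Form2 n x
  /-- the momentum-free parts of the constants of motion -/
  W : Fin (2 * n - 1) → M → ℝ
  smooth_V : ContMDiff (𝓡 n) 𝓘(ℝ) ∞ V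
  smooth_K : ∀ α, IsSmooth2 (K α)
  smooth_W : ∀ α, ContMDiff (𝓡 n) 𝓘(ℝ) ∞ (W α)
  symm_K : ∀ α x v w, K α x v w = K α x w v
  constant_of_motion : ∀ α, ∀ e ∈ smoothCharts n M, ∀ z : Model n × Model n, z.1 ∈ e.target →
    poisson (phaseFun e g (K α) (W α)) (phaseFun e g g.inner V) z = 0
  /-- the differentials are linearly independent almost everywhere on phase space -/
  functionally_independent : ∀ e ∈ smoothCharts n M,
    ∀ᵐ z : Model n × Model n, z.1 ∈ e.target →
      LinearIndependent ℝ fun α => fderiv ℝ (phaseFun e g (K α) (W α)) z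
  hamiltonian_mem : ∃ α, K α = g.inner ∧ W α = V

variable {g : Metric n M}

/-- The Killing tensors of the system: the linear combinations of the `K α`. -/
def System.killing (S : System g) (a : Fin (2 * n - 1) → ℝ) (x : M) : Form2 n x :=
  ∑ α, a α • S.K α x

/-- The momentum-free part of the constant of motion with quadratic part `S.killing a`. -/
def System.scalarPart (S : System g) (a : Fin (2 * n - 1) → ℝ) (x : M) : ℝ :=
  ∑ α, a α * S.W α x

/-- The values at `x` of the Killing tensors of the system. -/
def System.killingValues (S : System g) (x : M) : Set (Form2 n x) :=
  Set.range fun a => S.killing a x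

/-- The space of the restrictions to `U` of the Killing tensors of the system. -/
def System.killingOn (S : System g) (U : Set M) : Set (∀ x : U, Form2 n (x : M)) :=
  Set.range fun a => fun x : U => S.killing a x

/-- At every point, the Killing tensors, regarded as endomorphisms by means of the metric, have no
non-trivial common invariant subspace. (The vector `u` is the image of `v` under the endomorphism
`K α x`.) -/
def System.IsIrreducible (S : System g) : Prop :=
  ∀ (x : M) (L : Submodule ℝ (TS n x)),
    (∀ α, ∀ v ∈ L, ∃ u ∈ L, ∀ w, g.inner x u w = S.K α x v w) → L = ⊥ ∨ L = ⊤

/-- The equation `f_{,ij} = T_{ij}{}^m f_{,m} + (1/n) g_{ij} Δf` holds on the set `O`. -/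
def WilczynskiOn (g : Metric n M) (T : ∀ x : M, Form3 n x) (O : Set M) (f : M → ℝ) : Prop :=
  ∀ e ∈ smoothCharts n M, ∀ q ∈ e.target, e.symm q ∈ O → ∀ i j,
    hess e g f i j q =
      ∑ a, ∑ m, comp3 e T i j a q * ginv e g a m q * pd m (f ∘ e.symm) q
        + (1 / (n : ℝ)) * comp2 e g.inner i j q * lap e g f q

/-- The Bertrand-Darboux condition `d(K df) = 0` holds on the set `O`. -/
def BertrandDarbouxOn (g : Metric n M) (K : ∀ x : M, Form2 n x) (O : Set M) (f : M → ℝ) : Prop :=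
  ∀ e ∈ smoothCharts n M, ∀ q ∈ e.target, e.symm q ∈ O → ∀ i j,
    pd i (applyForm e g K f j) q = pd j (applyForm e g K f i) q

/-- `T` is a structure tensor of the system: smooth, symmetric and trace-free in its first two
arguments, and the potential satisfies the corresponding equation. -/
structure System.IsStructureTensor (S : System g) (T : ∀ x : M, Form3 n x) : Prop where
  smooth : IsSmooth3 T
  symm : ∀ x u v w, T x u v w = T x v u w
  trace_free : ∀ e ∈ smoothCharts n M, ∀ q ∈ e.target, ∀ k,
    ∑ i, ∑ j, ginv e g i j q * comp3 e T i j k q = 0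
  wilczynski : WilczynskiOn g T Set.univ S.V

/-- `f` is, on the open set `O`, a smooth potential belonging to the system `S` with structure
tensor `T`: it solves the structure equation and is compatible with all Killing tensors of `S`. -/
structure System.IsPotentialOn (S : System g) (T : ∀ x : M, Form3 n x) (O : Set M)
    (f : M → ℝ) : Prop where
  smooth : ContMDiffOn (𝓡 n) 𝓘(ℝ) ∞ f O
  wilczynski : WilczynskiOn g T O f
  bertrand_darboux : ∀ α, BertrandDarbouxOn g (S.K α) O f

/-- Non-degeneracy: around every point there is an `(n+2)`-dimensional space of potentials.
(On a connected open set `n + 2` is the largest possible dimension when `2 ≤ n`, because a solution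
is determined by the values of `f`, `df` and `Δf` at one point.) -/
def System.IsNondegenerate (S : System g) (T : ∀ x : M, Form3 n x) : Prop :=
  ∀ x : M, ∃ O : Set M, IsOpen O ∧ IsConnected O ∧ x ∈ O ∧
    ∃ f : Fin (n + 2) → M → ℝ, (∀ a, S.IsPotentialOn T O (f a)) ∧
      LinearIndependent ℝ fun a => O.domRestrict (f a)

/-- `∇T₁ = ∇T₂` at the point `x`. -/
def CovDerivEqAt (g : Metric n M) (T₁ T₂ : ∀ x : M, Form3 n x) (x : M) : Prop :=
  ∀ e ∈ smoothCharts n M, x ∈ e.source → ∀ i j k l,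
    covDeriv3 e g T₁ i j k l (e x) = covDeriv3 e g T₂ i j k l (e x)

/-- `f₁` and `f₂` have the same value, the same differential and the same Laplacian at `x`. -/
def SameDataAt (g : Metric n M) (f₁ f₂ : M → ℝ) (x : M) : Prop :=
  f₁ x = f₂ x ∧
  (∀ i, pd i (f₁ ∘ (chartAt (Model n) x).symm) (chartAt (Model n) x x) =
    pd i (f₂ ∘ (chartAt (Model n) x).symm) (chartAt (Model n) x x)) ∧
  lap (chartAt (Model n) x) g f₁ (chartAt (Model n) x x) =
    lap (chartAt (Model n) x) g f₂ (chartAt (Model n) x x)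

end Systems

end Superintegrable

end

/-!
Everything happens in one chart `e` around `x₀`, chosen such that the metric `G` is the identity at
`x₀`. Write `T`, `K` for the components of the structure tensor and of the Killing tensors. The idea
is that `(T, K)` solves a closed system of first order equations, although the equation for `∂T` is
only given implicitly.

*The equations of one system.* In a chart a potential satisfies `∂ᵢ∂ⱼ f = A_{ij}{}^m ∂_m f + G_{ij} h`
with `A = Γ + T` and `h = Δf / n`. Comparing third derivatives gives
`∂ₖ h = r_k{}^m ∂_m f + t_k h`, so that a potential is determined by its value, gradient and Laplacian
at a point (`System.eqOn_zero`). By non-degeneracy gradient and Laplacian of the potentials take all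
values at each point (`System.hasFullJets`), and hence all identities between them hold
coefficientwise. This gives two integrability conditions, one on `T` and one on `∂T`, and from
`d(K df) = 0` the antisymmetric part of `∂K`. Together with the Killing equation, which is the cubic
part of the Poisson bracket relation (`killing_of_poisson`), the latter expresses `∂K` in terms of `K`
and `T`. The result is `System.isLocalSystem`.

*Two systems.* Let `w` consist of the differences of `T`, of `K` and of the trace parts `t` of the two
systems; it vanishes at `x₀`. Subtracting the equations shows that `∂(K - K')` is `O(w)`, and, after
one more differentiation, that `D = ∂(T - T')` satisfies a homogeneous linear system up to `O(w)`
(`symbol_isBigO`). At `x₀` this system has only the zero solution (`symbol_injective`): by the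
integrability conditions `D` is the part of a totally symmetric tensor `Θ_{ijkl}` trace-free in the
first pair of indices, and by the integrability conditions of the Killing tensors the matrices `Θ_{··kl}`
commute with all Killing tensors. By irreducibility and Schur's lemma they are multiples of the
identity, which a totally symmetric tensor allows only if it is zero. Injectivity is an open
condition, so that `D = O(w)` near `x₀`, altogether `∂w = O(w)`, and `w = 0` near `x₀` by Grönwall's
inequality (`eventually_eq_zero_of_pd_isBigO`).

Hence the structure tensors and the Killing tensors coincide on a neighbourhood `U`, and with them
the derivatives of the structure tensors at `x₀` and the potentials on subsets of `U`. The functions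
`V` agree by the uniqueness of potentials, and the functions `W` up to constants because
`dW = K dV`.
-/

noncomputable section

namespace Superintegrable

open Asymptotics Filter

/-! ### Partial derivatives -/

section PartialDerivatives

variable {n : ℕ} {f f' : Model n → ℝ} {q : Model n}

theorem pd_congr (i : Fin n) (h : f =ᶠ[𝓝 q] f') : pd i f q = pd i f' q := by
  rw [pd, pd, h.fderiv_eq]

theorem pd_const (i : Fin n) (c : ℝ) : pd i (fun _ => c) q = 0 := by
  simp [pd]

theorem pd_add (i : Fin n) (hf : DifferentiableAt ℝ f q) (hf' : DifferentiableAt ℝ f' q) :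
    pd i (fun x => f x + f' x) q = pd i f q + pd i f' q := by
  simp only [pd]; rw [fderiv_fun_add hf hf']; rfl

theorem pd_sub (i : Fin n) (hf : DifferentiableAt ℝ f q) (hf' : DifferentiableAt ℝ f' q) :
    pd i (fun x => f x - f' x) q = pd i f q - pd i f' q := by
  simp only [pd]; rw [fderiv_fun_sub hf hf']; rfl

theorem pd_mul (i : Fin n) (hf : DifferentiableAt ℝ f q) (hf' : DifferentiableAt ℝ f' q) :
    pd i (fun x => f x * f' x) q = pd i f q * f' q + f q * pd i f' q := by
  simp only [pd]; rw [fderiv_fun_mul hf hf']; simp; ring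

theorem pd_const_mul (i : Fin n) (c : ℝ) (hf : DifferentiableAt ℝ f q) :
    pd i (fun x => c * f x) q = c * pd i f q := by
  simp only [pd]; rw [fderiv_const_mul hf]; simp

theorem pd_sum {ι : Type*} (s : Finset ι) {F : ι → Model n → ℝ} (i : Fin n)
    (hF : ∀ a, DifferentiableAt ℝ (F a) q) :
    pd i (fun x => ∑ a ∈ s, F a x) q = ∑ a ∈ s, pd i (F a) q := by
  simp only [pd]; rw [fderiv_fun_sum fun a _ => hF a]; simp

theorem pd_sum_mul {ι : Type*} (s : Finset ι) {F F' : ι → Model n → ℝ} (i : Fin n)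
    (hF : ∀ a, DifferentiableAt ℝ (F a) q) (hF' : ∀ a, DifferentiableAt ℝ (F' a) q) :
    pd i (fun x => ∑ a ∈ s, F a x * F' a x) q
      = ∑ a ∈ s, (pd i (F a) q * F' a q + F a q * pd i (F' a) q) := by
  rw [pd_sum s i fun a => (hF a).fun_mul (hF' a)]
  exact Finset.sum_congr rfl fun a _ => pd_mul i (hF a) (hF' a)

theorem fderiv_apply_eq_sum_pd (v : Model n) : fderiv ℝ f q v = ∑ i, v i * pd i f q := by
  conv_lhs => rw [← (EuclideanSpace.basisFun (Fin n) ℝ).sum_repr v]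
  simp [pd, map_sum]

theorem _root_.ContDiffOn.pd {Ω : Set (Model n)} (hf : ContDiffOn ℝ ∞ f Ω) (hΩ : IsOpen Ω)
    (i : Fin n) : ContDiffOn ℝ ∞ (pd i f) Ω :=
  (hf.fderiv_of_isOpen hΩ (by simp)).clm_apply contDiffOn_const

theorem _root_.ContDiffOn.differentiableAt_of_isOpen {Ω : Set (Model n)}
    (hf : ContDiffOn ℝ ∞ f Ω) (hΩ : IsOpen Ω) (hq : q ∈ Ω) : DifferentiableAt ℝ f q :=
  (hf.contDiffAt (hΩ.mem_nhds hq)).differentiableAt (by simp)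

theorem pd_comm (hf : ContDiffAt ℝ ∞ f q) (i j : Fin n) :
    pd i (pd j f) q = pd j (pd i f) q := by
  have hd : DifferentiableAt ℝ (fderiv ℝ f) q :=
    (hf.fderiv_right (m := ∞) (by simp)).differentiableAt (by simp)
  have key : ∀ a b : Fin n, pd a (pd b f) q
      = fderiv ℝ (fderiv ℝ f) q (EuclideanSpace.single a 1) (EuclideanSpace.single b 1) := by
    intro a b
    have : pd b f = fun x => fderiv ℝ f x (EuclideanSpace.single b 1) := rfl
    rw [pd, this, fderiv_clm_apply hd (differentiableAt_const _)]
    simp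
  rw [key, key]
  exact hf.isSymmSndFDerivAt (by simpa using ENat.LEInfty.out) _ _

end PartialDerivatives

/-! ### Unique continuation -/

/-- A family of functions which vanishes at `q₀` and whose first derivatives are, near `q₀`,
bounded by a multiple of the family itself vanishes near `q₀`: Grönwall's inequality along the
segments issuing from `q₀`. -/
theorem eventually_eq_zero_of_pd_isBigO {n : ℕ} {ι : Type*} [Fintype ι] {w : ι → Model n → ℝ}
    {q₀ : Model n} (hd : ∀ c, ∀ᶠ q in 𝓝 q₀, DifferentiableAt ℝ (w c) q)
    (hO : ∀ c i, pd i (w c) =O[𝓝 q₀] fun q => (fun c => w c q)) (h0 : ∀ c, w c q₀ = 0) :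
    ∀ᶠ q in 𝓝 q₀, ∀ c, w c q = 0 := by
  choose C hC using fun c i => (hO c i).bound
  have hev : ∀ᶠ q in 𝓝 q₀, ∀ c, DifferentiableAt ℝ (w c) q ∧
      ∀ i, ‖pd i (w c) q‖ ≤ C c i * ‖fun c => w c q‖ :=
    eventually_all.2 fun c => (hd c).and (eventually_all.2 fun i => hC c i)
  obtain ⟨r, hr, hball⟩ := Metric.eventually_nhds_iff_ball.1 hev
  refine Metric.eventually_nhds_iff_ball.2 ⟨r, hr, fun q hq => ?_⟩
  set v := q - q₀ with hv
  have hmem : ∀ t ∈ Set.Icc (0 : ℝ) 1, q₀ + t • v ∈ Metric.ball q₀ r := by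
    intro t ht
    have h1 : ‖t • v‖ ≤ ‖v‖ := by
      rw [norm_smul, Real.norm_of_nonneg ht.1]
      exact mul_le_of_le_one_left (norm_nonneg _) ht.2
    have h2 : ‖v‖ < r := by simpa [hv, dist_eq_norm] using hq
    simpa [dist_eq_norm] using h1.trans_lt h2
  have hder : ∀ t ∈ Set.Icc (0 : ℝ) 1, HasDerivAt (fun t : ℝ => fun c => w c (q₀ + t • v))
      (fun c => fderiv ℝ (w c) (q₀ + t • v) v) t := by
    intro t ht
    rw [hasDerivAt_pi]
    intro c
    have h1 := ((hball _ (hmem t ht) c).1).hasFDerivAt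
    have h2 : HasDerivAt (fun t : ℝ => q₀ + t • v) v t := by
      simpa using ((hasDerivAt_id t).smul_const v).const_add q₀
    exact h1.comp_hasDerivAt t h2
  set K : ℝ := ∑ c, ∑ i, |v i| * |C c i|
  have hbound : ∀ t ∈ Set.Icc (0 : ℝ) 1, ‖fun c => fderiv ℝ (w c) (q₀ + t • v) v‖
      ≤ K * ‖fun c => w c (q₀ + t • v)‖ := by
    intro t ht
    refine (pi_norm_le_iff_of_nonneg (by positivity)).2 fun c => ?_
    rw [fderiv_apply_eq_sum_pd]
    calc ‖∑ i, v i * pd i (w c) (q₀ + t • v)‖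
        ≤ ∑ i, |v i| * |C c i| * ‖fun c => w c (q₀ + t • v)‖ := by
          refine (norm_sum_le _ _).trans (Finset.sum_le_sum fun i _ => ?_)
          rw [norm_mul, Real.norm_eq_abs (v i), mul_assoc]
          refine mul_le_mul_of_nonneg_left ?_ (abs_nonneg _)
          exact ((hball _ (hmem t ht) c).2 i).trans
            (mul_le_mul_of_nonneg_right (le_abs_self _) (norm_nonneg _))
      _ = (∑ i, |v i| * |C c i|) * ‖fun c => w c (q₀ + t • v)‖ := by rw [Finset.sum_mul]
      _ ≤ K * _ := by
          refine mul_le_mul_of_nonneg_right ?_ (norm_nonneg _)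
          exact Finset.single_le_sum (f := fun c => ∑ i, |v i| * |C c i|)
            (fun c _ => Finset.sum_nonneg fun i _ => by positivity) (Finset.mem_univ c)
  have := eq_zero_of_abs_deriv_le_mul_abs_self_of_eq_zero_right
    (f := fun t : ℝ => fun c => w c (q₀ + t • v)) (K := K) (a := 0) (b := 1)
    (fun t ht => (hder t ht).continuousAt.continuousWithinAt)
    (fun t ht => (hder t ⟨ht.1, ht.2.le⟩).hasDerivWithinAt)
    (by ext c; simp [h0]) (fun t ht => hbound t ⟨ht.1, ht.2.le⟩) 1 (by simp)
  intro c
  simpa [hv] using congrFun this c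

theorem _root_.ContinuousAt.mul_isBigO {X F : Type*} [TopologicalSpace X] [NormedAddCommGroup F]
    {a b : X → ℝ} {w : X → F} {x : X} (ha : ContinuousAt a x) (hb : b =O[𝓝 x] w) :
    (fun y => a y * b y) =O[𝓝 x] w := by
  have h : a =O[𝓝 x] fun _ => (1 : ℝ) := ha.isBigO_one ℝ
  simpa using (h.mul hb.norm_right).norm_right

/-- Unique continuation from a point to a preconnected set, given unique continuation to
neighbourhoods. -/
theorem _root_.IsPreconnected.subset_of_forall_mem_nhds {X : Type*} [TopologicalSpace X]
    {U Z : Set X} (hU : IsPreconnected U) {x : X} (hxU : x ∈ U) (hxZ : x ∈ Z)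
    (hopen : ∀ y ∈ U, y ∈ Z → Z ∈ 𝓝 y) (hclosed : ∀ y ∈ U, y ∈ closure (interior Z) → y ∈ Z) :
    U ⊆ Z :=
  (hU.subset_of_closure_inter_subset isOpen_interior
    ⟨x, hxU, mem_interior_iff_mem_nhds.2 (hopen x hxU hxZ)⟩
    fun y hy => mem_interior_iff_mem_nhds.2 (hopen y hy.2 (hclosed y hy.2 hy.1))).trans
    interior_subset

/-! ### The symbol of the structure equations -/

/-- A family of homogeneous maps, continuous in a parameter, which is injective for one value of
the parameter is bounded below uniformly for nearby values. -/
theorem eventually_norm_le_of_injective {P V W : Type*} [TopologicalSpace P]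
    [NormedAddCommGroup V] [NormedSpace ℝ V] [ProperSpace V]
    [NormedAddCommGroup W] [NormedSpace ℝ W] {Λ : P → V → W}
    (hc : Continuous fun z : P × V => Λ z.1 z.2) (hs : ∀ p (c : ℝ) v, Λ p (c • v) = c • Λ p v)
    {p₀ : P} (hinj : ∀ v, Λ p₀ v = 0 → v = 0) :
    ∃ C : ℝ, ∀ᶠ p in 𝓝 p₀, ∀ v, ‖v‖ ≤ C * ‖Λ p v‖ := by
  have hS : IsCompact (Metric.sphere (0 : V) 1) := isCompact_sphere 0 1
  obtain ⟨m, hm, hmin⟩ : ∃ m : ℝ, 0 < m ∧ ∀ v ∈ Metric.sphere (0 : V) 1, m < ‖Λ p₀ v‖ := by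
    have hc0 : Continuous fun v => ‖Λ p₀ v‖ :=
      (hc.comp (Continuous.prodMk continuous_const continuous_id)).norm
    obtain hemp | hne := (Metric.sphere (0 : V) 1).eq_empty_or_nonempty
    · exact ⟨1, one_pos, by simp [hemp]⟩
    · obtain ⟨v, hv, hvmin⟩ := hS.exists_isMinOn hne hc0.continuousOn
      have hpos : 0 < ‖Λ p₀ v‖ := by
        refine norm_pos_iff.2 fun h => ?_
        simp [hinj v h] at hv
      exact ⟨‖Λ p₀ v‖ / 2, by positivity, fun u hu => by
        have : ‖Λ p₀ v‖ ≤ ‖Λ p₀ u‖ := hvmin hu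
        linarith⟩
  have hopen : IsOpen {z : P × V | m < ‖Λ z.1 z.2‖} := isOpen_lt continuous_const hc.norm
  obtain ⟨u, v, hu, -, hpu, hSv, huv⟩ := generalized_tube_lemma (isCompact_singleton (x := p₀)) hS
    hopen (by rintro ⟨p, v⟩ ⟨hp, hv⟩; obtain rfl : p = p₀ := hp; exact hmin v hv)
  refine ⟨m⁻¹, ?_⟩
  filter_upwards [hu.mem_nhds (hpu rfl)] with p hp x
  rcases eq_or_ne x 0 with rfl | hx
  · simp only [norm_zero]; positivity
  have h1 : m < ‖Λ p (‖x‖⁻¹ • x)‖ :=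
    huv (Set.mk_mem_prod hp (hSv (by simp [norm_smul, norm_ne_zero_iff.2 hx])))
  rw [hs, norm_smul, norm_inv, norm_norm] at h1
  have hxp := norm_pos_iff.2 hx
  rw [inv_mul_eq_div, lt_div_iff₀ hxp] at h1
  rw [inv_mul_eq_div, le_div_iff₀ hm]
  linarith

/-- Three-fold arrays of components. -/
abbrev Arr3 (n : ℕ) : Type := Fin n → Fin n → Fin n → ℝ

/-- The unknowns `(D, s, r)` of the linearised structure equations: the derivatives `D i j k l` of
`T i j k` and `s k l` of the trace part `t k` in the direction `l`, and the coefficients `r k m` in the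
equation `∂ₖ h = r_k{}^m ∂_m f + t_k h` for the Laplacian. -/
abbrev Jet (n : ℕ) : Type :=
  (Fin n → Arr3 n) × (Fin n → Fin n → ℝ) × (Fin n → Fin n → ℝ)

/-- The principal part of the integrability condition of the Killing tensor `k`, before
antisymmetrisation in `i` and `l`. -/
def killingSymbol {n : ℕ} (γ k : Fin n → Fin n → ℝ) (D : Fin n → Arr3 n) (i j m l : Fin n) : ℝ :=
  ∑ b, ∑ a, γ b a * (k i b * (D j a m l + D m a j l) - k j b * D i a m l - k m b * D i a j l)

/-- The principal part of all equations on the first derivatives of the structure tensor: symmetry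
and vanishing trace in the first two indices, the two integrability conditions of the structure
equation, and the integrability conditions of the Killing tensors `k α`. -/
def symbol {n : ℕ} {ι : Type*} (G γ : Fin n → Fin n → ℝ) (k : ι → Fin n → Fin n → ℝ) (X : Jet n) :
    (Fin n → Arr3 n) × (Fin n → Fin n → ℝ) × (Fin n → Arr3 n) × (Fin n → Arr3 n) ×
      (ι → Fin n → Arr3 n) :=
  (fun i j k l => X.1 i j k l - X.1 j i k l,
   fun k l => ∑ i, ∑ j, γ i j * X.1 i j k l,
   fun i j k l => X.1 i j k l - X.1 i k j l + (G i j * X.2.1 k l - G i k * X.2.1 j l),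
   fun i j k m => ∑ a, γ a m * (X.1 i j a k - X.1 i k a j)
     + (G i j * X.2.2 k m - G i k * X.2.2 j m),
   fun α i j m l => killingSymbol γ (k α) X.1 i j m l - killingSymbol γ (k α) X.1 l j m i)

theorem symbol_smul {n : ℕ} {ι : Type*} (G γ : Fin n → Fin n → ℝ) (k : ι → Fin n → Fin n → ℝ)
    (c : ℝ) (X : Jet n) : symbol G γ k (c • X) = c • symbol G γ k X := by
  have h : ∀ (κ : Fin n → Fin n → ℝ) (i j m l : Fin n),
      killingSymbol γ κ (c • X.1) i j m l = c * killingSymbol γ κ X.1 i j m l := by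
    intro κ i j m l
    simp only [killingSymbol, Pi.smul_apply, smul_eq_mul, Finset.mul_sum]
    exact Finset.sum_congr rfl fun b _ => Finset.sum_congr rfl fun a _ => by ring
  refine Prod.ext ?_ (Prod.ext ?_ (Prod.ext ?_ (Prod.ext ?_ ?_)))
  · ext i j k l; simp [symbol]; ring
  · ext k l
    simp only [symbol, Prod.smul_fst, Prod.smul_snd, Pi.smul_apply, smul_eq_mul, Finset.mul_sum]
    exact Finset.sum_congr rfl fun b _ => Finset.sum_congr rfl fun a _ => by ring
  · ext i j k l; simp [symbol]; ring
  · ext i j k m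
    simp only [symbol, Prod.smul_fst, Prod.smul_snd, Pi.smul_apply, smul_eq_mul, mul_add,
      Finset.mul_sum]
    congr 1
    · exact Finset.sum_congr rfl fun b _ => by ring
    · ring
  · ext α i j m l
    simp only [symbol, Prod.smul_fst, Prod.smul_snd, Pi.smul_apply, smul_eq_mul, h]
    ring

set_option synthInstance.maxSize 1000 in
set_option synthInstance.maxHeartbeats 200000 in
theorem continuous_symbol {n : ℕ} {ι : Type*} :
    Continuous fun z : ((Fin n → Fin n → ℝ) × (Fin n → Fin n → ℝ) × (ι → Fin n → Fin n → ℝ))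
      × Jet n => symbol z.1.1 z.1.2.1 z.1.2.2 z.2 := by
  unfold symbol killingSymbol
  fun_prop

theorem killingSymbol_one {n : ℕ} (k : Fin n → Fin n → ℝ) (D : Fin n → Arr3 n)
    (i j m l : Fin n) : killingSymbol (fun i j => if i = j then 1 else 0) k D i j m l
      = ∑ a, (k i a * (D j a m l + D m a j l) - k j a * D i a m l - k m a * D i a j l) := by
  simp [killingSymbol]

/-- The algebraic heart of the theorem. In an orthonormal frame the equations on `(D, s, r)` force
`Θ = D + δ ⊗ s` to be totally symmetric, and then the Killing tensors commute with all the matrices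
`Θ j m`. So these are multiples of the identity, and a totally symmetric `Θ` with this property is
zero. -/
theorem symbol_injective {n : ℕ} (hn : 3 ≤ n) {ι : Type*} {k : ι → Fin n → Fin n → ℝ}
    (hk : ∀ α i j, k α i j = k α j i)
    (hschur : ∀ X : Fin n → Fin n → ℝ, (∀ i j, X i j = X j i) →
      (∀ α i l, ∑ a, k α i a * X a l = ∑ a, k α l a * X a i) →
      ∃ c : ℝ, ∀ i j, X i j = if i = j then c else 0)
    (X : Jet n)
    (hX : symbol (fun i j => if i = j then 1 else 0) (fun i j => if i = j then 1 else 0) k X = 0) :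
    X = 0 := by
  obtain ⟨D, s, r⟩ := X
  have hn0 : (3 : ℝ) ≤ n := by exact_mod_cast hn
  simp only [symbol, killingSymbol_one, Prod.mk_eq_zero, funext_iff, Pi.zero_apply, ite_mul,
    one_mul, zero_mul, Finset.sum_ite_eq, Finset.sum_ite_eq', Finset.mem_univ, if_true] at hX
  obtain ⟨h1, h2, h3, h4, h5⟩ := hX
  set δ : Fin n → Fin n → ℝ := fun i j => if i = j then 1 else 0 with hδ
  have hδs : ∀ i j, δ i j = δ j i := fun i j => by simp [hδ, eq_comm]
  have hδ1 : ∀ i, δ i i = 1 := fun i => by simp [hδ]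
  have hδl : ∀ (f : Fin n → ℝ) i, ∑ j, δ i j * f j = f i := fun f i => by simp [hδ]
  have hδ' : ∀ i j (c : ℝ), (if i = j then c else 0) = δ i j * c := fun i j c => by simp [hδ]
  simp only [hδ'] at h3 h4
  set Θ : Fin n → Arr3 n := fun i j k l => D i j k l + δ i j * s k l with hΘ
  have hD : ∀ i j k l, D i j k l = Θ i j k l - δ i j * s k l := fun i j k l => by simp [hΘ]
  have e1 : ∀ i j k l, Θ i j k l = Θ j i k l := fun i j k l => by
    simp only [hΘ]; rw [hδs i j]; linarith [h1 i j k l]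
  have e2 : ∀ i j k l, Θ i j k l = Θ i k j l := fun i j k l => by
    simp only [hΘ]; linarith [h3 i j k l]
  -- the part of the second integrability condition antisymmetric in `i` and `m` contains no `Θ`
  have hu : ∀ m k, s m k = r k m := by
    have key : ∀ i j k m, δ i j * (s m k - r k m) - δ i k * (s m j - r j m)
        - δ m j * (s i k - r k i) + δ m k * (s i j - r j i) = 0 := by
      intro i j k m
      have a := h4 i j k m
      have b := h4 m j k i
      simp only [hD] at a b
      rw [e1 m j i k, e2 j m i k, e1 j i m k, e1 m k i j, e2 k m i j, e1 k i m j] at b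
      linarith
    have key2 : ∀ k m, ((n : ℝ) - 2) * (s m k - r k m)
        + δ m k * ∑ i, (s i i - r i i) = 0 := by
      intro k m
      have := Finset.sum_eq_zero (s := Finset.univ) fun i _ => key i i k m
      simp only [Finset.sum_add_distrib, Finset.sum_sub_distrib, hδ1, one_mul,
        Finset.sum_const, Finset.card_univ, Fintype.card_fin, nsmul_eq_mul, ← Finset.mul_sum] at this
      have a := hδl (fun i => s i k - r k i) m
      have b := hδl (fun i => s m i - r i m) k
      simp only [hδs k] at b
      simp only [mul_sub, Finset.sum_sub_distrib] at a b this ⊢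
      linarith
    have htr : ∑ i, (s i i - r i i) = 0 := by
      have := Finset.sum_eq_zero (s := Finset.univ) fun i _ => key2 i i
      simp only [hδ1, one_mul, Finset.sum_add_distrib, ← Finset.mul_sum, Finset.sum_const,
        Finset.card_univ, Fintype.card_fin, nsmul_eq_mul] at this
      have h : (2 * (n : ℝ) - 2) * ∑ i, (s i i - r i i) = 0 := by linarith
      rcases mul_eq_zero.1 h with h | h
      · linarith
      · exact h
    intro m k
    have := key2 k m
    rw [htr, mul_zero, add_zero] at this
    rcases mul_eq_zero.1 this with h | h <;> linarith
  have e3 : ∀ i j k l, Θ i j k l = Θ i j l k := by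
    intro i j k l
    rw [e2 i j k l, e2 i j l k]
    have a := h4 i k l j
    simp only [hD, hu] at a
    rw [e2 i k j l, e2 i l j k] at a
    rw [e2 i k j l, e2 i l j k]
    linarith
  have hΘ0 : ∀ i j k l, Θ i j k l = 0 := by
    -- in the Killing condition all terms with `s` cancel, and the remaining one is the commutator
    have hsc : ∀ j m, ∃ c : ℝ, ∀ i l, Θ i l j m = if i = l then c else 0 := by
      intro j m
      refine hschur (fun i l => Θ i l j m) (fun i l => e1 i l j m) fun α i l => ?_
      have key : ∀ i l, ∑ a, (k α i a * (D j a m l + D m a j l) - k α j a * D i a m l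
          - k α m a * D i a j l) = 2 * ∑ a, k α i a * Θ a l j m
            - ∑ a, (k α j a * Θ i a m l + k α m a * Θ i a j l) := by
        intro i l
        have expand : ∀ a, k α i a * (D j a m l + D m a j l) - k α j a * D i a m l
            - k α m a * D i a j l = 2 * (k α i a * Θ a l j m)
              - (k α j a * Θ i a m l + k α m a * Θ i a j l)
              - δ j a * (k α i a * s m l) - δ m a * (k α i a * s j l)
              + δ i a * (k α j a * s m l) + δ i a * (k α m a * s j l) := by
          intro a
          have a1 : Θ j a m l = Θ a l j m := by rw [e1 j a, e3 a j, e2 a j]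
          have a2 : Θ m a j l = Θ a l j m := by rw [e1 m a, e2 a m, e3 a j, e2 a j]
          simp only [hD, a1, a2]
          ring
        simp only [expand, Finset.sum_add_distrib, Finset.sum_sub_distrib, hδl, ← Finset.mul_sum]
        rw [hk α j i, hk α m i]
        ring
      have h := h5 α i j m l
      rw [key, key] at h
      have hsym : ∑ a, (k α j a * Θ i a m l + k α m a * Θ i a j l)
          = ∑ a, (k α j a * Θ l a m i + k α m a * Θ l a j i) := by
        refine Finset.sum_congr rfl fun a _ => ?_
        have b : ∀ x, Θ i a x l = Θ l a x i := fun x => by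
          rw [e1 i a, e2 a i, e3 a x i, e2 a x, e1 a l]
        rw [b, b]
      rw [hsym] at h
      linarith
    choose c hc using hsc
    have hc0 : ∀ j m, c j m = 0 := by
      intro j m
      obtain ⟨i, hi⟩ : ∃ i : Fin n, i ≠ j :=
        Fintype.exists_ne_of_one_lt_card (by simp; omega) j
      have a := hc j m i i
      rw [e2, hc, if_neg hi] at a
      simpa using a.symm
    intro i j k l
    rw [hc, hc0, ite_self]
  have hs0 : ∀ k l, s k l = 0 := by
    intro k l
    have a := h2 k l
    simp only [hD, hΘ0, hδ1, one_mul, zero_sub, Finset.sum_neg_distrib, Finset.sum_const,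
      Finset.card_univ, Fintype.card_fin, nsmul_eq_mul, neg_eq_zero] at a
    rcases mul_eq_zero.1 a with h | h
    · linarith
    · exact h
  refine Prod.mk_eq_zero.2 ⟨?_, Prod.mk_eq_zero.2 ⟨?_, ?_⟩⟩
  · funext i j k l; simp [hD, hΘ0, hs0]
  · funext k l; simp [hs0]
  · funext k l; rw [← hu, hs0]; rfl

/-! ### The structure equation in coordinates -/

section Local

variable {n : ℕ}

/-- `G` and `γ` are smooth mutually inverse symmetric matrices on `Ω`: the components of a metric
and of its inverse. -/
structure IsMetricOn (Ω : Set (Model n)) (G γ : Fin n → Fin n → Model n → ℝ) : Prop where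
  isOpen : IsOpen Ω
  smooth : ∀ i j, ContDiffOn ℝ ∞ (G i j) Ω
  smooth_inv : ∀ i j, ContDiffOn ℝ ∞ (γ i j) Ω
  symm : ∀ i j, ∀ q ∈ Ω, G i j q = G j i q
  symm_inv : ∀ i j, ∀ q ∈ Ω, γ i j q = γ j i q
  inv_mul : ∀ i k, ∀ q ∈ Ω, ∑ j, γ i j q * G j k q = if i = k then 1 else 0

/-- `f` solves on `Ω` the equation `∂ᵢ∂ⱼ f = A_{ij}{}^m ∂_m f + G_{ij} h`. -/
structure IsLocalSolution (Ω : Set (Model n)) (G : Fin n → Fin n → Model n → ℝ)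
    (A : Fin n → Fin n → Fin n → Model n → ℝ) (f h : Model n → ℝ) : Prop where
  smooth : ContDiffOn ℝ ∞ f Ω
  smooth_trace : ContDiffOn ℝ ∞ h Ω
  eq : ∀ q ∈ Ω, ∀ i j, pd i (pd j f) q = ∑ m, A i j m q * pd m f q + G i j q * h q

/-- The coefficient of `∂_m f` in the integrability condition of the structure equation. -/
def gradCoeff (A : Fin n → Fin n → Fin n → Model n → ℝ) (i j k m : Fin n) (q : Model n) : ℝ :=
  pd j (A k i m) q - pd k (A j i m) q
    + ∑ l, (A k i l q * A j l m q - A j i l q * A k l m q)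

/-- The coefficient of `h` in the integrability condition of the structure equation. -/
def traceCoeff (G : Fin n → Fin n → Model n → ℝ) (A : Fin n → Fin n → Fin n → Model n → ℝ)
    (i j k : Fin n) (q : Model n) : ℝ :=
  ∑ m, (A k i m q * G j m q - A j i m q * G k m q) + (pd j (G k i) q - pd k (G j i) q)

/-- The coefficients `r` in the equation `∂ₖ h = r_k{}^m ∂_m f + t_k h`, which is a contraction of the
integrability condition. -/
def rCoeff (γ : Fin n → Fin n → Model n → ℝ) (A : Fin n → Fin n → Fin n → Model n → ℝ)
    (k m : Fin n) (q : Model n) : ℝ :=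
  ((n : ℝ) - 1)⁻¹ * ∑ i, ∑ j, γ i j q * gradCoeff A i j k m q

/-- The coefficients `t` in the equation `∂ₖ h = r_k{}^m ∂_m f + t_k h`, which is a contraction of the
integrability condition. -/
def tCoeff (G γ : Fin n → Fin n → Model n → ℝ) (A : Fin n → Fin n → Fin n → Model n → ℝ)
    (k : Fin n) (q : Model n) : ℝ :=
  ((n : ℝ) - 1)⁻¹ * ∑ i, ∑ j, γ i j q * traceCoeff G A i j k q

variable {Ω : Set (Model n)} {G γ : Fin n → Fin n → Model n → ℝ}
  {A : Fin n → Fin n → Fin n → Model n → ℝ}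

theorem IsMetricOn.sum_mul_inv (hG : IsMetricOn Ω G γ) {q : Model n} (hq : q ∈ Ω) (i k : Fin n) :
    ∑ j, G i j q * γ j k q = if i = k then 1 else 0 := by
  rw [show (if i = k then (1 : ℝ) else 0) = if k = i then 1 else 0 by simp [eq_comm],
    ← hG.inv_mul k i q hq]
  exact Finset.sum_congr rfl fun j _ => by rw [hG.symm i j q hq, hG.symm_inv j k q hq, mul_comm]

theorem IsMetricOn.mono {Ω' : Set (Model n)} (hG : IsMetricOn Ω G γ) (hΩ' : IsOpen Ω')
    (h : Ω' ⊆ Ω) : IsMetricOn Ω' G γ :=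
  ⟨hΩ', fun i j => (hG.smooth i j).mono h, fun i j => (hG.smooth_inv i j).mono h,
    fun i j q hq => hG.symm i j q (h hq), fun i j q hq => hG.symm_inv i j q (h hq),
    fun i j q hq => hG.inv_mul i j q (h hq)⟩

/-- Contraction of `x_k G_{ij} - x_j G_{ik}` with the inverse metric. -/
theorem IsMetricOn.contract (hG : IsMetricOn Ω G γ) {q : Model n} (hq : q ∈ Ω) (x : Fin n → ℝ)
    (k : Fin n) :
    ∑ i, ∑ j, γ i j q * (G i j q * x k - G i k q * x j) = ((n : ℝ) - 1) * x k := by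
  have h1 : ∑ i, ∑ j, γ i j q * G i j q = n := by
    have : ∀ i, ∑ j, γ i j q * G i j q = 1 := fun i => by
      have := hG.inv_mul i i q hq
      rw [if_pos rfl] at this
      rw [← this]
      exact Finset.sum_congr rfl fun j _ => by rw [hG.symm i j q hq]
    simp [this]
  have h2 : ∑ i, ∑ j, γ i j q * (G i k q * x j) = x k := by
    rw [Finset.sum_comm]
    have : ∀ j, ∑ i, γ i j q * (G i k q * x j) = (if j = k then 1 else 0) * x j := fun j => by
      rw [← hG.inv_mul j k q hq, Finset.sum_mul]
      exact Finset.sum_congr rfl fun i _ => by rw [hG.symm_inv i j q hq]; ring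
    simp [this]
  calc ∑ i, ∑ j, γ i j q * (G i j q * x k - G i k q * x j)
      = (∑ i, ∑ j, γ i j q * G i j q) * x k - ∑ i, ∑ j, γ i j q * (G i k q * x j) := by
        simp only [Finset.sum_mul, ← Finset.sum_sub_distrib]
        exact Finset.sum_congr rfl fun i _ => Finset.sum_congr rfl fun j _ => by ring
    _ = _ := by rw [h1, h2]; ring

/-- The integrability condition of the structure equation: equality of the third derivatives
`∂ₖ∂ⱼ∂ᵢ f` and `∂ⱼ∂ₖ∂ᵢ f`. -/
theorem IsLocalSolution.integrability (hG : IsMetricOn Ω G γ)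
    (hA : ∀ i j m, ContDiffOn ℝ ∞ (A i j m) Ω) {f h : Model n → ℝ}
    (hf : IsLocalSolution Ω G A f h) {q : Model n} (hq : q ∈ Ω) (i j k : Fin n) :
    G i j q * pd k h q - G i k q * pd j h q
      = ∑ m, gradCoeff A i j k m q * pd m f q + traceCoeff G A i j k q * h q := by
  have hΩ := hG.isOpen
  have hu := fun m => (hf.smooth.pd hΩ m).differentiableAt_of_isOpen hΩ hq
  have hh := hf.smooth_trace.differentiableAt_of_isOpen hΩ hq
  have hA' := fun i j m => (hA i j m).differentiableAt_of_isOpen hΩ hq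
  have hG' := fun i j => (hG.smooth i j).differentiableAt_of_isOpen hΩ hq
  have key : ∀ j k, pd k (pd j (pd i f)) q
      = ∑ m, (pd k (A j i m) q + ∑ l, A j i l q * A k l m q) * pd m f q
        + (∑ m, A j i m q * G k m q) * h q + pd k (G j i) q * h q + G j i q * pd k h q := by
    intro j k
    have hev : pd j (pd i f) =ᶠ[𝓝 q] fun x => ∑ m, A j i m x * pd m f x + G j i x * h x := by
      filter_upwards [hΩ.mem_nhds hq] with x hx using hf.eq x hx j i
    rw [pd_congr k hev, pd_add k (by fun_prop) (by fun_prop), pd_mul k (hG' _ _) hh,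
      pd_sum_mul _ k (fun m => hA' j i m) hu]
    simp only [hf.eq q hq, mul_add, add_mul, Finset.sum_add_distrib, Finset.mul_sum,
      Finset.sum_mul]
    rw [Finset.sum_comm (f := fun x y => A j i x q * (A k x y q * pd y f q))]
    simp only [mul_assoc, add_assoc]
  have hc : pd k (pd j (pd i f)) q = pd j (pd k (pd i f)) q :=
    pd_comm ((hf.smooth.pd hΩ i).contDiffAt (hΩ.mem_nhds hq)) k j
  rw [key, key] at hc
  have e : ∑ m, gradCoeff A i j k m q * pd m f q
      = ∑ m, (pd j (A k i m) q + ∑ l, A k i l q * A j l m q) * pd m f q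
        - ∑ m, (pd k (A j i m) q + ∑ l, A j i l q * A k l m q) * pd m f q := by
    rw [← Finset.sum_sub_distrib]
    refine Finset.sum_congr rfl fun m _ => ?_
    rw [gradCoeff, Finset.sum_sub_distrib]; ring
  rw [e, traceCoeff, Finset.sum_sub_distrib, hG.symm i j q hq, hG.symm i k q hq]
  linarith

/-- The structure equation forms, together with this equation, a closed first order system for
`f`, its gradient and `h`. -/
theorem IsLocalSolution.pd_trace (hn : 2 ≤ n) (hG : IsMetricOn Ω G γ)
    (hA : ∀ i j m, ContDiffOn ℝ ∞ (A i j m) Ω) {f h : Model n → ℝ}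
    (hf : IsLocalSolution Ω G A f h) {q : Model n} (hq : q ∈ Ω) (k : Fin n) :
    pd k h q = ∑ m, rCoeff γ A k m q * pd m f q + tCoeff G γ A k q * h q := by
  have hn' : (n : ℝ) - 1 ≠ 0 := by
    have : (2 : ℝ) ≤ n := by exact_mod_cast hn
    linarith
  have h1 := hG.contract hq (fun k => pd k h q) k
  simp only [hf.integrability hG hA hq] at h1
  refine mul_left_cancel₀ hn' ?_
  rw [← h1]
  have e1 : ∀ m, ((n : ℝ) - 1) * (rCoeff γ A k m q * pd m f q)
      = ∑ i, ∑ j, γ i j q * (gradCoeff A i j k m q * pd m f q) := fun m => by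
    rw [rCoeff, mul_assoc, mul_inv_cancel_left₀ hn', Finset.sum_mul]
    simp only [Finset.sum_mul, mul_assoc]
  have e2 : ((n : ℝ) - 1) * (tCoeff G γ A k q * h q)
      = ∑ i, ∑ j, γ i j q * (traceCoeff G A i j k q * h q) := by
    rw [tCoeff, mul_assoc, mul_inv_cancel_left₀ hn', Finset.sum_mul]
    simp only [Finset.sum_mul, mul_assoc]
  rw [mul_add, Finset.mul_sum, e2, Finset.sum_congr rfl fun m _ => e1 m]
  simp only [mul_add, Finset.sum_add_distrib, Finset.mul_sum]
  congr 1
  symm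
  rw [Finset.sum_comm]
  exact Finset.sum_congr rfl fun i _ => Finset.sum_comm

theorem contDiffOn_gradCoeff (hΩ : IsOpen Ω) (hA : ∀ i j m, ContDiffOn ℝ ∞ (A i j m) Ω)
    (i j k m : Fin n) : ContDiffOn ℝ ∞ (gradCoeff A i j k m) Ω := by
  have := fun i j m l => (hA i j m).pd hΩ l
  unfold gradCoeff
  fun_prop

theorem contDiffOn_rCoeff (hG : IsMetricOn Ω G γ) (hA : ∀ i j m, ContDiffOn ℝ ∞ (A i j m) Ω)
    (k m : Fin n) : ContDiffOn ℝ ∞ (rCoeff γ A k m) Ω := by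
  have := contDiffOn_gradCoeff hG.isOpen hA
  have := hG.smooth_inv
  unfold rCoeff
  fun_prop

theorem contDiffOn_tCoeff (hG : IsMetricOn Ω G γ) (hA : ∀ i j m, ContDiffOn ℝ ∞ (A i j m) Ω)
    (k : Fin n) : ContDiffOn ℝ ∞ (tCoeff G γ A k) Ω := by
  have := fun i j l => (hG.smooth i j).pd hG.isOpen l
  have := hG.smooth_inv
  have := hG.smooth
  unfold tCoeff traceCoeff
  fun_prop

/-- A solution of the structure equation is determined by the values of `f`, its gradient and `h`
at a point. -/
theorem IsLocalSolution.eventually_eq_zero (hn : 2 ≤ n) (hG : IsMetricOn Ω G γ)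
    (hA : ∀ i j m, ContDiffOn ℝ ∞ (A i j m) Ω) {f h : Model n → ℝ}
    (hf : IsLocalSolution Ω G A f h) {q₀ : Model n} (hq : q₀ ∈ Ω) (h0 : f q₀ = 0)
    (h1 : ∀ m, pd m f q₀ = 0) (h2 : h q₀ = 0) : ∀ᶠ q in 𝓝 q₀, f q = 0 := by
  have hΩ := hG.isOpen
  have hnhds := hΩ.mem_nhds hq
  set w : Unit ⊕ Unit ⊕ Fin n → Model n → ℝ :=
    Sum.elim (fun _ => f) (Sum.elim (fun _ => h) fun m => pd m f) with hw
  have hO : ∀ c, w c =O[𝓝 q₀] fun q => (fun c => w c q) := fun c =>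
    isBigO_of_le _ fun q => norm_le_pi_norm (fun c => w c q) c
  have hOf := fun m => hO (Sum.inr (Sum.inr m))
  have hOh := hO (Sum.inr (Sum.inl ()))
  have hcont : ∀ {a : Model n → ℝ}, ContDiffOn ℝ ∞ a Ω → ContinuousAt a q₀ := fun ha =>
    ha.continuousOn.continuousAt hnhds
  have := eventually_eq_zero_of_pd_isBigO (w := w) (q₀ := q₀) ?_ ?_ ?_
  · filter_upwards [this] with q hq using hq (Sum.inl ())
  · rintro (_ | _ | m)
    · filter_upwards [hnhds] with q hq using hf.smooth.differentiableAt_of_isOpen hΩ hq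
    · filter_upwards [hnhds] with q hq using hf.smooth_trace.differentiableAt_of_isOpen hΩ hq
    · filter_upwards [hnhds] with q hq using (hf.smooth.pd hΩ m).differentiableAt_of_isOpen hΩ hq
  · rintro (_ | _ | m) i
    · exact hOf i
    · refine IsBigO.congr' ?_ ?_ EventuallyEq.rfl (f₁ := fun q =>
        ∑ m, rCoeff γ A i m q * pd m f q + tCoeff G γ A i q * h q)
      · refine IsBigO.add (.fun_sum fun m _ => ?_) ?_
        · exact (hcont (contDiffOn_rCoeff hG hA i m)).mul_isBigO (hOf m)
        · exact (hcont (contDiffOn_tCoeff hG hA i)).mul_isBigO hOh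
      · filter_upwards [hnhds] with q hq using (hf.pd_trace hn hG hA hq i).symm
    · refine IsBigO.congr' ?_ ?_ EventuallyEq.rfl (f₁ := fun q =>
        ∑ l, A i m l q * pd l f q + G i m q * h q)
      · refine IsBigO.add (.fun_sum fun l _ => ?_) ?_
        · exact (hcont (hA i m l)).mul_isBigO (hOf l)
        · exact (hcont (hG.smooth i m)).mul_isBigO hOh
      · filter_upwards [hnhds] with q hq using (hf.eq q hq i m).symm
  · rintro (_ | _ | m)
    exacts [h0, h2, h1 m]

/-- The gradients and the functions `h` of the solutions in a family satisfy no linear relation at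
`q`. -/
def HasFullJets {ι : Type*} (f h : ι → Model n → ℝ) (q : Model n) : Prop :=
  ∀ (v : Fin n → ℝ) (c : ℝ), (∀ a, ∑ m, v m * pd m (f a) q + c * h a q = 0) → v = 0 ∧ c = 0

/-- If there are enough solutions, then the integrability condition holds coefficientwise. -/
theorem coeff_eq_of_hasFullJets (hn : 2 ≤ n) (hG : IsMetricOn Ω G γ)
    (hA : ∀ i j m, ContDiffOn ℝ ∞ (A i j m) Ω) {ι : Type*} {f h : ι → Model n → ℝ}
    (hf : ∀ a, IsLocalSolution Ω G A (f a) (h a)) {q : Model n} (hq : q ∈ Ω)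
    (hjet : HasFullJets f h q) (i j k : Fin n) :
    (∀ m, G i j q * rCoeff γ A k m q - G i k q * rCoeff γ A j m q = gradCoeff A i j k m q) ∧
      G i j q * tCoeff G γ A k q - G i k q * tCoeff G γ A j q = traceCoeff G A i j k q := by
  have := hjet
    (fun m => G i j q * rCoeff γ A k m q - G i k q * rCoeff γ A j m q - gradCoeff A i j k m q)
    (G i j q * tCoeff G γ A k q - G i k q * tCoeff G γ A j q - traceCoeff G A i j k q) fun a => by
      have h1 := (hf a).integrability hG hA hq i j k
      rw [(hf a).pd_trace hn hG hA hq, (hf a).pd_trace hn hG hA hq] at h1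
      simp only [sub_mul, Finset.sum_sub_distrib, mul_assoc, ← Finset.mul_sum]
      linarith
  exact ⟨fun m => sub_eq_zero.1 (congrFun this.1 m), sub_eq_zero.1 this.2⟩

/-- The coefficients in the equation `∂ᵢ k_{jr} - ∂ⱼ k_{ir} = k_j{}^b P_{bir} - k_i{}^b P_{bjr}`
for the Killing tensors. -/
def pCoeff (G γ : Fin n → Fin n → Model n → ℝ) (A : Fin n → Fin n → Fin n → Model n → ℝ)
    (b i r : Fin n) (q : Model n) : ℝ :=
  ∑ m, γ b m q * pd i (G m r) q - ∑ l, ∑ m, γ b l q * (A i l m q * G m r q)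

/-- If there are enough solutions `f` with `d(K df) = 0`, then this condition holds
coefficientwise. -/
theorem pd_sub_pd_of_hasFullJets (hG : IsMetricOn Ω G γ)
    {ι : Type*} {f h : ι → Model n → ℝ}
    (hf : ∀ a, IsLocalSolution Ω G A (f a) (h a)) {q : Model n} (hq : q ∈ Ω)
    (hjet : HasFullJets f h q) {k : Fin n → Fin n → Model n → ℝ}
    (hk : ∀ i j, ContDiffOn ℝ ∞ (k i j) Ω) (hks : ∀ i j, k i j = k j i)
    (hBD : ∀ a i j,
      pd i (fun x => ∑ b, ∑ m, k j b x * γ b m x * pd m (f a) x) q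
        = pd j (fun x => ∑ b, ∑ m, k i b x * γ b m x * pd m (f a) x) q) (i j r : Fin n) :
    pd i (k j r) q - pd j (k i r) q
      = ∑ b, (k j b q * pCoeff G γ A b i r q - k i b q * pCoeff G γ A b j r q) := by
  have hΩ := hG.isOpen
  have hG' := fun i j => (hG.smooth i j).differentiableAt_of_isOpen hΩ hq
  have hγ' := fun i j => (hG.smooth_inv i j).differentiableAt_of_isOpen hΩ hq
  have hk' := fun i j => (hk i j).differentiableAt_of_isOpen hΩ hq
  -- `κ` is `k` with the second index raised; the equation is obtained for `κ` and then lowered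
  set κ : Fin n → Fin n → Model n → ℝ := fun j m x => ∑ b, k j b x * γ b m x with hκ
  have hκ' : ∀ i j, DifferentiableAt ℝ (κ i j) q := fun i j => by simp only [hκ]; fun_prop
  have hκG : ∀ j r, ∀ x ∈ Ω, ∑ m, κ j m x * G m r x = k j r x := by
    intro j r x hx
    simp only [hκ, Finset.sum_mul]
    rw [Finset.sum_comm]
    simp only [mul_assoc, ← Finset.mul_sum, hG.inv_mul _ _ x hx]
    simp
  have key : ∀ a i j, pd i (fun x => ∑ b, ∑ m, k j b x * γ b m x * pd m (f a) x) q
      = ∑ m, (pd i (κ j m) q + ∑ l, κ j l q * A i l m q) * pd m (f a) q + k j i q * h a q := by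
    intro a i j
    have hu := fun m => ((hf a).smooth.pd hΩ m).differentiableAt_of_isOpen hΩ hq
    have : (fun x => ∑ b, ∑ m, k j b x * γ b m x * pd m (f a) x)
        = fun x => ∑ m, κ j m x * pd m (f a) x := by
      funext x
      rw [Finset.sum_comm]
      simp only [hκ, Finset.sum_mul]
    rw [this, pd_sum_mul _ i (hκ' j) hu]
    simp only [(hf a).eq q hq, mul_add, add_mul, Finset.sum_add_distrib, Finset.mul_sum,
      Finset.sum_mul]
    rw [Finset.sum_comm (f := fun x y => κ j x q * (A i x y q * pd y (f a) q)), ← hκG j i q hq,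
      Finset.sum_mul]
    simp only [mul_assoc, add_assoc, hG.symm i _ q hq]
  have hmix : ∀ m, (pd i (κ j m) q + ∑ l, κ j l q * A i l m q)
      = pd j (κ i m) q + ∑ l, κ i l q * A j l m q := by
    have := hjet (fun m => (pd i (κ j m) q + ∑ l, κ j l q * A i l m q)
      - (pd j (κ i m) q + ∑ l, κ i l q * A j l m q)) 0 fun a => by
        have h1 := hBD a i j
        rw [key, key, hks j i] at h1
        simp only [sub_mul, Finset.sum_sub_distrib]
        linarith
    exact fun m => sub_eq_zero.1 (congrFun this.1 m)
  have hlow : ∀ i j, pd i (k j r) q = ∑ m, (pd i (κ j m) q + ∑ l, κ j l q * A i l m q) * G m r q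
      + ∑ b, k j b q * pCoeff G γ A b i r q := by
    intro i j
    have hev : k j r =ᶠ[𝓝 q] fun x => ∑ m, κ j m x * G m r x := by
      filter_upwards [hΩ.mem_nhds hq] with x hx using (hκG j r x hx).symm
    rw [pd_congr i hev, pd_sum_mul _ i (hκ' j) (fun m => hG' m r)]
    have e : ∑ b, k j b q * pCoeff G γ A b i r q
        = ∑ m, κ j m q * pd i (G m r) q - ∑ m, (∑ l, κ j l q * A i l m q) * G m r q := by
      simp only [hκ, pCoeff, mul_sub, Finset.sum_sub_distrib, Finset.sum_mul, Finset.mul_sum]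
      congr 1
      · rw [Finset.sum_comm]
        exact Finset.sum_congr rfl fun _ _ => Finset.sum_congr rfl fun _ _ => by ring
      · have : ∀ b, ∑ l, ∑ m, k j b q * (γ b l q * (A i l m q * G m r q))
            = ∑ m, ∑ l, k j b q * γ b l q * A i l m q * G m r q := fun b => by
          rw [Finset.sum_comm]
          exact Finset.sum_congr rfl fun _ _ => Finset.sum_congr rfl fun _ _ => by ring
        simp only [this]
        rw [Finset.sum_comm]
        exact Finset.sum_congr rfl fun _ _ => Finset.sum_comm
    rw [e]
    simp only [add_mul, Finset.sum_add_distrib]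
    ring
  rw [hlow, hlow, Finset.sum_sub_distrib]
  simp only [hmix]
  ring

end Local

/-! ### The Killing equation -/

section Killing

variable {n : ℕ}

/-- Polarisation: the symmetrised coefficients of a vanishing cubic form are zero. -/
theorem sum_perm_eq_zero_of_cubic {c : Fin n → Fin n → Fin n → ℝ}
    (h : ∀ v : Fin n → ℝ, ∑ l, ∑ i, ∑ j, c l i j * (v l * v i * v j) = 0) (l i j : Fin n) :
    c l i j + c l j i + c i l j + c i j l + c j l i + c j i l = 0 := by
  set a : Fin n → ℝ := fun x => if l = x then 1 else 0 with ha
  set b : Fin n → ℝ := fun x => if i = x then 1 else 0 with hb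
  set d : Fin n → ℝ := fun x => if j = x then 1 else 0 with hd
  have key : ∑ x, ∑ y, ∑ z, c x y z * (a x * b y * d z + a x * d y * b z + b x * a y * d z
      + b x * d y * a z + d x * a y * b z + d x * b y * a z) = 0 := by
    -- the values at `a ± b ± d`, added with signs, leave only the terms linear in `a`, `b` and `d`
    have h4 : 4 * ∑ x, ∑ y, ∑ z, c x y z * (a x * b y * d z + a x * d y * b z + b x * a y * d z
        + b x * d y * a z + d x * a y * b z + d x * b y * a z)
        = ∑ x, ∑ y, ∑ z, c x y z * ((a + b + d) x * (a + b + d) y * (a + b + d) z)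
        - ∑ x, ∑ y, ∑ z, c x y z * ((a + b - d) x * (a + b - d) y * (a + b - d) z)
        - ∑ x, ∑ y, ∑ z, c x y z * ((a - b + d) x * (a - b + d) y * (a - b + d) z)
        + ∑ x, ∑ y, ∑ z, c x y z * ((a - b - d) x * (a - b - d) y * (a - b - d) z) := by
      simp only [← Finset.sum_sub_distrib, ← Finset.sum_add_distrib, Finset.mul_sum, Pi.add_apply,
        Pi.sub_apply]
      refine Finset.sum_congr rfl fun x _ => Finset.sum_congr rfl fun y _ =>
        Finset.sum_congr rfl fun z _ => ?_
      ring
    rw [h, h, h, h] at h4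
    linarith
  simpa [ha, hb, hd, mul_add, Finset.sum_add_distrib, ite_and] using key

/-- The Christoffel symbols of a metric, multiplied by two. -/
def sCoeff (G γ : Fin n → Fin n → Model n → ℝ) (b i j : Fin n) (q : Model n) : ℝ :=
  ∑ m, γ b m q * (pd i (G m j) q + pd j (G m i) q - pd m (G i j) q)

/-- The function `k_{ij} pⁱ pʲ + W` of `(q, p)`, where the index of `p` is raised by means of
`γ`. -/
def phase (γ k : Fin n → Fin n → Model n → ℝ) (W : Model n → ℝ) (z : Model n × Model n) : ℝ :=
  (∑ i, ∑ j, k i j z.1 * (∑ a, γ i a z.1 * z.2 a) * (∑ b, γ j b z.1 * z.2 b)) + W z.1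

variable {γ k : Fin n → Fin n → Model n → ℝ} {W : Model n → ℝ}

theorem pd_coord (l a : Fin n) (p : Model n) :
    pd l (fun p : Model n => p a) p = if a = l then 1 else 0 := by
  have : (fun p : Model n => p a) = EuclideanSpace.proj (𝕜 := ℝ) a := rfl
  rw [pd, this, ContinuousLinearMap.fderiv]
  simp

theorem fderiv_phase {q p : Model n} (hγ : ∀ i j, DifferentiableAt ℝ (γ i j) q)
    (hk : ∀ i j, DifferentiableAt ℝ (k i j) q) (hW : DifferentiableAt ℝ W q) (l : Fin n) :
    fderiv ℝ (phase γ k W) (q, p) (EuclideanSpace.single l 1, 0)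
      = ∑ i, ∑ j, (pd l (k i j) q * (∑ a, γ i a q * p a) * (∑ b, γ j b q * p b)
        + k i j q * ((∑ a, pd l (γ i a) q * p a) * (∑ b, γ j b q * p b)
          + (∑ a, γ i a q * p a) * (∑ b, pd l (γ j b) q * p b))) + pd l W q
    ∧ fderiv ℝ (phase γ k W) (q, p) (0, EuclideanSpace.single l 1)
      = ∑ i, ∑ j, k i j q * (γ i l q * (∑ b, γ j b q * p b) + (∑ a, γ i a q * p a) * γ j l q) := by
  have hp : ∀ (a : Fin n) (p : Model n), DifferentiableAt ℝ (fun p : Model n => p a) p :=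
    fun a p => (EuclideanSpace.proj (𝕜 := ℝ) a).differentiableAt
  have hd : DifferentiableAt ℝ (phase γ k W) (q, p) := by
    have h1 : ∀ i j, DifferentiableAt ℝ (fun z : Model n × Model n => γ i j z.1) (q, p) :=
      fun i j => DifferentiableAt.comp (q, p) (hγ i j) differentiableAt_fst
    have h2 : ∀ i j, DifferentiableAt ℝ (fun z : Model n × Model n => k i j z.1) (q, p) :=
      fun i j => DifferentiableAt.comp (q, p) (hk i j) differentiableAt_fst
    have h3 : DifferentiableAt ℝ (fun z : Model n × Model n => W z.1) (q, p) :=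
      DifferentiableAt.comp (q, p) hW differentiableAt_fst
    have h4 : ∀ a, DifferentiableAt ℝ (fun z : Model n × Model n => z.2 a) (q, p) :=
      fun a => by fun_prop
    unfold phase
    fun_prop
  constructor
  · have h1 : HasFDerivAt (fun x : Model n => (x, p)) (ContinuousLinearMap.inl ℝ _ _) q :=
      hasFDerivAt_prodMk_left q p
    have h2 : pd l (fun x => phase γ k W (x, p)) q
        = fderiv ℝ (phase γ k W) (q, p) (EuclideanSpace.single l 1, 0) := by
      have := (hd.hasFDerivAt.comp q h1).fderiv
      rw [pd, show (fun x => phase γ k W (x, p)) = phase γ k W ∘ fun x => (x, p) from rfl, this]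
      simp
    rw [← h2]
    have hy : ∀ i, DifferentiableAt ℝ (fun x => ∑ a, γ i a x * p a) q := by fun_prop
    have hpy : ∀ i, pd l (fun x => ∑ a, γ i a x * p a) q = ∑ a, pd l (γ i a) q * p a := by
      intro i
      rw [pd_sum_mul _ l (hγ i) fun _ => differentiableAt_const _]
      simp [pd_const]
    unfold phase
    dsimp only
    rw [pd_add l (by fun_prop) hW, pd_sum _ l (by fun_prop)]
    congr 1
    refine Finset.sum_congr rfl fun i _ => ?_
    rw [pd_sum _ l (by fun_prop)]
    refine Finset.sum_congr rfl fun j _ => ?_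
    rw [pd_mul l (by fun_prop) (hy j), pd_mul l (hk i j) (hy i), hpy, hpy]
    ring
  · have h1 : HasFDerivAt (fun x : Model n => (q, x)) (ContinuousLinearMap.inr ℝ _ _) p :=
      hasFDerivAt_prodMk_right q p
    have h2 : pd l (fun x => phase γ k W (q, x)) p
        = fderiv ℝ (phase γ k W) (q, p) (0, EuclideanSpace.single l 1) := by
      have := (hd.hasFDerivAt.comp p h1).fderiv
      rw [pd, show (fun x => phase γ k W (q, x)) = phase γ k W ∘ fun x => (q, x) from rfl, this]
      simp
    rw [← h2]
    have hy : ∀ i, DifferentiableAt ℝ (fun x : Model n => ∑ a, γ i a q * x a) p := by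
      fun_prop
    have hpy : ∀ i, pd l (fun x : Model n => ∑ a, γ i a q * x a) p = γ i l q := by
      intro i
      rw [pd_sum_mul _ l (fun _ => differentiableAt_const _) fun a => hp a p]
      simp [pd_const, pd_coord]
    unfold phase
    dsimp only
    rw [pd_add l (by fun_prop) (by fun_prop), pd_const, add_zero, pd_sum _ l (by fun_prop)]
    refine Finset.sum_congr rfl fun i _ => ?_
    rw [pd_sum _ l (by fun_prop)]
    refine Finset.sum_congr rfl fun j _ => ?_
    rw [pd_mul l (by fun_prop) (hy j), pd_const_mul l _ (hy i), hpy, hpy]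
    ring

/-- The derivative of the inverse matrix, contracted with the matrix. -/
theorem IsMetricOn.pd_inv_mul {Ω : Set (Model n)} {G : Fin n → Fin n → Model n → ℝ}
    (hG : IsMetricOn Ω G γ) {q : Model n} (hq : q ∈ Ω) (l i b : Fin n) :
    ∑ a, pd l (γ i a) q * G a b q = -∑ a, γ i a q * pd l (G a b) q := by
  have hev : (fun x => ∑ a, γ i a x * G a b x) =ᶠ[𝓝 q] fun _ => if i = b then 1 else 0 := by
    filter_upwards [hG.isOpen.mem_nhds hq] with x hx using hG.inv_mul i b x hx
  have := pd_congr l hev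
  rw [pd_const, pd_sum_mul _ l
    (fun a => (hG.smooth_inv i a).differentiableAt_of_isOpen hG.isOpen hq)
    (fun a => (hG.smooth a b).differentiableAt_of_isOpen hG.isOpen hq),
    Finset.sum_add_distrib] at this
  linarith

/-- The equations contained in the vanishing of the Poisson bracket of `k + W` with `G + V`: the
Killing equation for `k`, and `dW = k dV`. -/
theorem killing_of_poisson {Ω : Set (Model n)} {G : Fin n → Fin n → Model n → ℝ} {V : Model n → ℝ}
    (hG : IsMetricOn Ω G γ) {q : Model n} (hq : q ∈ Ω) (hk : ∀ i j, DifferentiableAt ℝ (k i j) q)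
    (hks : ∀ i j, k i j = k j i) (hW : DifferentiableAt ℝ W q) (hV : DifferentiableAt ℝ V q)
    (h : ∀ p, poisson (phase γ k W) (phase γ G V) (q, p) = 0) :
    (∀ l i j, pd l (k i j) q + pd i (k j l) q + pd j (k l i) q
      = ∑ b, (k l b q * sCoeff G γ b i j q + k i b q * sCoeff G γ b j l q
        + k j b q * sCoeff G γ b l i q)) ∧
    ∀ l, pd l W q = ∑ b, ∑ m, k l b q * γ b m q * pd m V q := by
  have hΩ := hG.isOpen
  have hG' := fun i j => (hG.smooth i j).differentiableAt_of_isOpen hΩ hq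
  have hγ' := fun i j => (hG.smooth_inv i j).differentiableAt_of_isOpen hΩ hq
  set R : Fin n → Fin n → Fin n → ℝ := fun l i b => ∑ m, γ i m q * pd l (G m b) q with hR
  set c : Fin n → Fin n → Fin n → ℝ := fun l i j => 2 * (pd l (k i j) q
    - ∑ b, k j b q * R l b i - ∑ b, k i b q * R l b j
    + ∑ b, k l b q * ∑ m, γ b m q * pd m (G i j) q) with hc
  set d : Fin n → ℝ := fun l => 2 * (pd l W q - ∑ b, ∑ m, k l b q * γ b m q * pd m V q) with hd
  -- the Poisson bracket at the momentum `p = G v`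
  have key : ∀ v : Fin n → ℝ,
      ∑ l, ∑ i, ∑ j, c l i j * (v l * v i * v j) + ∑ l, d l * v l = 0 := by
    intro v
    set p : Model n := WithLp.toLp 2 fun a => ∑ b, G a b q * v b with hp
    have hpa : ∀ a, p a = ∑ b, G a b q * v b := fun a => rfl
    have hy : ∀ i, ∑ a, γ i a q * p a = v i := by
      intro i
      simp only [hpa, Finset.mul_sum]
      rw [Finset.sum_comm]
      simp only [← mul_assoc, ← Finset.sum_mul, hG.inv_mul _ _ q hq]
      simp
    have hdy : ∀ l i, ∑ a, pd l (γ i a) q * p a = -∑ b, R l i b * v b := by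
      intro l i
      simp only [hpa, Finset.mul_sum]
      rw [Finset.sum_comm]
      simp only [← mul_assoc, ← Finset.sum_mul, hG.pd_inv_mul hq, neg_mul, Finset.sum_neg_distrib,
        hR]
    have hGR : ∀ l j b, ∑ i, G i j q * R l i b = pd l (G j b) q := by
      intro l j b
      simp only [hR, Finset.mul_sum]
      rw [Finset.sum_comm]
      simp only [← mul_assoc, ← Finset.sum_mul, hG.symm _ j q hq, hG.sum_mul_inv hq]
      simp
    have hGR' : ∀ l, ∑ i, ∑ j, G i j q * ((-∑ b, R l i b * v b) * v j)
        = -∑ i, ∑ j, pd l (G i j) q * v i * v j := by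
      intro l
      rw [Finset.sum_comm]
      simp only [← hGR, Finset.sum_mul, Finset.mul_sum, neg_mul, mul_neg, Finset.sum_neg_distrib]
      refine congrArg _ (Finset.sum_congr rfl fun j _ => ?_)
      rw [Finset.sum_comm]
      exact Finset.sum_congr rfl fun _ _ => Finset.sum_congr rfl fun _ _ => by ring
    have hGR'' : ∀ l, ∑ i, ∑ j, G i j q * (v i * (-∑ b, R l j b * v b))
        = -∑ i, ∑ j, pd l (G i j) q * v i * v j := by
      intro l
      rw [← hGR' l, Finset.sum_comm]
      exact Finset.sum_congr rfl fun i _ => Finset.sum_congr rfl fun j _ => by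
        rw [hG.symm j i q hq]; ring
    have h0 := h p
    simp only [poisson, (fderiv_phase hγ' hk hW _).1, (fderiv_phase hγ' hk hW _).2,
      (fderiv_phase hγ' hG' hV _).1, (fderiv_phase hγ' hG' hV _).2, hy, hdy] at h0
    have hHq : ∀ l, ∑ i, ∑ j, (pd l (G i j) q * v i * v j
        + G i j q * ((-∑ b, R l i b * v b) * v j + v i * (-∑ b, R l j b * v b))) + pd l V q
        = pd l V q - ∑ i, ∑ j, pd l (G i j) q * v i * v j := by
      intro l
      simp only [mul_add, Finset.sum_add_distrib, hGR', hGR'']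
      ring
    have hHp : ∀ l, ∑ i, ∑ j, G i j q * (γ i l q * v j + v i * γ j l q) = 2 * v l := by
      intro l
      have a1 : ∑ i, ∑ j, G i j q * (γ i l q * v j) = v l := by
        rw [Finset.sum_comm]
        simp only [← mul_assoc, ← Finset.sum_mul]
        have : ∀ j, ∑ i, G i j q * γ i l q = if j = l then 1 else 0 := fun j => by
          rw [← hG.sum_mul_inv hq]
          exact Finset.sum_congr rfl fun i _ => by rw [hG.symm i j q hq]
        simp [this]
      have a2 : ∑ i, ∑ j, G i j q * (v i * γ j l q) = v l := by
        have : ∀ i, ∑ j, G i j q * (v i * γ j l q) = (if i = l then 1 else 0) * v i := fun i => by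
          rw [← hG.sum_mul_inv hq, Finset.sum_mul]
          exact Finset.sum_congr rfl fun j _ => by ring
        simp [this]
      simp only [mul_add, Finset.sum_add_distrib, a1, a2]
      ring
    have hFp : ∀ l, ∑ i, ∑ j, k i j q * (γ i l q * v j + v i * γ j l q)
        = 2 * ∑ j, ∑ b, k j b q * γ b l q * v j := by
      intro l
      simp only [mul_add, Finset.sum_add_distrib, two_mul]
      congr 1
      · rw [Finset.sum_comm]
        exact Finset.sum_congr rfl fun j _ => Finset.sum_congr rfl fun b _ => by
          rw [hks b j]; ring
      · exact Finset.sum_congr rfl fun j _ => Finset.sum_congr rfl fun b _ => by ring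
    simp only [hHq, hHp, hFp] at h0
    have hE : ∀ l, ∑ i, ∑ j, (pd l (k i j) q * v i * v j
        + k i j q * ((-∑ b, R l i b * v b) * v j + v i * (-∑ b, R l j b * v b)))
        = ∑ i, ∑ j, (pd l (k i j) q - ∑ b, k j b q * R l b i - ∑ b, k i b q * R l b j)
          * (v i * v j) := by
      intro l
      have b1 : ∑ i, ∑ j, k i j q * ((-∑ b, R l i b * v b) * v j)
          = -∑ i, ∑ j, (∑ b, k j b q * R l b i) * (v i * v j) := by
        simp only [neg_mul, mul_neg, Finset.sum_neg_distrib, Finset.sum_mul, Finset.mul_sum]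
        refine congrArg _ ?_
        calc ∑ i, ∑ j, ∑ b, k i j q * (R l i b * v b * v j)
            = ∑ i, ∑ b, ∑ j, k i j q * (R l i b * v b * v j) :=
              Finset.sum_congr rfl fun _ _ => Finset.sum_comm
          _ = ∑ b, ∑ i, ∑ j, k i j q * (R l i b * v b * v j) := Finset.sum_comm
          _ = ∑ b, ∑ j, ∑ i, k i j q * (R l i b * v b * v j) :=
              Finset.sum_congr rfl fun _ _ => Finset.sum_comm
          _ = _ := Finset.sum_congr rfl fun x _ => Finset.sum_congr rfl fun y _ =>
              Finset.sum_congr rfl fun z _ => by rw [hks y z]; ring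
      have b2 : ∑ i, ∑ j, k i j q * (v i * (-∑ b, R l j b * v b))
          = -∑ i, ∑ j, (∑ b, k i b q * R l b j) * (v i * v j) := by
        simp only [mul_neg, Finset.sum_neg_distrib, Finset.sum_mul, Finset.mul_sum]
        refine congrArg _ (Finset.sum_congr rfl fun i _ => ?_)
        rw [Finset.sum_comm]
        exact Finset.sum_congr rfl fun _ _ => Finset.sum_congr rfl fun _ _ => by ring
      simp only [mul_add, sub_mul, Finset.sum_add_distrib, Finset.sum_sub_distrib, b1, b2,
        mul_assoc]
      ring
    have hV' : ∑ l, pd l V q * (2 * ∑ j, ∑ b, k j b q * γ b l q * v j)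
        = ∑ j, (2 * ∑ b, ∑ m, k j b q * γ b m q * pd m V q) * v j := by
      simp only [Finset.mul_sum, Finset.sum_mul]
      rw [Finset.sum_comm]
      refine Finset.sum_congr rfl fun j _ => ?_
      rw [Finset.sum_comm]
      exact Finset.sum_congr rfl fun _ _ => Finset.sum_congr rfl fun _ _ => by ring
    have hS' : ∑ l, (∑ i, ∑ j, pd l (G i j) q * v i * v j)
          * (2 * ∑ a, ∑ b, k a b q * γ b l q * v a)
        = ∑ a, ∑ i, ∑ j, (2 * ∑ b, k a b q * ∑ m, γ b m q * pd m (G i j) q)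
          * (v a * v i * v j) := by
      calc _ = ∑ l, ∑ a, ∑ i, ∑ j, ∑ b,
              2 * (k a b q * (γ b l q * pd l (G i j) q)) * (v a * v i * v j) := by
            refine Finset.sum_congr rfl fun l _ => ?_
            simp only [Finset.mul_sum]
            refine Finset.sum_congr rfl fun a _ => ?_
            simp only [Finset.sum_mul]
            rw [Finset.sum_comm]
            refine Finset.sum_congr rfl fun i _ => ?_
            rw [Finset.sum_comm]
            exact Finset.sum_congr rfl fun j _ => Finset.sum_congr rfl fun b _ => by ring
        _ = _ := by
            rw [Finset.sum_comm]
            refine Finset.sum_congr rfl fun a _ => ?_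
            rw [Finset.sum_comm]
            refine Finset.sum_congr rfl fun i _ => ?_
            rw [Finset.sum_comm]
            refine Finset.sum_congr rfl fun j _ => ?_
            rw [Finset.sum_comm]
            simp only [Finset.mul_sum, Finset.sum_mul]
    simp only [hE] at h0
    simp only [sub_mul, add_mul, Finset.sum_add_distrib, Finset.sum_sub_distrib] at h0
    rw [hV', hS'] at h0
    rw [← h0]
    have e1 : ∀ l, (∑ i, ∑ j, pd l (k i j) q * (v i * v j)) * (2 * v l)
        = ∑ i, ∑ j, 2 * pd l (k i j) q * (v l * v i * v j) := fun l => by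
      simp only [Finset.sum_mul]
      exact Finset.sum_congr rfl fun _ _ => Finset.sum_congr rfl fun _ _ => by ring
    have e2 : ∀ l, (∑ i, ∑ j, (∑ b, k j b q * R l b i) * (v i * v j)) * (2 * v l)
        = ∑ i, ∑ j, 2 * (∑ b, k j b q * R l b i) * (v l * v i * v j) := fun l => by
      simp only [Finset.sum_mul _ _ (2 * v l)]
      exact Finset.sum_congr rfl fun _ _ => Finset.sum_congr rfl fun _ _ => by ring
    have e3 : ∀ l, (∑ i, ∑ j, (∑ b, k i b q * R l b j) * (v i * v j)) * (2 * v l)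
        = ∑ i, ∑ j, 2 * (∑ b, k i b q * R l b j) * (v l * v i * v j) := fun l => by
      simp only [Finset.sum_mul _ _ (2 * v l)]
      exact Finset.sum_congr rfl fun _ _ => Finset.sum_congr rfl fun _ _ => by ring
    have e4 : ∀ l, pd l W q * (2 * v l) = 2 * pd l W q * v l := fun l => by ring
    simp only [e1, e2, e3, e4, hc, hd, mul_sub, mul_add, sub_mul, add_mul,
      Finset.sum_add_distrib, Finset.sum_sub_distrib]
    ring
  -- replacing `v` by `2 v` separates the cubic part from the linear part
  have hhom : ∀ v : Fin n → ℝ, ∑ l, ∑ i, ∑ j, c l i j * (v l * v i * v j) = 0 ∧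
      ∑ l, d l * v l = 0 := by
    intro v
    have h1 := key v
    have h2 := key fun i => 2 * v i
    have e1 : ∑ l, ∑ i, ∑ j, c l i j * (2 * v l * (2 * v i) * (2 * v j))
        = 8 * ∑ l, ∑ i, ∑ j, c l i j * (v l * v i * v j) := by
      simp only [Finset.mul_sum]
      exact Finset.sum_congr rfl fun _ _ => Finset.sum_congr rfl fun _ _ =>
        Finset.sum_congr rfl fun _ _ => by ring
    have e2 : ∑ l, d l * (2 * v l) = 2 * ∑ l, d l * v l := by
      simp only [Finset.mul_sum]
      exact Finset.sum_congr rfl fun _ _ => by ring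
    rw [e1, e2] at h2
    constructor <;> linarith
  refine ⟨fun l i j => ?_, fun l => ?_⟩
  · have hGs : ∀ m i j, pd m (G i j) q = pd m (G j i) q := fun m i j => pd_congr m <| by
      filter_upwards [hΩ.mem_nhds hq] with x hx using hG.symm i j x hx
    have hs : ∀ b i j, sCoeff G γ b i j q = R i b j + R j b i - ∑ m, γ b m q * pd m (G i j) q := by
      intro b i j
      simp only [sCoeff, hR, mul_sub, mul_add, Finset.sum_add_distrib, Finset.sum_sub_distrib]
    have h6 := sum_perm_eq_zero_of_cubic (fun v => (hhom v).1) l i j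
    simp only [hc, hs] at h6 ⊢
    simp only [hks i l, hks j i, hks j l, hGs _ i l, hGs _ j i, hGs _ j l] at h6 ⊢
    simp only [mul_add, mul_sub, Finset.sum_add_distrib, Finset.sum_sub_distrib] at h6 ⊢
    linarith
  · have := (hhom fun x => if l = x then 1 else 0).2
    simp [hd] at this
    linarith

end Killing

/-! ### Comparison of two systems in coordinates -/

section Comparison

variable {n : ℕ}

/-- The coefficients `Γ^m_{ij} + T_{ij}{}^m` of the structure equation in coordinates. -/
def connCoeff (γ : Fin n → Fin n → Model n → ℝ) (Γ T : Fin n → Fin n → Fin n → Model n → ℝ)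
    (i j m : Fin n) (q : Model n) : ℝ :=
  Γ i j m q + ∑ a, T i j a q * γ a m q

/-- The equations in coordinates satisfied by the structure tensor `T` and the Killing tensors `k α`
of a non-degenerate superintegrable system: the algebraic properties of `T`, the two integrability
conditions of the structure equation, and the prolonged Killing equation. -/
structure IsLocalSystem {ι : Type*} (Ω : Set (Model n)) (G γ : Fin n → Fin n → Model n → ℝ)
    (Γ T : Fin n → Fin n → Fin n → Model n → ℝ) (k : ι → Fin n → Fin n → Model n → ℝ) : Prop where
  smooth : ∀ i j a, ContDiffOn ℝ ∞ (T i j a) Ω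
  smooth_killing : ∀ α i j, ContDiffOn ℝ ∞ (k α i j) Ω
  symm : ∀ i j a, T i j a = T j i a
  trace_free : ∀ q ∈ Ω, ∀ a, ∑ i, ∑ j, γ i j q * T i j a q = 0
  symm_killing : ∀ α i j, k α i j = k α j i
  grad_eq : ∀ q ∈ Ω, ∀ i j a m,
    G i j q * rCoeff γ (connCoeff γ Γ T) a m q - G i a q * rCoeff γ (connCoeff γ Γ T) j m q
      = gradCoeff (connCoeff γ Γ T) i j a m q
  trace_eq : ∀ q ∈ Ω, ∀ i j a,
    G i j q * tCoeff G γ (connCoeff γ Γ T) a q - G i a q * tCoeff G γ (connCoeff γ Γ T) j q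
      = traceCoeff G (connCoeff γ Γ T) i j a q
  killing_eq : ∀ α, ∀ q ∈ Ω, ∀ i j m, 3 * pd i (k α j m) q
    = ∑ b, (k α i b q * (sCoeff G γ b j m q - pCoeff G γ (connCoeff γ Γ T) b j m q
          - pCoeff G γ (connCoeff γ Γ T) b m j q)
        + k α j b q * (sCoeff G γ b m i q + pCoeff G γ (connCoeff γ Γ T) b i m q)
        + k α m b q * (sCoeff G γ b i j q + pCoeff G γ (connCoeff γ Γ T) b i j q))

variable {ι : Type*} {Ω : Set (Model n)} {G γ : Fin n → Fin n → Model n → ℝ}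
  {Γ T T' : Fin n → Fin n → Fin n → Model n → ℝ} {k k' : ι → Fin n → Fin n → Model n → ℝ}

theorem contDiffOn_connCoeff (hG : IsMetricOn Ω G γ)
    (hΓ : ∀ i j m, ContDiffOn ℝ ∞ (Γ i j m) Ω) (hT : ∀ i j a, ContDiffOn ℝ ∞ (T i j a) Ω)
    (i j m : Fin n) : ContDiffOn ℝ ∞ (connCoeff γ Γ T i j m) Ω := by
  have := hG.smooth_inv
  unfold connCoeff
  fun_prop

theorem contDiffOn_pCoeff {A : Fin n → Fin n → Fin n → Model n → ℝ} (hG : IsMetricOn Ω G γ)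
    (hA : ∀ i j m, ContDiffOn ℝ ∞ (A i j m) Ω)
    (b i r : Fin n) : ContDiffOn ℝ ∞ (pCoeff G γ A b i r) Ω := by
  have := hG.smooth_inv
  have := hG.smooth
  have := fun i j l => (hG.smooth i j).pd hG.isOpen l
  unfold pCoeff
  fun_prop

theorem contDiffOn_sCoeff (hG : IsMetricOn Ω G γ) (b i j : Fin n) :
    ContDiffOn ℝ ∞ (sCoeff G γ b i j) Ω := by
  have := hG.smooth_inv
  have := fun i j l => (hG.smooth i j).pd hG.isOpen l
  unfold sCoeff
  fun_prop

theorem connCoeff_sub (i j m : Fin n) (q : Model n) :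
    connCoeff γ Γ T i j m q - connCoeff γ Γ T' i j m q
      = ∑ a, γ a m q * (T i j a q - T' i j a q) := by
  simp only [connCoeff, add_sub_add_left_eq_sub, ← Finset.sum_sub_distrib]
  exact Finset.sum_congr rfl fun a _ => by ring

theorem connCoeff_sub_lower (hG : IsMetricOn Ω G γ) {q : Model n} (hq : q ∈ Ω) (i j r : Fin n) :
    ∑ m, (connCoeff γ Γ T i j m q - connCoeff γ Γ T' i j m q) * G m r q
      = T i j r q - T' i j r q := by
  simp only [connCoeff_sub, Finset.sum_mul]
  rw [Finset.sum_comm]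
  have : ∀ a, ∑ m, γ a m q * (T i j a q - T' i j a q) * G m r q
      = (if a = r then 1 else 0) * (T i j a q - T' i j a q) := fun a => by
    rw [← hG.inv_mul a r q hq, Finset.sum_mul]
    exact Finset.sum_congr rfl fun _ _ => by ring
  simp [this]

theorem pCoeff_sub (hG : IsMetricOn Ω G γ) {q : Model n} (hq : q ∈ Ω) (b i r : Fin n) :
    pCoeff G γ (connCoeff γ Γ T) b i r q - pCoeff G γ (connCoeff γ Γ T') b i r q
      = -∑ a, γ b a q * (T i a r q - T' i a r q) := by
  simp only [pCoeff, ← connCoeff_sub_lower (Γ := Γ) (T := T) (T' := T') hG hq, sub_mul, mul_sub, Finset.mul_sum,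
    Finset.sum_sub_distrib]
  ring

theorem traceCoeff_sub (hG : IsMetricOn Ω G γ) {q : Model n} (hq : q ∈ Ω) (i j a : Fin n) :
    traceCoeff G (connCoeff γ Γ T) i j a q - traceCoeff G (connCoeff γ Γ T') i j a q
      = (T a i j q - T' a i j q) - (T j i a q - T' j i a q) := by
  simp only [traceCoeff, ← connCoeff_sub_lower (Γ := Γ) (T := T) (T' := T') hG hq, sub_mul,
    Finset.sum_sub_distrib, hG.symm j _ q hq, hG.symm a _ q hq]
  ring

/-- The prolonged Killing equations of two systems, subtracted. -/
theorem killing_sub (hG : IsMetricOn Ω G γ) (h : IsLocalSystem Ω G γ Γ T k)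
    (h' : IsLocalSystem Ω G γ Γ T' k') (α : ι) {q : Model n} (hq : q ∈ Ω) (i j m : Fin n) :
    3 * pd i (fun x => k α j m x - k' α j m x) q
      = ∑ b, ((sCoeff G γ b j m q - pCoeff G γ (connCoeff γ Γ T) b j m q
            - pCoeff G γ (connCoeff γ Γ T) b m j q) * (k α i b q - k' α i b q)
          + (sCoeff G γ b m i q + pCoeff G γ (connCoeff γ Γ T) b i m q)
            * (k α j b q - k' α j b q)
          + (sCoeff G γ b i j q + pCoeff G γ (connCoeff γ Γ T) b i j q)
            * (k α m b q - k' α m b q))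
        + ∑ b, ∑ a, γ b a q * (k' α i b q * ((T j a m q - T' j a m q) + (T m a j q - T' m a j q))
          - k' α j b q * (T i a m q - T' i a m q) - k' α m b q * (T i a j q - T' i a j q)) := by
  have hΩ := hG.isOpen
  rw [pd_sub i ((h.smooth_killing α j m).differentiableAt_of_isOpen hΩ hq)
    ((h'.smooth_killing α j m).differentiableAt_of_isOpen hΩ hq), mul_sub, h.killing_eq α q hq,
    h'.killing_eq α q hq, ← Finset.sum_sub_distrib, ← Finset.sum_add_distrib]
  refine Finset.sum_congr rfl fun b _ => ?_
  have e : ∑ a, γ b a q * (k' α i b q * ((T j a m q - T' j a m q) + (T m a j q - T' m a j q))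
        - k' α j b q * (T i a m q - T' i a m q) - k' α m b q * (T i a j q - T' i a j q))
      = k' α i b q * (∑ a, γ b a q * (T j a m q - T' j a m q)
          + ∑ a, γ b a q * (T m a j q - T' m a j q))
        - k' α j b q * ∑ a, γ b a q * (T i a m q - T' i a m q)
        - k' α m b q * ∑ a, γ b a q * (T i a j q - T' i a j q) := by
    simp only [Finset.mul_sum, ← Finset.sum_add_distrib, ← Finset.sum_sub_distrib, mul_add]
    exact Finset.sum_congr rfl fun a _ => by ring
  have p1 := pCoeff_sub (Γ := Γ) (T := T) (T' := T') hG hq b j m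
  have p2 := pCoeff_sub (Γ := Γ) (T := T) (T' := T') hG hq b m j
  have p3 := pCoeff_sub (Γ := Γ) (T := T) (T' := T') hG hq b i m
  have p4 := pCoeff_sub (Γ := Γ) (T := T) (T' := T') hG hq b i j
  rw [e]
  linear_combination (-k' α i b q) * p1 - k' α i b q * p2 + k' α j b q * p3 + k' α m b q * p4

/-- The differences of the components of the two systems. -/
def diffFamily (G γ : Fin n → Fin n → Model n → ℝ) (Γ T T' : Fin n → Fin n → Fin n → Model n → ℝ)
    (k k' : ι → Fin n → Fin n → Model n → ℝ) :
    (Fin n × Fin n × Fin n) ⊕ (ι × Fin n × Fin n) ⊕ Fin n → Model n → ℝ :=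
  Sum.elim (fun c q => T c.1 c.2.1 c.2.2 q - T' c.1 c.2.1 c.2.2 q)
    (Sum.elim (fun c q => k c.1 c.2.1 c.2.2 q - k' c.1 c.2.1 c.2.2 q)
      fun c q => tCoeff G γ (connCoeff γ Γ T) c q - tCoeff G γ (connCoeff γ Γ T') c q)

/-- The first derivatives of the differences of the structure tensors and of their trace parts,
together with the difference of the coefficients `r`. -/
def diffJet (G γ : Fin n → Fin n → Model n → ℝ) (Γ T T' : Fin n → Fin n → Fin n → Model n → ℝ)
    (q : Model n) : Jet n :=
  (fun i j a l => pd l (fun x => T i j a x - T' i j a x) q,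
   fun a l => pd l (fun x => tCoeff G γ (connCoeff γ Γ T) a x
     - tCoeff G γ (connCoeff γ Γ T') a x) q,
   fun a m => rCoeff γ (connCoeff γ Γ T) a m q - rCoeff γ (connCoeff γ Γ T') a m q)

/-- The first derivatives of the differences of the Killing tensors are dominated by the differences
of the components of the two systems, and so is the principal part of the equation between the second
derivatives: the prolonged Killing equation expresses `∂(k - k')` linearly in `k - k'` and `T - T'`,
and in its derivative only the terms with `∂(T - T')` are not of this kind. -/
theorem killing_isBigO [Fintype ι] (hG : IsMetricOn Ω G γ)
    (hΓ : ∀ i j m, ContDiffOn ℝ ∞ (Γ i j m) Ω)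
    (h : IsLocalSystem Ω G γ Γ T k) (h' : IsLocalSystem Ω G γ Γ T' k') {q₀ : Model n}
    (hq₀ : q₀ ∈ Ω) :
    (∀ α i j m, pd i (fun x => k α j m x - k' α j m x) =O[𝓝 q₀]
      fun q c => diffFamily G γ Γ T T' k k' c q) ∧
    ∀ α i j m l, (fun q =>
      killingSymbol (fun a b => γ a b q) (fun a b => k' α a b q) (diffJet G γ Γ T T' q).1 i j m l
      - killingSymbol (fun a b => γ a b q) (fun a b => k' α a b q) (diffJet G γ Γ T T' q).1 l j m i)
      =O[𝓝 q₀] fun q c => diffFamily G γ Γ T T' k k' c q := by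
  have hΩ := hG.isOpen
  have hnhds := hΩ.mem_nhds hq₀
  set w : Model n → ((Fin n × Fin n × Fin n) ⊕ (ι × Fin n × Fin n) ⊕ Fin n) → ℝ :=
    fun q c => diffFamily G γ Γ T T' k k' c q with hw
  have hO : ∀ c, (fun q => w q c) =O[𝓝 q₀] w := fun c =>
    isBigO_of_le _ fun q => norm_le_pi_norm (w q) c
  have hT : ∀ i j a, (fun q => T i j a q - T' i j a q) =O[𝓝 q₀] w :=
    fun i j a => hO (Sum.inl (i, j, a))
  have hk : ∀ α i j, (fun q => k α i j q - k' α i j q) =O[𝓝 q₀] w :=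
    fun α i j => hO (Sum.inr (Sum.inl (α, i, j)))
  have hcont : ∀ {a : Model n → ℝ}, ContDiffOn ℝ ∞ a Ω → ContinuousAt a q₀ := fun ha =>
    ha.continuousOn.continuousAt hnhds
  -- the coefficients of `k - k'` and the dependence on `T - T'` in the difference of the equations
  set X : Fin n → Fin n → Fin n → Model n → ℝ := fun b j m q => sCoeff G γ b j m q
    - pCoeff G γ (connCoeff γ Γ T) b j m q - pCoeff G γ (connCoeff γ Γ T) b m j q with hX
  set Y : Fin n → Fin n → Fin n → Model n → ℝ := fun b i m q => sCoeff G γ b m i q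
    + pCoeff G γ (connCoeff γ Γ T) b i m q with hY
  set Z : Fin n → Fin n → Fin n → Model n → ℝ := fun b i j q => sCoeff G γ b i j q
    + pCoeff G γ (connCoeff γ Γ T) b i j q with hZ
  have hA := contDiffOn_connCoeff hG hΓ h.smooth
  have hP := contDiffOn_pCoeff hG hA
  have hS := contDiffOn_sCoeff hG
  have hXs : ∀ b j m, ContDiffOn ℝ ∞ (X b j m) Ω := by fun_prop
  have hYs : ∀ b j m, ContDiffOn ℝ ∞ (Y b j m) Ω := by fun_prop
  have hZs : ∀ b j m, ContDiffOn ℝ ∞ (Z b j m) Ω := by fun_prop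
  have hTs := h.smooth
  have hTs' := h'.smooth
  have hks := h.smooth_killing
  have hks' := h'.smooth_killing
  have hγs := hG.smooth_inv
  set F : ι → Fin n → Fin n → Fin n → Model n → ℝ := fun α i j m q =>
    ∑ b, (X b j m q * (k α i b q - k' α i b q) + Y b i m q * (k α j b q - k' α j b q)
      + Z b i j q * (k α m b q - k' α m b q)) with hF
  set H : ι → Fin n → Fin n → Fin n → Model n → ℝ := fun α i j m q =>
    ∑ b, ∑ a, γ b a q * (k' α i b q * ((T j a m q - T' j a m q) + (T m a j q - T' m a j q))
      - k' α j b q * (T i a m q - T' i a m q) - k' α m b q * (T i a j q - T' i a j q)) with hH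
  have hFs : ∀ α i j m, ContDiffOn ℝ ∞ (F α i j m) Ω := by fun_prop
  have hHs : ∀ α i j m, ContDiffOn ℝ ∞ (H α i j m) Ω := by fun_prop
  have hpk : ∀ α i j m, ∀ q ∈ Ω, 3 * pd i (fun x => k α j m x - k' α j m x) q
      = F α i j m q + H α i j m q := fun α i j m q hq => killing_sub hG h h' α hq i j m
  have hFO : ∀ α i j m, F α i j m =O[𝓝 q₀] w := by
    intro α i j m
    refine .fun_sum fun b _ => IsBigO.add (IsBigO.add ?_ ?_) ?_
    · exact (hcont (hXs b j m)).mul_isBigO (hk α i b)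
    · exact (hcont (hYs b i m)).mul_isBigO (hk α j b)
    · exact (hcont (hZs b i j)).mul_isBigO (hk α m b)
  have hHO : ∀ α i j m, H α i j m =O[𝓝 q₀] w := by
    intro α i j m
    refine .fun_sum fun b _ => .fun_sum fun a _ => (hcont (hγs b a)).mul_isBigO ?_
    refine IsBigO.sub (IsBigO.sub ?_ ?_) ?_
    · exact (hcont (hks' α i b)).mul_isBigO ((hT j a m).add (hT m a j))
    · exact (hcont (hks' α j b)).mul_isBigO (hT i a m)
    · exact (hcont (hks' α m b)).mul_isBigO (hT i a j)
  have hdk : ∀ α i j m, pd i (fun x => k α j m x - k' α j m x) =O[𝓝 q₀] w := by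
    intro α i j m
    have : (fun q => 3⁻¹ * (F α i j m q + H α i j m q)) =O[𝓝 q₀] w :=
      ((hFO α i j m).add (hHO α i j m)).const_mul_left _
    refine this.congr' ?_ EventuallyEq.rfl
    filter_upwards [hnhds] with q hq
    rw [← hpk α i j m q hq]
    ring
  refine ⟨hdk, fun α i j m l => ?_⟩
  -- differentiated once more, only the derivatives of `T - T'` are not dominated by `w`
  have hdF : ∀ α i j m l, pd l (F α i j m) =O[𝓝 q₀] w := by
    intro α i j m l
    have e : (fun q => ∑ b, ((pd l (X b j m) q * (k α i b q - k' α i b q)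
          + X b j m q * pd l (fun x => k α i b x - k' α i b x) q)
        + (pd l (Y b i m) q * (k α j b q - k' α j b q)
          + Y b i m q * pd l (fun x => k α j b x - k' α j b x) q)
        + (pd l (Z b i j) q * (k α m b q - k' α m b q)
          + Z b i j q * pd l (fun x => k α m b x - k' α m b x) q))) =O[𝓝 q₀] w := by
      refine .fun_sum fun b _ => IsBigO.add (IsBigO.add (IsBigO.add ?_ ?_) (IsBigO.add ?_ ?_))
        (IsBigO.add ?_ ?_)
      · exact (hcont ((hXs b j m).pd hΩ l)).mul_isBigO (hk α i b)
      · exact (hcont (hXs b j m)).mul_isBigO (hdk α l i b)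
      · exact (hcont ((hYs b i m).pd hΩ l)).mul_isBigO (hk α j b)
      · exact (hcont (hYs b i m)).mul_isBigO (hdk α l j b)
      · exact (hcont ((hZs b i j).pd hΩ l)).mul_isBigO (hk α m b)
      · exact (hcont (hZs b i j)).mul_isBigO (hdk α l m b)
    refine e.congr' ?_ EventuallyEq.rfl
    filter_upwards [hnhds] with q hq
    have dX := fun b j m => (hXs b j m).differentiableAt_of_isOpen hΩ hq
    have dY := fun b j m => (hYs b j m).differentiableAt_of_isOpen hΩ hq
    have dZ := fun b j m => (hZs b j m).differentiableAt_of_isOpen hΩ hq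
    have dk : ∀ i j, DifferentiableAt ℝ (fun x => k α i j x - k' α i j x) q := fun i j =>
      ((hks α i j).sub (hks' α i j)).differentiableAt_of_isOpen hΩ hq
    simp only [hF]
    rw [pd_sum _ l (fun b => (((dX b j m).fun_mul (dk i b)).fun_add
      ((dY b i m).fun_mul (dk j b))).fun_add ((dZ b i j).fun_mul (dk m b)))]
    refine Finset.sum_congr rfl fun b _ => ?_
    rw [pd_add l (((dX b j m).fun_mul (dk i b)).fun_add
      ((dY b i m).fun_mul (dk j b))) ((dZ b i j).fun_mul (dk m b)),
      pd_add l ((dX b j m).fun_mul (dk i b)) ((dY b i m).fun_mul (dk j b)),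
      pd_mul l (dX b j m) (dk i b), pd_mul l (dY b i m) (dk j b), pd_mul l (dZ b i j) (dk m b)]
  have hdH : ∀ i j m l, (fun q => pd l (H α i j m) q
      - killingSymbol (fun a b => γ a b q) (fun a b => k' α a b q) (diffJet G γ Γ T T' q).1
        i j m l) =O[𝓝 q₀] w := by
    intro i j m l
    have e : (fun q => ∑ b, ∑ a, (pd l (γ b a) q * (k' α i b q
          * ((T j a m q - T' j a m q) + (T m a j q - T' m a j q))
          - k' α j b q * (T i a m q - T' i a m q) - k' α m b q * (T i a j q - T' i a j q))
        + γ b a q * (pd l (k' α i b) q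
          * ((T j a m q - T' j a m q) + (T m a j q - T' m a j q))
          - pd l (k' α j b) q * (T i a m q - T' i a m q)
          - pd l (k' α m b) q * (T i a j q - T' i a j q)))) =O[𝓝 q₀] w := by
      refine .fun_sum fun b _ => .fun_sum fun a _ => IsBigO.add
        ((hcont ((hγs b a).pd hΩ l)).mul_isBigO (IsBigO.sub (IsBigO.sub ?_ ?_) ?_))
        ((hcont (hγs b a)).mul_isBigO (IsBigO.sub (IsBigO.sub ?_ ?_) ?_))
      · exact (hcont (hks' α i b)).mul_isBigO ((hT j a m).add (hT m a j))
      · exact (hcont (hks' α j b)).mul_isBigO (hT i a m)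
      · exact (hcont (hks' α m b)).mul_isBigO (hT i a j)
      · exact (hcont ((hks' α i b).pd hΩ l)).mul_isBigO ((hT j a m).add (hT m a j))
      · exact (hcont ((hks' α j b).pd hΩ l)).mul_isBigO (hT i a m)
      · exact (hcont ((hks' α m b).pd hΩ l)).mul_isBigO (hT i a j)
    refine e.congr' ?_ EventuallyEq.rfl
    filter_upwards [hnhds] with q hq
    have dk := fun i j => (hks' α i j).differentiableAt_of_isOpen hΩ hq
    have dγ := fun i j => (hγs i j).differentiableAt_of_isOpen hΩ hq
    have dT : ∀ i j a, DifferentiableAt ℝ (fun x => T i j a x - T' i j a x) q := fun i j a =>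
      ((hTs i j a).sub (hTs' i j a)).differentiableAt_of_isOpen hΩ hq
    rw [eq_sub_iff_add_eq]
    simp only [hH, killingSymbol, diffJet]
    have d1 : ∀ b a, DifferentiableAt ℝ (fun q => k' α i b q * ((T j a m q - T' j a m q)
        + (T m a j q - T' m a j q))) q := fun b a =>
      (dk i b).fun_mul ((dT j a m).fun_add (dT m a j))
    have d2 : ∀ b a, DifferentiableAt ℝ (fun q => k' α j b q * (T i a m q - T' i a m q)) q :=
      fun b a => (dk j b).fun_mul (dT i a m)
    have d3 : ∀ b a, DifferentiableAt ℝ (fun q => k' α m b q * (T i a j q - T' i a j q)) q :=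
      fun b a => (dk m b).fun_mul (dT i a j)
    rw [pd_sum _ l (fun b => DifferentiableAt.fun_sum fun a _ =>
      (dγ b a).fun_mul (((d1 b a).fun_sub (d2 b a)).fun_sub (d3 b a))), ← Finset.sum_add_distrib]
    refine Finset.sum_congr rfl fun b _ => ?_
    rw [pd_sum _ l (fun a =>
      (dγ b a).fun_mul (((d1 b a).fun_sub (d2 b a)).fun_sub (d3 b a))), ← Finset.sum_add_distrib]
    refine Finset.sum_congr rfl fun a _ => ?_
    rw [pd_mul l (dγ b a) (((d1 b a).fun_sub (d2 b a)).fun_sub (d3 b a)),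
      pd_sub l ((d1 b a).fun_sub (d2 b a)) (d3 b a), pd_sub l (d1 b a) (d2 b a),
      pd_mul l (dk i b) ((dT j a m).fun_add (dT m a j)), pd_add l (dT j a m) (dT m a j),
      pd_mul l (dk j b) (dT i a m), pd_mul l (dk m b) (dT i a j)]
    ring
  -- the second derivatives of `k - k'` commute
  have hcomm : ∀ᶠ q in 𝓝 q₀, pd l (F α i j m) q + pd l (H α i j m) q
      = pd i (F α l j m) q + pd i (H α l j m) q := by
    filter_upwards [hnhds] with q hq
    have hsm : ContDiffOn ℝ ∞ (fun x => k α j m x - k' α j m x) Ω :=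
      (hks α j m).sub (hks' α j m)
    have e : ∀ i l, pd l (F α i j m) q + pd l (H α i j m) q
        = 3 * pd l (pd i (fun x => k α j m x - k' α j m x)) q := by
      intro i l
      rw [← pd_add l ((hFs α i j m).differentiableAt_of_isOpen hΩ hq)
        ((hHs α i j m).differentiableAt_of_isOpen hΩ hq),
        ← pd_const_mul l 3 ((hsm.pd hΩ i).differentiableAt_of_isOpen hΩ hq)]
      refine pd_congr l ?_
      filter_upwards [hΩ.mem_nhds hq] with x hx using (hpk α i j m x hx).symm
    rw [e, e, pd_comm (hsm.contDiffAt (hΩ.mem_nhds hq))]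
  refine ((((hdF α l j m i).sub (hdF α i j m l)).add (hdH l j m i)).sub
    (hdH i j m l)).congr' ?_ EventuallyEq.rfl
  filter_upwards [hcomm] with q hq
  linarith

theorem diff_trace_eq (hG : IsMetricOn Ω G γ) (h : IsLocalSystem Ω G γ Γ T k)
    (h' : IsLocalSystem Ω G γ Γ T' k') {q : Model n} (hq : q ∈ Ω) (i j a : Fin n) :
    (T i j a q - T' i j a q) - (T i a j q - T' i a j q)
      + (G i j q * (tCoeff G γ (connCoeff γ Γ T) a q - tCoeff G γ (connCoeff γ Γ T') a q)
        - G i a q * (tCoeff G γ (connCoeff γ Γ T) j q - tCoeff G γ (connCoeff γ Γ T') j q)) = 0 := by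
  have e := traceCoeff_sub (Γ := Γ) (T := T) (T' := T') hG hq i j a
  rw [← h.trace_eq q hq, ← h'.trace_eq q hq, h.symm a i, h'.symm a i, h.symm j i, h'.symm j i] at e
  linarith

/-- The derivatives of the differences satisfy the linearised structure equations up to terms
dominated by the differences themselves. -/
theorem symbol_isBigO [Fintype ι] (hG : IsMetricOn Ω G γ)
    (hΓ : ∀ i j m, ContDiffOn ℝ ∞ (Γ i j m) Ω)
    (h : IsLocalSystem Ω G γ Γ T k) (h' : IsLocalSystem Ω G γ Γ T' k') {q₀ : Model n}
    (hq₀ : q₀ ∈ Ω) :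
    (fun q => symbol (fun i j => G i j q) (fun i j => γ i j q) (fun α i j => k' α i j q)
      (diffJet G γ Γ T T' q)) =O[𝓝 q₀] fun q c => diffFamily G γ Γ T T' k k' c q := by
  have hΩ := hG.isOpen
  have hnhds := hΩ.mem_nhds hq₀
  have hK := (killing_isBigO hG hΓ h h' hq₀).2
  set w : Model n → ((Fin n × Fin n × Fin n) ⊕ (ι × Fin n × Fin n) ⊕ Fin n) → ℝ :=
    fun q c => diffFamily G γ Γ T T' k k' c q with hw
  have hO : ∀ c, (fun q => w q c) =O[𝓝 q₀] w := fun c =>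
    isBigO_of_le _ fun q => norm_le_pi_norm (w q) c
  have hT : ∀ i j a, (fun q => T i j a q - T' i j a q) =O[𝓝 q₀] w :=
    fun i j a => hO (Sum.inl (i, j, a))
  have ht : ∀ a, (fun q => tCoeff G γ (connCoeff γ Γ T) a q - tCoeff G γ (connCoeff γ Γ T') a q)
      =O[𝓝 q₀] w := fun a => hO (Sum.inr (Sum.inr a))
  have hcont : ∀ {a : Model n → ℝ}, ContDiffOn ℝ ∞ a Ω → ContinuousAt a q₀ := fun ha =>
    ha.continuousOn.continuousAt hnhds
  have hA := contDiffOn_connCoeff hG hΓ h.smooth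
  have hA' := contDiffOn_connCoeff hG hΓ h'.smooth
  have hγs := hG.smooth_inv
  have hAO : ∀ i j m, (fun q => connCoeff γ Γ T i j m q - connCoeff γ Γ T' i j m q)
      =O[𝓝 q₀] w := by
    intro i j m
    simp only [connCoeff_sub]
    exact .fun_sum fun a _ => (hcont (hγs a m)).mul_isBigO (hT i j a)
  have dT : ∀ q ∈ Ω, ∀ i j a, DifferentiableAt ℝ (fun x => T i j a x - T' i j a x) q :=
    fun q hq i j a => ((h.smooth i j a).sub (h'.smooth i j a)).differentiableAt_of_isOpen hΩ hq
  have dt : ∀ q ∈ Ω, ∀ a, DifferentiableAt ℝ (fun x => tCoeff G γ (connCoeff γ Γ T) a x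
      - tCoeff G γ (connCoeff γ Γ T') a x) q := fun q hq a =>
    ((contDiffOn_tCoeff hG hA a).sub (contDiffOn_tCoeff hG hA' a)).differentiableAt_of_isOpen hΩ hq
  unfold symbol
  refine IsBigO.prod_left ?_ (IsBigO.prod_left ?_ (IsBigO.prod_left ?_ (IsBigO.prod_left ?_ ?_)))
  · refine isBigO_pi.2 fun i => isBigO_pi.2 fun j => isBigO_pi.2 fun a => isBigO_pi.2 fun l => ?_
    refine (isBigO_zero w (𝓝 q₀)).congr_left fun q => ?_
    simp only [diffJet, h.symm j i, h'.symm j i, sub_self]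
  · refine isBigO_pi.2 fun a => isBigO_pi.2 fun l => ?_
    have e : (fun q => -∑ i, ∑ j, pd l (γ i j) q * (T i j a q - T' i j a q)) =O[𝓝 q₀] w :=
      (IsBigO.fun_sum fun i _ => IsBigO.fun_sum fun j _ =>
        (hcont ((hγs i j).pd hΩ l)).mul_isBigO (hT i j a)).neg_left
    refine e.congr' ?_ EventuallyEq.rfl
    filter_upwards [hnhds] with q hq
    have dγ := fun i j => (hγs i j).differentiableAt_of_isOpen hΩ hq
    have hev : (fun x => ∑ i, ∑ j, γ i j x * (T i j a x - T' i j a x)) =ᶠ[𝓝 q] fun _ => 0 := by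
      filter_upwards [hΩ.mem_nhds hq] with x hx
      simp only [mul_sub, Finset.sum_sub_distrib, h.trace_free x hx, h'.trace_free x hx, sub_self]
    have := pd_congr l hev
    rw [pd_const, pd_sum _ l fun i => DifferentiableAt.fun_sum fun j _ =>
      (dγ i j).fun_mul (dT q hq i j a)] at this
    simp only [fun i => pd_sum_mul Finset.univ l (dγ i) (fun j => dT q hq i j a),
      Finset.sum_add_distrib] at this
    simp only [diffJet]
    linarith
  · refine isBigO_pi.2 fun i => isBigO_pi.2 fun j => isBigO_pi.2 fun a => isBigO_pi.2 fun l => ?_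
    refine (((hcont ((hG.smooth i a).pd hΩ l)).mul_isBigO (ht j)).sub
      ((hcont ((hG.smooth i j).pd hΩ l)).mul_isBigO (ht a))).congr' ?_ EventuallyEq.rfl
    filter_upwards [hnhds] with q hq
    have dG := fun i j => (hG.smooth i j).differentiableAt_of_isOpen hΩ hq
    have hev : (fun x => (T i j a x - T' i j a x) - (T i a j x - T' i a j x)
        + (G i j x * (tCoeff G γ (connCoeff γ Γ T) a x - tCoeff G γ (connCoeff γ Γ T') a x)
          - G i a x * (tCoeff G γ (connCoeff γ Γ T) j x - tCoeff G γ (connCoeff γ Γ T') j x)))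
        =ᶠ[𝓝 q] fun _ => 0 := by
      filter_upwards [hΩ.mem_nhds hq] with x hx using diff_trace_eq hG h h' hx i j a
    have e := pd_congr l hev
    rw [pd_const, pd_add l ((dT q hq i j a).fun_sub (dT q hq i a j))
      (((dG i j).fun_mul (dt q hq a)).fun_sub ((dG i a).fun_mul (dt q hq j))),
      pd_sub l (dT q hq i j a) (dT q hq i a j),
      pd_sub l ((dG i j).fun_mul (dt q hq a)) ((dG i a).fun_mul (dt q hq j)),
      pd_mul l (dG i j) (dt q hq a), pd_mul l (dG i a) (dt q hq j)] at e
    simp only [diffJet]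
    linarith
  · refine isBigO_pi.2 fun i => isBigO_pi.2 fun j => isBigO_pi.2 fun a => isBigO_pi.2 fun m => ?_
    have e : (fun q => ∑ b, pd j (γ b m) q * (T a i b q - T' a i b q)
        - ∑ b, pd a (γ b m) q * (T j i b q - T' j i b q)
        + ∑ l, (connCoeff γ Γ T j l m q * (connCoeff γ Γ T a i l q - connCoeff γ Γ T' a i l q)
          + connCoeff γ Γ T' a i l q * (connCoeff γ Γ T j l m q - connCoeff γ Γ T' j l m q)
          - (connCoeff γ Γ T a l m q * (connCoeff γ Γ T j i l q - connCoeff γ Γ T' j i l q)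
          + connCoeff γ Γ T' j i l q * (connCoeff γ Γ T a l m q - connCoeff γ Γ T' a l m q))))
        =O[𝓝 q₀] w := by
      refine IsBigO.add (IsBigO.sub ?_ ?_) (.fun_sum fun l _ =>
        IsBigO.sub (IsBigO.add ?_ ?_) (IsBigO.add ?_ ?_))
      · exact .fun_sum fun b _ => (hcont ((hγs b m).pd hΩ j)).mul_isBigO (hT a i b)
      · exact .fun_sum fun b _ => (hcont ((hγs b m).pd hΩ a)).mul_isBigO (hT j i b)
      · exact (hcont (hA j l m)).mul_isBigO (hAO a i l)
      · exact (hcont (hA' a i l)).mul_isBigO (hAO j l m)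
      · exact (hcont (hA a l m)).mul_isBigO (hAO j i l)
      · exact (hcont (hA' j i l)).mul_isBigO (hAO a l m)
    refine e.congr' ?_ EventuallyEq.rfl
    filter_upwards [hnhds] with q hq
    have dγ := fun i j => (hγs i j).differentiableAt_of_isOpen hΩ hq
    have dA := fun i j m => (hA i j m).differentiableAt_of_isOpen hΩ hq
    have dA' := fun i j m => (hA' i j m).differentiableAt_of_isOpen hΩ hq
    have hpA : ∀ l a i m, pd l (connCoeff γ Γ T a i m) q - pd l (connCoeff γ Γ T' a i m) q
        = ∑ b, pd l (γ b m) q * (T a i b q - T' a i b q)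
          + ∑ b, γ b m q * pd l (fun x => T a i b x - T' a i b x) q := by
      intro l a i m
      rw [← pd_sub l (dA a i m) (dA' a i m)]
      simp only [connCoeff_sub]
      rw [pd_sum_mul _ l (fun b => dγ b m) (fun b => dT q hq a i b), Finset.sum_add_distrib]
    have g1 := h.grad_eq q hq i j a m
    have g2 := h'.grad_eq q hq i j a m
    have p1 := hpA j a i m
    have p2 := hpA a j i m
    simp only [gradCoeff, Finset.sum_sub_distrib] at g1 g2
    simp only [diffJet, h.symm i, h'.symm i, mul_sub, Finset.sum_sub_distrib,
      Finset.sum_add_distrib] at p1 p2 ⊢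
    simp only [mul_comm (connCoeff γ Γ T j _ m q), mul_comm (connCoeff γ Γ T a _ m q)]
    linarith
  · exact isBigO_pi.2 fun α => isBigO_pi.2 fun i => isBigO_pi.2 fun j => isBigO_pi.2 fun m =>
      isBigO_pi.2 fun l => hK α i j m l

set_option synthInstance.maxSize 1000 in
set_option synthInstance.maxHeartbeats 200000 in
/-- Two local systems with the same values at `q₀` coincide near `q₀`, if only the multiples of the
identity commute with the Killing tensors at `q₀`: the family of the differences satisfies the
hypotheses of `eventually_eq_zero_of_pd_isBigO`, because the symbol is injective at `q₀`. -/
theorem eventually_eq_of_isLocalSystem [Fintype ι] (hn : 3 ≤ n) (hG : IsMetricOn Ω G γ)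
    (hΓ : ∀ i j m, ContDiffOn ℝ ∞ (Γ i j m) Ω)
    (h : IsLocalSystem Ω G γ Γ T k) (h' : IsLocalSystem Ω G γ Γ T' k') {q₀ : Model n}
    (hq₀ : q₀ ∈ Ω) (hδ : ∀ i j, G i j q₀ = if i = j then 1 else 0)
    (hschur : ∀ X : Fin n → Fin n → ℝ, (∀ i j, X i j = X j i) →
      (∀ α i l, ∑ a, k' α i a q₀ * X a l = ∑ a, k' α l a q₀ * X a i) →
      ∃ c : ℝ, ∀ i j, X i j = if i = j then c else 0)
    (hT0 : ∀ i j a, T i j a q₀ = T' i j a q₀) (hk0 : ∀ α i j, k α i j q₀ = k' α i j q₀) :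
    ∀ᶠ q in 𝓝 q₀, (∀ i j a, T i j a q = T' i j a q) ∧ ∀ α i j, k α i j q = k' α i j q := by
  have hΩ := hG.isOpen
  have hnhds := hΩ.mem_nhds hq₀
  have hn' : (3 : ℝ) ≤ n := by exact_mod_cast hn
  have hγδ : ∀ i j, γ i j q₀ = if i = j then 1 else 0 := by
    intro i j
    have := hG.inv_mul i j q₀ hq₀
    simpa [hδ] using this
  have hL := eventually_norm_le_of_injective
    (Λ := fun (p : (Fin n → Fin n → ℝ) × (Fin n → Fin n → ℝ) × (ι → Fin n → Fin n → ℝ))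
      (X : Jet n) => symbol p.1 p.2.1 p.2.2 X) continuous_symbol
    (fun p c X => symbol_smul _ _ _ c X)
    (p₀ := (fun i j => G i j q₀, fun i j => γ i j q₀, fun α i j => k' α i j q₀)) (by
      intro X hX
      simp only [hδ, hγδ] at hX
      exact symbol_injective hn (fun α i j => by rw [h'.symm_killing]) hschur X hX)
  obtain ⟨C, hC⟩ := hL
  have hcont : ContinuousAt (fun q => ((fun i j => G i j q, fun i j => γ i j q,
      fun α i j => k' α i j q) : (Fin n → Fin n → ℝ) × (Fin n → Fin n → ℝ) ×
        (ι → Fin n → Fin n → ℝ))) q₀ := by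
    refine ContinuousAt.prodMk ?_ (ContinuousAt.prodMk ?_ ?_)
    · exact continuousAt_pi.2 fun i => continuousAt_pi.2 fun j =>
        (hG.smooth i j).continuousOn.continuousAt hnhds
    · exact continuousAt_pi.2 fun i => continuousAt_pi.2 fun j =>
        (hG.smooth_inv i j).continuousOn.continuousAt hnhds
    · exact continuousAt_pi.2 fun α => continuousAt_pi.2 fun i => continuousAt_pi.2 fun j =>
        (h'.smooth_killing α i j).continuousOn.continuousAt hnhds
  have hX : diffJet G γ Γ T T' =O[𝓝 q₀] fun q c => diffFamily G γ Γ T T' k k' c q :=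
    (IsBigO.of_bound C ((hcont.eventually hC).mono fun q hq => hq _)).trans
      (symbol_isBigO hG hΓ h h' hq₀)
  have key := eventually_eq_zero_of_pd_isBigO (w := diffFamily G γ Γ T T' k k') (q₀ := q₀)
    ?_ ?_ ?_
  · filter_upwards [key] with q hq
    exact ⟨fun i j a => sub_eq_zero.1 (hq (Sum.inl (i, j, a))),
      fun α i j => sub_eq_zero.1 (hq (Sum.inr (Sum.inl (α, i, j))))⟩
  · have hA := contDiffOn_connCoeff hG hΓ h.smooth
    have hA' := contDiffOn_connCoeff hG hΓ h'.smooth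
    rintro (c | c | c) <;> filter_upwards [hnhds] with q hq
    · exact ((h.smooth _ _ _).sub (h'.smooth _ _ _)).differentiableAt_of_isOpen hΩ hq
    · exact ((h.smooth_killing _ _ _).sub
        (h'.smooth_killing _ _ _)).differentiableAt_of_isOpen hΩ hq
    · exact ((contDiffOn_tCoeff hG hA _).sub
        (contDiffOn_tCoeff hG hA' _)).differentiableAt_of_isOpen hΩ hq
  · have h1 : (fun q => (diffJet G γ Γ T T' q).1) =O[𝓝 q₀] _ := hX.prod_left_fst
    have h2 : (fun q => (diffJet G γ Γ T T' q).2.1) =O[𝓝 q₀] _ := hX.prod_left_snd.prod_left_fst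
    rintro (⟨i, j, a⟩ | ⟨α, j, m⟩ | c) l
    · exact isBigO_pi.1 (isBigO_pi.1 (isBigO_pi.1 (isBigO_pi.1 h1 i) j) a) l
    · exact (killing_isBigO hG hΓ h h' hq₀).1 α l j m
    · exact isBigO_pi.1 (isBigO_pi.1 h2 c) l
  · rintro (⟨i, j, a⟩ | ⟨α, j, m⟩ | c)
    · exact sub_eq_zero.2 (hT0 i j a)
    · exact sub_eq_zero.2 (hk0 α j m)
    · have e := hG.contract hq₀ (fun a => tCoeff G γ (connCoeff γ Γ T) a q₀
        - tCoeff G γ (connCoeff γ Γ T') a q₀) c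
      have z : ∀ i j, γ i j q₀ * (G i j q₀ * (tCoeff G γ (connCoeff γ Γ T) c q₀
          - tCoeff G γ (connCoeff γ Γ T') c q₀) - G i c q₀ * (tCoeff G γ (connCoeff γ Γ T) j q₀
          - tCoeff G γ (connCoeff γ Γ T') j q₀)) = 0 := by
        intro i j
        have := diff_trace_eq hG h h' hq₀ i j c
        rw [hT0, hT0, sub_self, sub_self, sub_self, zero_add] at this
        rw [this, mul_zero]
      simp only [z, Finset.sum_const_zero] at e
      rcases mul_eq_zero.1 e.symm with e | e
      · linarith
      · exact e

end Comparison

/-! ### From the manifold to a chart -/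

section Charts

theorem isOpen_chart_preimage {X Y : Type*} [TopologicalSpace X] [TopologicalSpace Y]
    {e : OpenPartialHomeomorph X Y} {O : Set X} (hO : IsOpen O) :
    IsOpen (e.target ∩ e.symm ⁻¹' O) :=
  e.symm.isOpen_inter_preimage hO

variable {n : ℕ} {M : Type*} [TopologicalSpace M] [ChartedSpace (Model n) M]
  {e : OpenPartialHomeomorph M (Model n)}

theorem mdifferentiable_of_mem_smoothCharts (he : e ∈ smoothCharts n M) :
    e.MDifferentiable (𝓡 n) (𝓡 n) :=
  ⟨(contMDiffOn_of_mem_maximalAtlas he).mdifferentiableOn (by simp),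
    (contMDiffOn_symm_of_mem_maximalAtlas he).mdifferentiableOn (by simp)⟩

/-- The identification of `ℝⁿ` with the tangent space given by a chart. -/
def frame (he : e ∈ smoothCharts n M) {q : Model n} (hq : q ∈ e.target) :
    Model n ≃L[ℝ] TS n (e.symm q) :=
  (mdifferentiable_of_mem_smoothCharts he).symm.mfderiv hq

theorem coordVec_eq_frame (he : e ∈ smoothCharts n M) {q : Model n} (hq : q ∈ e.target)
    (i : Fin n) : coordVec e i q = frame he hq (EuclideanSpace.single i 1) := rfl

theorem frame_apply (he : e ∈ smoothCharts n M) {q : Model n} (hq : q ∈ e.target) (v : Model n) :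
    frame he hq v = ∑ i, v i • coordVec e i q := by
  conv_lhs => rw [← (EuclideanSpace.basisFun (Fin n) ℝ).sum_repr v]
  rw [map_sum]
  simp only [map_smul, coordVec_eq_frame he hq, EuclideanSpace.basisFun_repr,
    EuclideanSpace.basisFun_apply]

theorem form_apply_frame (he : e ∈ smoothCharts n M) {q : Model n} (hq : q ∈ e.target)
    (K : ∀ x : M, Form2 n x) (v w : Model n) :
    K (e.symm q) (frame he hq v) (frame he hq w) = ∑ i, ∑ j, v i * w j * comp2 e K i j q := by
  simp only [frame_apply, map_sum, map_smul, sum_apply,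
    smul_apply, smul_eq_mul, Finset.mul_sum, comp2]
  rw [Finset.sum_comm]
  exact Finset.sum_congr rfl fun _ _ => Finset.sum_congr rfl fun _ _ => by ring

theorem form2_ext (he : e ∈ smoothCharts n M) {q : Model n} (hq : q ∈ e.target)
    {K K' : ∀ x : M, Form2 n x} (h : ∀ i j, comp2 e K i j q = comp2 e K' i j q) :
    K (e.symm q) = K' (e.symm q) := by
  refine ContinuousLinearMap.ext fun u => ContinuousLinearMap.ext fun w => ?_
  obtain ⟨u, rfl⟩ := (frame he hq).surjective u
  obtain ⟨w, rfl⟩ := (frame he hq).surjective w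
  simp only [form_apply_frame, h]

theorem form3_ext (he : e ∈ smoothCharts n M) {q : Model n} (hq : q ∈ e.target)
    {T T' : ∀ x : M, Form3 n x} (h : ∀ i j k, comp3 e T i j k q = comp3 e T' i j k q) :
    T (e.symm q) = T' (e.symm q) := by
  refine ContinuousLinearMap.ext fun u => ContinuousLinearMap.ext fun v =>
    ContinuousLinearMap.ext fun w => ?_
  obtain ⟨u, rfl⟩ := (frame he hq).surjective u
  obtain ⟨v, rfl⟩ := (frame he hq).surjective v
  obtain ⟨w, rfl⟩ := (frame he hq).surjective w
  simp only [comp3] at h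
  simp only [frame_apply, map_sum, map_smul, sum_apply,
    smul_apply, h]

theorem contDiffOn_comp_symm (he : e ∈ smoothCharts n M) {O : Set M} {f : M → ℝ}
    (hf : ContMDiffOn (𝓡 n) 𝓘(ℝ) ∞ f O) :
    ContDiffOn ℝ ∞ (f ∘ e.symm) (e.target ∩ e.symm ⁻¹' O) := by
  rw [← contMDiffOn_iff_contDiffOn]
  exact hf.comp ((contMDiffOn_symm_of_mem_maximalAtlas he).mono Set.inter_subset_left)
    fun q hq => hq.2

variable [IsManifold (𝓡 n) ∞ M] {g : Metric n M}

theorem metric_det_ne_zero (he : e ∈ smoothCharts n M) {q : Model n} (hq : q ∈ e.target) :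
    (Matrix.of fun a b => comp2 e g.inner a b q).det ≠ 0 := by
  intro h
  obtain ⟨v, hv, hv0⟩ := Matrix.exists_mulVec_eq_zero_iff.2 h
  set u : Model n := WithLp.toLp 2 v with hu
  have hne : frame he hq u ≠ 0 := by
    intro h0
    have : u = 0 := (frame he hq).map_eq_zero_iff.1 h0
    exact hv (by simpa [hu] using this)
  have hpos := g.pos (e.symm q) (frame he hq u) hne
  rw [form_apply_frame he hq g.inner] at hpos
  have hz : ∀ i, ∑ j, v j * comp2 e g.inner i j q = 0 := fun i => by
    have := congrFun hv0 i
    simpa [Matrix.mulVec, dotProduct, mul_comm] using this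
  have : ∑ i, ∑ j, u i * u j * comp2 e g.inner i j q = 0 := by
    simp only [hu, mul_assoc, ← Finset.mul_sum, hz, mul_zero, Finset.sum_const_zero]
  linarith

theorem comp2_metric_symm (i j : Fin n) (q : Model n) :
    comp2 e g.inner i j q = comp2 e g.inner j i q :=
  g.symm _ _ _

theorem contDiffOn_inv_entry {Ω : Set (Model n)} {G : Fin n → Fin n → Model n → ℝ}
    (hG : ∀ i j, ContDiffOn ℝ ∞ (G i j) Ω)
    (hdet : ∀ q ∈ Ω, (Matrix.of fun a b => G a b q).det ≠ 0) (i j : Fin n) :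
    ContDiffOn ℝ ∞ (fun q => (Matrix.of fun a b => G a b q)⁻¹ i j) Ω := by
  have hd : ∀ G : Fin n → Fin n → Model n → ℝ, (∀ i j, ContDiffOn ℝ ∞ (G i j) Ω) →
      ContDiffOn ℝ ∞ (fun q => (Matrix.of fun a b => G a b q).det) Ω := by
    intro G hG
    simp only [Matrix.det_apply, Matrix.of_apply]
    refine ContDiffOn.sum fun σ _ => ContDiffOn.const_smul _ ?_
    exact contDiffOn_prod fun a _ => hG _ _
  simp only [Matrix.inv_def, Matrix.smul_apply, Ring.inverse_eq_inv', smul_eq_mul,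
    Matrix.adjugate_apply]
  refine ((hd G hG).inv hdet).mul ?_
  have := hd (fun a b q => if a = j then (Pi.single i 1 : Fin n → ℝ) b else G a b q) fun a b => by
    by_cases h : a = j
    · simpa [h] using contDiffOn_const
    · simpa [h] using hG a b
  refine this.congr fun q _ => ?_
  congr 1
  ext a b
  simp [Matrix.updateRow_apply]

/-- The metric of a superintegrable system is smooth in charts, being one of its Killing
tensors. -/
theorem System.isMetricOn (S : System g) (he : e ∈ smoothCharts n M) :
    IsMetricOn e.target (comp2 e g.inner) (ginv e g) where
  isOpen := e.open_target
  smooth i j := by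
    obtain ⟨α, hα, -⟩ := S.hamiltonian_mem
    have := S.smooth_K α e he i j
    rwa [hα] at this
  smooth_inv := contDiffOn_inv_entry (fun i j => by
    obtain ⟨α, hα, -⟩ := S.hamiltonian_mem
    have := S.smooth_K α e he i j
    rwa [hα] at this) fun q hq => metric_det_ne_zero he hq
  symm i j q _ := comp2_metric_symm i j q
  symm_inv i j q _ := by
    have : (Matrix.of fun a b => comp2 e g.inner a b q).IsSymm :=
      Matrix.IsSymm.ext fun i j => comp2_metric_symm j i q
    exact this.inv.apply j i
  inv_mul i k q hq := by
    have := Matrix.nonsing_inv_mul (Matrix.of fun a b => comp2 e g.inner a b q)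
      (isUnit_iff_ne_zero.2 (metric_det_ne_zero he hq))
    have := congrFun (congrFun this i) k
    rwa [Matrix.mul_apply, Matrix.one_apply] at this

theorem System.contDiffOn_christoffel (S : System g) (he : e ∈ smoothCharts n M) (m i j : Fin n) :
    ContDiffOn ℝ ∞ (christoffel e g m i j) e.target := by
  have hG := S.isMetricOn he
  have := hG.smooth_inv
  have := fun i j l => (hG.smooth i j).pd hG.isOpen l
  unfold christoffel
  fun_prop

/-- The Christoffel symbols with the upper index last. -/
def gamma (e : OpenPartialHomeomorph M (Model n)) (g : Metric n M) (i j m : Fin n) (q : Model n) :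
    ℝ :=
  christoffel e g m i j q

/-- A smooth solution of the structure equation, in a chart. -/
theorem System.isLocalSolution (S : System g) (he : e ∈ smoothCharts n M)
    {T : ∀ x : M, Form3 n x} {O : Set M} (hO : IsOpen O) {f : M → ℝ}
    (hf : ContMDiffOn (𝓡 n) 𝓘(ℝ) ∞ f O) (hW : WilczynskiOn g T O f) :
    IsLocalSolution (e.target ∩ e.symm ⁻¹' O) (comp2 e g.inner)
      (connCoeff (ginv e g) (gamma e g) (comp3 e T)) (f ∘ e.symm)
      (fun q => (1 / (n : ℝ)) * lap e g f q) := by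
  have hs := contDiffOn_comp_symm he hf
  have hΩ := isOpen_chart_preimage (e := e) hO
  refine ⟨hs, ?_, fun q hq i j => ?_⟩
  · have h1 := fun i => hs.pd hΩ i
    have h2 := fun i j => (h1 i).pd hΩ j
    have h3 := fun m i j =>
      (S.contDiffOn_christoffel he m i j).mono (Set.inter_subset_left (t := e.symm ⁻¹' O))
    have h4 := fun i j =>
      ((S.isMetricOn he).smooth_inv i j).mono (Set.inter_subset_left (t := e.symm ⁻¹' O))
    unfold lap hess
    fun_prop
  · have h := hW e he q hq.1 hq.2 i j
    rw [hess, sub_eq_iff_eq_add] at h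
    rw [h]
    simp only [connCoeff, gamma, add_mul, Finset.sum_add_distrib, Finset.sum_mul]
    rw [Finset.sum_comm]
    ring

theorem contDiffOn_structure (S : System g) (he : e ∈ smoothCharts n M)
    {T : ∀ x : M, Form3 n x} (hT : IsSmooth3 T) (i j m : Fin n) :
    ContDiffOn ℝ ∞ (connCoeff (ginv e g) (gamma e g) (comp3 e T) i j m) e.target :=
  contDiffOn_connCoeff (S.isMetricOn he) (fun i j m => S.contDiffOn_christoffel he m i j)
    (hT e he) i j m

/-- A solution of the structure equation whose value, differential and Laplacian vanish at a point
vanishes near this point. -/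
theorem System.eventually_eq_zero (S : System g) (hn : 2 ≤ n) (he : e ∈ smoothCharts n M)
    {T : ∀ x : M, Form3 n x} (hT : IsSmooth3 T) {O : Set M} (hO : IsOpen O) {f : M → ℝ}
    (hf : ContMDiffOn (𝓡 n) 𝓘(ℝ) ∞ f O) (hW : WilczynskiOn g T O f) {x : M} (hxO : x ∈ O)
    (hxe : x ∈ e.source) (h0 : f x = 0) (h1 : ∀ i, pd i (f ∘ e.symm) (e x) = 0)
    (h2 : lap e g f (e x) = 0) : f =ᶠ[𝓝 x] 0 := by
  have hq : e x ∈ e.target ∩ e.symm ⁻¹' O := ⟨e.map_source hxe, by simpa [e.left_inv hxe] using hxO⟩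
  have hsol := (S.isLocalSolution he hO hf hW).eventually_eq_zero hn
    ((S.isMetricOn he).mono (isOpen_chart_preimage hO) Set.inter_subset_left)
    (fun i j m => (contDiffOn_structure S he hT i j m).mono Set.inter_subset_left) hq
    (by simpa [e.left_inv hxe] using h0) h1 (by simp [h2])
  filter_upwards [(e.continuousAt hxe).eventually hsol, e.open_source.mem_nhds hxe] with y hy hye
  simpa [e.left_inv hye] using hy

/-- A solution of the structure equation on a connected set whose value, differential and Laplacian
vanish at a point is zero. -/
theorem System.eqOn_zero (S : System g) (hn : 2 ≤ n) (he : e ∈ smoothCharts n M)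
    {T : ∀ x : M, Form3 n x} (hT : IsSmooth3 T) {O : Set M} (hO : IsOpen O)
    (hOc : IsPreconnected O) {f : M → ℝ}
    (hf : ContMDiffOn (𝓡 n) 𝓘(ℝ) ∞ f O) (hW : WilczynskiOn g T O f) {x : M} (hxO : x ∈ O)
    (hxe : x ∈ e.source) (h0 : f x = 0) (h1 : ∀ i, pd i (f ∘ e.symm) (e x) = 0)
    (h2 : lap e g f (e x) = 0) : ∀ y ∈ O, f y = 0 := by
  have key : O ⊆ {y | f =ᶠ[𝓝 y] 0} := by
    refine hOc.subset_of_forall_mem_nhds hxO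
      (S.eventually_eq_zero hn he hT hO hf hW hxO hxe h0 h1 h2)
      (fun y _ hy => eventually_eventually_nhds.2 hy) fun y hyO hy => ?_
    -- the value, differential and Laplacian vanish at `y` by continuity
    set e' := chartAt (Model n) y with he'
    have he'm : e' ∈ smoothCharts n M := IsManifold.chart_mem_maximalAtlas y
    have hye : y ∈ e'.source := mem_chart_source _ y
    have hsol := S.isLocalSolution he'm hO hf hW
    have hΩ := isOpen_chart_preimage (e := e') hO
    have hq : e' y ∈ e'.target ∩ e'.symm ⁻¹' O :=
      ⟨e'.map_source hye, by simpa [e'.left_inv hye] using hyO⟩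
    have hcl : e' y ∈ closure {q | q ∈ e'.target ∧ f =ᶠ[𝓝 (e'.symm q)] 0} := by
      have hy' : y ∈ closure ({y | f =ᶠ[𝓝 y] 0} ∩ e'.source) := by
        have := closure_mono interior_subset hy
        exact (mem_closure_iff_nhds.2 fun t ht => by
          obtain ⟨z, hz1, hz2⟩ := mem_closure_iff_nhds.1 this (t ∩ e'.source)
            (inter_mem ht (e'.open_source.mem_nhds hye))
          exact ⟨z, hz1.1, hz2, hz1.2⟩)
      have := (e'.continuousAt hye).continuousWithinAt.mem_closure_image hy'
      refine closure_mono ?_ this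
      rintro _ ⟨z, ⟨hz, hze⟩, rfl⟩
      exact ⟨e'.map_source hze, by simpa [e'.left_inv hze] using hz⟩
    have hzero : ∀ φ : Model n → ℝ, ContDiffOn ℝ ∞ φ (e'.target ∩ e'.symm ⁻¹' O) →
        (∀ q ∈ e'.target, f =ᶠ[𝓝 (e'.symm q)] 0 → φ q = 0) → φ (e' y) = 0 := by
      intro φ hφ h
      have hc := (hφ.continuousOn.continuousAt (hΩ.mem_nhds hq)).continuousWithinAt.mem_closure_image
        hcl
      have : φ '' {q | q ∈ e'.target ∧ f =ᶠ[𝓝 (e'.symm q)] 0} ⊆ {0} := by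
        rintro _ ⟨q, ⟨hq1, hq2⟩, rfl⟩
        exact h q hq1 hq2
      simpa using closure_mono this hc
    have hgerm : ∀ q ∈ e'.target, f =ᶠ[𝓝 (e'.symm q)] 0 → f ∘ e'.symm =ᶠ[𝓝 q] fun _ => 0 :=
      fun q hq h => (e'.continuousAt_symm hq).eventually h
    have hpd : ∀ q ∈ e'.target, f =ᶠ[𝓝 (e'.symm q)] 0 → ∀ i,
        pd i (f ∘ e'.symm) =ᶠ[𝓝 q] fun _ => 0 := fun q hq h i => by
      filter_upwards [(hgerm q hq h).eventuallyEq_nhds] with z hz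
      rw [pd_congr i hz, pd_const]
    have hn0 : (n : ℝ) ≠ 0 := by
      have : (2 : ℝ) ≤ n := by exact_mod_cast hn
      linarith
    refine S.eventually_eq_zero hn he'm hT hO hf hW hyO hye ?_ (fun i => ?_) ?_
    · simpa [e'.left_inv hye] using
        hzero (f ∘ e'.symm) hsol.smooth fun q hq h => (hgerm q hq h).eq_of_nhds
    · exact hzero _ (hsol.smooth.pd hΩ i) fun q hq h => (hpd q hq h i).eq_of_nhds
    · have := hzero _ hsol.smooth_trace fun q hq h => by
        have h1 : ∀ i j, pd i (pd j (f ∘ e'.symm)) q = 0 := fun i j => by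
          rw [pd_congr i (hpd q hq h j), pd_const]
        have h2 : ∀ i, pd i (f ∘ e'.symm) q = 0 := fun i => (hpd q hq h i).eq_of_nhds
        simp [lap, hess, h1, h2]
      simpa [hn0] using this
  exact fun y hy => (key hy).eq_of_nhds

end Charts

/-! ### The equations of a non-degenerate system -/

section Systems

section Linearity

variable {n : ℕ} {M : Type*} [TopologicalSpace M] {e : OpenPartialHomeomorph M (Model n)}
  {κ : Type*} [Fintype κ] {f : κ → M → ℝ} {O : Set M} {q : Model n}

theorem pd_linear_combination (c : κ → ℝ)
    (hf : ∀ a, DifferentiableAt ℝ (f a ∘ e.symm) q) (i : Fin n) :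
    pd i ((fun x => ∑ a, c a * f a x) ∘ e.symm) q = ∑ a, c a * pd i (f a ∘ e.symm) q := by
  have : ((fun x => ∑ a, c a * f a x) ∘ e.symm) = fun y => ∑ a, c a * (f a ∘ e.symm) y := rfl
  rw [this, pd_sum _ i fun a => (hf a).const_mul (c a)]
  exact Finset.sum_congr rfl fun a _ => pd_const_mul i (c a) (hf a)

variable [ChartedSpace (Model n) M]

theorem contMDiffOn_linear_combination (c : κ → ℝ)
    (hf : ∀ a, ContMDiffOn (𝓡 n) 𝓘(ℝ) ∞ (f a) O) :
    ContMDiffOn (𝓡 n) 𝓘(ℝ) ∞ (fun x => ∑ a, c a * f a x) O :=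
  contMDiffOn_finsetSum fun a _ => contMDiffOn_const.mul (hf a)

variable [IsManifold (𝓡 n) ∞ M] {g : Metric n M}

theorem hess_linear_combination (c : κ → ℝ) (he : e ∈ smoothCharts n M) (hO : IsOpen O)
    (hf : ∀ a, ContMDiffOn (𝓡 n) 𝓘(ℝ) ∞ (f a) O) (hq : q ∈ e.target ∩ e.symm ⁻¹' O)
    (i j : Fin n) :
    hess e g (fun x => ∑ a, c a * f a x) i j q = ∑ a, c a * hess e g (f a) i j q := by
  have hΩ := isOpen_chart_preimage (e := e) hO
  have hs := fun a => contDiffOn_comp_symm he (hf a)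
  have h1 : ∀ j, ∀ y ∈ e.target ∩ e.symm ⁻¹' O,
      pd j ((fun x => ∑ a, c a * f a x) ∘ e.symm) y = ∑ a, c a * pd j (f a ∘ e.symm) y :=
    fun j y hy => pd_linear_combination c (fun a => (hs a).differentiableAt_of_isOpen hΩ hy) j
  have h2 : pd i (pd j ((fun x => ∑ a, c a * f a x) ∘ e.symm)) q
      = ∑ a, c a * pd i (pd j (f a ∘ e.symm)) q := by
    have hd := fun a => ((hs a).pd hΩ j).differentiableAt_of_isOpen hΩ hq
    rw [pd_congr i (Filter.eventuallyEq_of_mem (hΩ.mem_nhds hq) (h1 j)),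
      pd_sum _ i fun a => (hd a).const_mul (c a)]
    exact Finset.sum_congr rfl fun a _ => pd_const_mul i (c a) (hd a)
  simp only [hess, h2, h1 _ q hq, mul_sub, Finset.sum_sub_distrib, Finset.mul_sum]
  congr 1
  rw [Finset.sum_comm]
  exact Finset.sum_congr rfl fun _ _ => Finset.sum_congr rfl fun _ _ => by ring

theorem lap_linear_combination (c : κ → ℝ) (he : e ∈ smoothCharts n M) (hO : IsOpen O)
    (hf : ∀ a, ContMDiffOn (𝓡 n) 𝓘(ℝ) ∞ (f a) O) (hq : q ∈ e.target ∩ e.symm ⁻¹' O) :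
    lap e g (fun x => ∑ a, c a * f a x) q = ∑ a, c a * lap e g (f a) q := by
  simp only [lap, hess_linear_combination c he hO hf hq, Finset.mul_sum]
  symm
  rw [Finset.sum_comm]
  refine Finset.sum_congr rfl fun _ _ => ?_
  rw [Finset.sum_comm]
  exact Finset.sum_congr rfl fun _ _ => Finset.sum_congr rfl fun _ _ => by ring

theorem WilczynskiOn.linear_combination {T : ∀ x : M, Form3 n x} (c : κ → ℝ) (hO : IsOpen O)
    (hf : ∀ a, ContMDiffOn (𝓡 n) 𝓘(ℝ) ∞ (f a) O) (hW : ∀ a, WilczynskiOn g T O (f a)) :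
    WilczynskiOn g T O (fun x => ∑ a, c a * f a x) := by
  intro e he q hq hqO i j
  have hΩ := isOpen_chart_preimage (e := e) hO
  have hp := fun m => pd_linear_combination (e := e) (q := q) c
    (fun a => (contDiffOn_comp_symm he (hf a)).differentiableAt_of_isOpen hΩ ⟨hq, hqO⟩) m
  rw [hess_linear_combination c he hO hf ⟨hq, hqO⟩, lap_linear_combination c he hO hf ⟨hq, hqO⟩]
  simp only [fun a => hW a e he q hq hqO, hp, mul_add, Finset.sum_add_distrib, Finset.mul_sum]
  congr 1
  · rw [Finset.sum_comm]
    refine Finset.sum_congr rfl fun _ _ => ?_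
    rw [Finset.sum_comm]
    exact Finset.sum_congr rfl fun _ _ => Finset.sum_congr rfl fun _ _ => by ring
  · exact Finset.sum_congr rfl fun _ _ => by ring

end Linearity

variable {n : ℕ} {M : Type*} [TopologicalSpace M] [ChartedSpace (Model n) M]
  [IsManifold (𝓡 n) ∞ M] {g : Metric n M} {e : OpenPartialHomeomorph M (Model n)}

/-- On a connected set, `n + 2` linearly independent potentials realise all values of the gradient
and the Laplacian at every point, because a potential is determined by its value, gradient and
Laplacian there. -/
theorem System.hasFullJets (S : System g) (hn : 2 ≤ n) {T : ∀ x : M, Form3 n x} (hT : IsSmooth3 T)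
    {O : Set M} (hO : IsOpen O) (hOc : IsConnected O) {f : Fin (n + 2) → M → ℝ}
    (hf : ∀ a, S.IsPotentialOn T O (f a)) (hind : LinearIndependent ℝ fun a => O.domRestrict (f a))
    (he : e ∈ smoothCharts n M) {q : Model n} (hq : q ∈ e.target) (hqO : e.symm q ∈ O) :
    HasFullJets (fun a => f a ∘ e.symm) (fun a q => (1 / (n : ℝ)) * lap e g (f a) q) q := by
  have hΩ := isOpen_chart_preimage (e := e) hO
  have hn0 : (n : ℝ) ≠ 0 := by
    have : (2 : ℝ) ≤ n := by exact_mod_cast hn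
    linarith
  -- the linear map which takes the coefficients of a potential to its value, gradient and Laplacian
  set Ψ := Fintype.linearCombination ℝ fun a =>
    ((f a (e.symm q), (fun m => pd m (f a ∘ e.symm) q), 1 / (n : ℝ) * lap e g (f a) q) :
      ℝ × (Fin n → ℝ) × ℝ) with hΨ
  have hΨ1 : ∀ c, Ψ c = ∑ a, c a •
      ((f a (e.symm q), (fun m => pd m (f a ∘ e.symm) q), 1 / (n : ℝ) * lap e g (f a) q) :
          ℝ × (Fin n → ℝ) × ℝ) := fun c => Fintype.linearCombination_apply ℝ _ c
  have hinj : Function.Injective Ψ := by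
    refine (injective_iff_map_eq_zero Ψ).2 fun c hc => ?_
    rw [hΨ1] at hc
    have hc0 := congrArg Prod.fst hc
    have hc1 := fun m => congrFun (congrArg (fun z => z.2.1) hc) m
    have hc2 := congrArg (fun z => z.2.2) hc
    simp only [Prod.fst_sum, Prod.snd_sum, Prod.smul_fst, Prod.smul_snd, Finset.sum_apply,
      Pi.smul_apply, smul_eq_mul, Prod.fst_zero, Prod.snd_zero, Pi.zero_apply] at hc0 hc1 hc2
    have hz := S.eqOn_zero hn he hT hO hOc.isPreconnected
      (contMDiffOn_linear_combination c fun a => (hf a).smooth)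
      (WilczynskiOn.linear_combination c hO (fun a => (hf a).smooth) fun a => (hf a).wilczynski)
      hqO (e.map_target hq) hc0 (by
        intro i
        rw [e.right_inv hq, pd_linear_combination c fun a =>
          (contDiffOn_comp_symm he (hf a).smooth).differentiableAt_of_isOpen hΩ ⟨hq, hqO⟩]
        exact hc1 i) (by
        rw [e.right_inv hq, lap_linear_combination c he hO (fun a => (hf a).smooth) ⟨hq, hqO⟩]
        have : 1 / (n : ℝ) * ∑ a, c a * lap e g (f a) q = 0 := by
          rw [← hc2, Finset.mul_sum]
          exact Finset.sum_congr rfl fun _ _ => by ring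
        simpa [hn0] using this)
    refine funext fun a => Fintype.linearIndependent_iff.1 hind c ?_ a
    funext y
    simpa [Set.domRestrict] using hz y y.2
  have hsurj : Function.Surjective Ψ :=
    (LinearMap.injective_iff_surjective_of_finrank_eq_finrank (by simp; ring)).1 hinj
  intro v c hvc
  have hall : ∀ y : ℝ × (Fin n → ℝ) × ℝ, ∑ m, v m * y.2.1 m + c * y.2.2 = 0 := by
    intro y
    obtain ⟨b, rfl⟩ := hsurj y
    rw [hΨ1]
    simp only [Prod.fst_sum, Prod.snd_sum, Prod.smul_fst, Prod.smul_snd, Finset.sum_apply,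
      Pi.smul_apply, smul_eq_mul, Finset.mul_sum]
    rw [Finset.sum_comm, ← Finset.sum_add_distrib]
    refine Finset.sum_eq_zero fun a _ => ?_
    have := congrArg (fun z => b a * z) (hvc a)
    simp only [mul_zero, mul_add, Finset.mul_sum] at this
    rw [← this]
    congr 1
    · exact Finset.sum_congr rfl fun _ _ => by ring
    · ring
  refine ⟨funext fun m => ?_, ?_⟩
  · simpa [Pi.single_apply] using hall (0, Pi.single m 1, 0)
  · simpa using hall (0, 0, 1)

/-- The Killing equation for the Killing tensors of a system and `dW = K dV`, from the vanishing of the Poisson bracket. -/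
theorem System.killing_eq (S : System g) (he : e ∈ smoothCharts n M) {q : Model n}
    (hq : q ∈ e.target) (α : Fin (2 * n - 1)) :
    (∀ l i j, pd l (comp2 e (S.K α) i j) q + pd i (comp2 e (S.K α) j l) q
        + pd j (comp2 e (S.K α) l i) q
      = ∑ b, (comp2 e (S.K α) l b q * sCoeff (comp2 e g.inner) (ginv e g) b i j q
        + comp2 e (S.K α) i b q * sCoeff (comp2 e g.inner) (ginv e g) b j l q
        + comp2 e (S.K α) j b q * sCoeff (comp2 e g.inner) (ginv e g) b l i q)) ∧
    ∀ l, pd l (S.W α ∘ e.symm) q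
      = ∑ b, ∑ m, comp2 e (S.K α) l b q * ginv e g b m q * pd m (S.V ∘ e.symm) q := by
  have hsm : ∀ {f : M → ℝ}, ContMDiff (𝓡 n) 𝓘(ℝ) ∞ f → DifferentiableAt ℝ (f ∘ e.symm) q :=
    fun {f} hf => (contDiffOn_comp_symm he (hf.contMDiffOn (s := Set.univ))).differentiableAt_of_isOpen
      (isOpen_chart_preimage isOpen_univ) ⟨hq, trivial⟩
  exact killing_of_poisson (S.isMetricOn he) hq
    (fun i j => (S.smooth_K α e he i j).differentiableAt_of_isOpen e.open_target hq)
    (fun i j => funext fun x => S.symm_K α _ _ _) (hsm (S.smooth_W α)) (hsm S.smooth_V)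
    fun p => S.constant_of_motion α e he (q, p) hq

/-- A non-degenerate system satisfies, in every chart, all the integrability conditions. -/
theorem System.isLocalSystem (S : System g) (hn : 2 ≤ n) {T : ∀ x : M, Form3 n x}
    (hT : S.IsStructureTensor T) (hnd : S.IsNondegenerate T) (he : e ∈ smoothCharts n M) :
    IsLocalSystem e.target (comp2 e g.inner) (ginv e g) (gamma e g) (comp3 e T)
      (fun α => comp2 e (S.K α)) := by
  have hG := S.isMetricOn he
  have hA := contDiffOn_structure S he hT.smooth
  have hloc : ∀ q ∈ e.target, ∃ O : Set M, IsOpen O ∧ e.symm q ∈ O ∧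
      ∃ f : Fin (n + 2) → M → ℝ, (∀ a, S.IsPotentialOn T O (f a)) ∧
      (∀ a, IsLocalSolution (e.target ∩ e.symm ⁻¹' O) (comp2 e g.inner)
        (connCoeff (ginv e g) (gamma e g) (comp3 e T)) (f a ∘ e.symm)
        (fun q => (1 / (n : ℝ)) * lap e g (f a) q)) ∧
      HasFullJets (fun a => f a ∘ e.symm) (fun a q => (1 / (n : ℝ)) * lap e g (f a) q) q := by
    intro q hq
    obtain ⟨O, hO, hOc, hqO, f, hf, hind⟩ := hnd (e.symm q)
    exact ⟨O, hO, hqO, f, hf, fun a => S.isLocalSolution he hO (hf a).smooth (hf a).wilczynski,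
      S.hasFullJets hn hT.smooth hO hOc hf hind he hq hqO⟩
  set A := connCoeff (ginv e g) (gamma e g) (comp3 e T) with hAdef
  have hcoeff : ∀ q ∈ e.target, ∀ i j k,
      (∀ m, comp2 e g.inner i j q * rCoeff (ginv e g) A k m q
        - comp2 e g.inner i k q * rCoeff (ginv e g) A j m q = gradCoeff A i j k m q) ∧
      comp2 e g.inner i j q * tCoeff (comp2 e g.inner) (ginv e g) A k q
        - comp2 e g.inner i k q * tCoeff (comp2 e g.inner) (ginv e g) A j q
        = traceCoeff (comp2 e g.inner) A i j k q := by
    intro q hq i j k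
    obtain ⟨O, hO, hqO, f, -, hsol, hjet⟩ := hloc q hq
    exact coeff_eq_of_hasFullJets hn (hG.mono (isOpen_chart_preimage hO) Set.inter_subset_left)
      (fun i j m => (hA i j m).mono Set.inter_subset_left) hsol ⟨hq, hqO⟩ hjet i j k
  refine ⟨hT.smooth e he, fun α => S.smooth_K α e he, fun i j a => ?_, ?_, fun α i j => ?_,
    fun q hq i j a => (hcoeff q hq i j a).1, fun q hq i j a => (hcoeff q hq i j a).2, ?_⟩
  · exact funext fun q => hT.symm _ _ _ _
  · exact fun q hq a => hT.trace_free e he q hq a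
  · exact funext fun q => S.symm_K α _ _ _
  · intro α q hq i j m
    obtain ⟨O, hO, hqO, f, hpot, hsol, hjet⟩ := hloc q hq
    have hBD := pd_sub_pd_of_hasFullJets
      (hG.mono (isOpen_chart_preimage hO) Set.inter_subset_left) hsol ⟨hq, hqO⟩ hjet
      (k := comp2 e (S.K α)) (fun i j => (S.smooth_K α e he i j).mono Set.inter_subset_left)
      (fun i j => funext fun x => S.symm_K α _ _ _)
      (fun a i j => (hpot a).bertrand_darboux α e he q hq hqO i j)
    have h1 := hBD i j m
    have h2 := hBD i m j
    have h3 := (S.killing_eq he hq α).1 i j m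
    have hs : ∀ i j, comp2 e (S.K α) i j = comp2 e (S.K α) j i := fun i j =>
      funext fun x => S.symm_K α _ _ _
    rw [hs m j] at h2
    rw [hs m i] at h3
    -- `∂K` is the sum of its symmetrisation and of two antisymmetrised derivatives
    have e3 : (3 : ℝ) * pd i (comp2 e (S.K α) j m) q
        = (pd i (comp2 e (S.K α) j m) q + pd j (comp2 e (S.K α) i m) q
          + pd m (comp2 e (S.K α) i j) q)
        + (pd i (comp2 e (S.K α) j m) q - pd j (comp2 e (S.K α) i m) q)
        + (pd i (comp2 e (S.K α) j m) q - pd m (comp2 e (S.K α) i j) q) := by ring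
    rw [e3, h1, h2, h3, ← Finset.sum_add_distrib, ← Finset.sum_add_distrib]
    exact Finset.sum_congr rfl fun b _ => by ring

end Systems

section LinearCombination

variable {n : ℕ} {ι ι' : Type*} {Ω : Set (Model n)}
  {G γ : Fin n → Fin n → Model n → ℝ}
  {Γ T : Fin n → Fin n → Fin n → Model n → ℝ} {k : ι → Fin n → Fin n → Model n → ℝ}

theorem IsLocalSystem.linear_combination [Fintype ι] (h : IsLocalSystem Ω G γ Γ T k) (hΩ : IsOpen Ω)
    (c : ι' → ι → ℝ) :
    IsLocalSystem Ω G γ Γ T fun α i j q => ∑ β, c α β * k β i j q where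
  smooth := h.smooth
  smooth_killing α i j := by
    have := h.smooth_killing
    fun_prop
  symm := h.symm
  trace_free := h.trace_free
  symm_killing α i j := by simp only [h.symm_killing _ i j]
  grad_eq := h.grad_eq
  trace_eq := h.trace_eq
  killing_eq α q hq i j m := by
    have hd := fun β => (h.smooth_killing β j m).differentiableAt_of_isOpen hΩ hq
    rw [pd_sum _ i fun β => (hd β).const_mul (c α β), Finset.mul_sum]
    have : ∀ β, 3 * pd i (fun x => c α β * k β j m x) q = c α β * (3 * pd i (k β j m) q) :=
      fun β => by rw [pd_const_mul i _ (hd β)]; ring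
    simp only [this, h.killing_eq _ q hq, Finset.mul_sum, Finset.sum_mul]
    rw [Finset.sum_comm]
    refine Finset.sum_congr rfl fun b _ => ?_
    simp only [← Finset.sum_add_distrib]
    exact Finset.sum_congr rfl fun _ _ => by ring

/-- A Killing tensor which vanishes at a point vanishes near this point. -/
theorem IsLocalSystem.eventually_killing_eq_zero (h : IsLocalSystem Ω G γ Γ T k)
    (hG : IsMetricOn Ω G γ) (hΓ : ∀ i j m, ContDiffOn ℝ ∞ (Γ i j m) Ω) (α : ι) {q₀ : Model n}
    (hq₀ : q₀ ∈ Ω) (h0 : ∀ i j, k α i j q₀ = 0) : ∀ᶠ q in 𝓝 q₀, ∀ i j, k α i j q = 0 := by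
  have hΩ := hG.isOpen
  have hnhds := hΩ.mem_nhds hq₀
  have hcont : ∀ {a : Model n → ℝ}, ContDiffOn ℝ ∞ a Ω → ContinuousAt a q₀ := fun ha =>
    ha.continuousOn.continuousAt hnhds
  have hA := contDiffOn_connCoeff hG hΓ h.smooth
  have hP := contDiffOn_pCoeff hG hA
  have hS := contDiffOn_sCoeff hG
  have hO : ∀ i j, k α i j =O[𝓝 q₀] fun q => (fun c : Fin n × Fin n => k α c.1 c.2 q) :=
    fun i j => isBigO_of_le _ fun q =>
      norm_le_pi_norm (fun c : Fin n × Fin n => k α c.1 c.2 q) (i, j)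
  have := eventually_eq_zero_of_pd_isBigO (w := fun c : Fin n × Fin n => k α c.1 c.2)
    (q₀ := q₀) ?_ ?_ (fun c => h0 c.1 c.2)
  · filter_upwards [this] with q hq i j using hq (i, j)
  · intro c
    filter_upwards [hnhds] with q hq using (h.smooth_killing α _ _).differentiableAt_of_isOpen hΩ hq
  · rintro ⟨j, m⟩ i
    refine IsBigO.congr' (f₁ := fun q => 3⁻¹ * ∑ b,
      ((sCoeff G γ b j m q - pCoeff G γ (connCoeff γ Γ T) b j m q
          - pCoeff G γ (connCoeff γ Γ T) b m j q) * k α i b q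
        + (sCoeff G γ b m i q + pCoeff G γ (connCoeff γ Γ T) b i m q) * k α j b q
        + (sCoeff G γ b i j q + pCoeff G γ (connCoeff γ Γ T) b i j q) * k α m b q))
      ?_ ?_ EventuallyEq.rfl
    · refine IsBigO.const_mul_left (.fun_sum fun b _ => IsBigO.add (IsBigO.add ?_ ?_) ?_) _
      · exact (hcont (by fun_prop)).mul_isBigO (hO i b)
      · exact (hcont (by fun_prop)).mul_isBigO (hO j b)
      · exact (hcont (by fun_prop)).mul_isBigO (hO m b)
    · filter_upwards [hnhds] with q hq
      have e := h.killing_eq α q hq i j m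
      simp only [mul_comm (k α _ _ q)] at e
      rw [← e]
      ring

end LinearCombination

/-! ### Orthonormal charts and irreducibility -/

section Orthonormal

variable {n : ℕ} {M : Type*} [TopologicalSpace M] [ChartedSpace (Model n) M]

theorem transHomeomorph_mem_smoothCharts {e : OpenPartialHomeomorph M (Model n)}
    (he : e ∈ smoothCharts n M) (L : Model n ≃L[ℝ] Model n) :
    e.transHomeomorph L.toHomeomorph ∈ smoothCharts n M := by
  have hL : ∀ L : Model n ≃L[ℝ] Model n,
      L.toHomeomorph.toOpenPartialHomeomorph ∈ contDiffGroupoid ∞ (𝓡 n) := by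
    intro L
    rw [contDiffGroupoid, mem_groupoid_of_pregroupoid]
    constructor
    · simpa [contDiffPregroupoid] using L.contDiff.contDiffOn
    · simpa [contDiffPregroupoid] using L.symm.contDiff.contDiffOn
  rw [OpenPartialHomeomorph.transHomeomorph_eq_trans]
  refine mem_maximalAtlas_iff.2 fun e' he' => ?_
  have h := mem_maximalAtlas_iff.1 he e' he'
  constructor
  · rw [OpenPartialHomeomorph.trans_symm_eq_symm_trans_symm, OpenPartialHomeomorph.trans_assoc]
    exact (contDiffGroupoid ∞ (𝓡 n)).trans ((contDiffGroupoid ∞ (𝓡 n)).symm (hL L)) h.1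
  · rw [← OpenPartialHomeomorph.trans_assoc]
    exact (contDiffGroupoid ∞ (𝓡 n)).trans h.2 (hL L)

theorem comp2_transHomeomorph {e : OpenPartialHomeomorph M (Model n)}
    (he : e ∈ smoothCharts n M) (L : Model n ≃L[ℝ] Model n) (K : ∀ x : M, Form2 n x) (i j : Fin n)
    {q : Model n} (hq : L.symm q ∈ e.target) :
    comp2 (e.transHomeomorph L.toHomeomorph) K i j q
      = ∑ a, ∑ b, L.symm (EuclideanSpace.single i 1) a * L.symm (EuclideanSpace.single j 1) b
        * comp2 e K a b (L.symm q) := by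
  rw [← form_apply_frame he hq]
  have h : ∀ i, coordVec (e.transHomeomorph L.toHomeomorph) i q
      = frame he hq (L.symm (EuclideanSpace.single i 1)) := by
    intro i
    have h1 : MDifferentiableAt (𝓡 n) (𝓡 n) e.symm (L.symm q) :=
      (mdifferentiable_of_mem_smoothCharts he).symm.mdifferentiableAt hq
    have h2 : MDifferentiableAt (𝓡 n) (𝓡 n) L.symm q := L.symm.differentiableAt.mdifferentiableAt
    have h3 := mfderiv_comp q h1 h2
    have h4 : mfderiv (𝓡 n) (𝓡 n) L.symm q = (L.symm : Model n →L[ℝ] Model n) := by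
      rw [mfderiv_eq_fderiv]; exact L.symm.fderiv
    have h5 : (e.transHomeomorph L.toHomeomorph).symm = e.symm ∘ L.symm := rfl
    rw [coordVec]
    change mfderiv (𝓡 n) (𝓡 n) (e.symm ∘ L.symm) q _ = _
    rw [h3, h4]
    rfl
  rw [comp2, h, h]
  rfl

/-- Around every point there is a chart in which the metric is the identity at this point. -/
theorem exists_orthonormal_chart [IsManifold (𝓡 n) ∞ M] (g : Metric n M) (x₀ : M) :
    ∃ e ∈ smoothCharts n M, x₀ ∈ e.source ∧
      ∀ i j, comp2 e g.inner i j (e x₀) = if i = j then 1 else 0 := by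
  set e₀ := chartAt (Model n) x₀ with he₀
  have he : e₀ ∈ smoothCharts n M := IsManifold.chart_mem_maximalAtlas x₀
  have hx : x₀ ∈ e₀.source := mem_chart_source _ x₀
  have hq : e₀ x₀ ∈ e₀.target := e₀.map_source hx
  set B : LinearMap.BilinForm ℝ (Model n) := LinearMap.mk₂ ℝ
    (fun v w => g.inner (e₀.symm (e₀ x₀)) (frame he hq v) (frame he hq w))
    (by intros; simp) (by intros; simp) (by intros; simp) (by intros; simp) with hB
  have hBs : LinearMap.IsSymm B := ⟨fun v w => g.symm _ _ _⟩
  have hBpos : ∀ v, v ≠ 0 → 0 < B v v := fun v hv =>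
    g.pos _ _ fun h => hv ((frame he hq).map_eq_zero_iff.1 h)
  obtain ⟨v', hv'⟩ := LinearMap.BilinForm.exists_orthogonal_basis hBs
  -- an orthogonal basis exists since `g` is symmetric; it is normalised and taken as new frame
  set v := v'.reindex (finCongr (finrank_euclideanSpace_fin (𝕜 := ℝ) (n := n))) with hv
  have hvo : ∀ i j, i ≠ j → B (v i) (v j) = 0 := fun i j hij => by
    simp only [hv, Module.Basis.reindex_apply]
    exact hv' (by simpa using hij)
  have hvp : ∀ i, 0 < B (v i) (v i) := fun i => hBpos _ (v.ne_zero i)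
  set u := v.isUnitSMul (w := fun i => (√(B (v i) (v i)))⁻¹) fun i =>
    isUnit_iff_ne_zero.2 (inv_ne_zero (Real.sqrt_ne_zero'.2 (hvp i))) with hu
  have huo : ∀ i j, B (u i) (u j) = if i = j then 1 else 0 := by
    intro i j
    simp only [hu, Module.Basis.isUnitSMul_apply, map_smul, LinearMap.smul_apply, smul_eq_mul]
    split_ifs with hij
    · subst hij
      have := Real.mul_self_sqrt (hvp i).le
      have h0 := Real.sqrt_ne_zero'.2 (hvp i)
      field_simp
      rw [sq, this]
    · rw [hvo i j hij, mul_zero, mul_zero]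
  set P : Model n ≃L[ℝ] Model n :=
    ((EuclideanSpace.basisFun (Fin n) ℝ).toBasis.equiv u (Equiv.refl _)).toContinuousLinearEquiv
    with hP
  have hPu : ∀ i, P (EuclideanSpace.single i 1) = u i := fun i => by
    have := (EuclideanSpace.basisFun (Fin n) ℝ).toBasis.equiv_apply i u (Equiv.refl _)
    simpa [hP] using this
  refine ⟨e₀.transHomeomorph P.symm.toHomeomorph, transHomeomorph_mem_smoothCharts he _, hx,
    fun i j => ?_⟩
  have hPq : P.symm.symm ((e₀.transHomeomorph P.symm.toHomeomorph) x₀) = e₀ x₀ :=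
    P.apply_symm_apply _
  rw [comp2_transHomeomorph he _ _ _ _ (by rwa [hPq]), hPq, ← huo, ← hPu, ← hPu]
  exact (form_apply_frame he hq g.inner _ _).symm

/-- Schur's lemma: a symmetric matrix which commutes with an irreducible family of Killing tensors,
in an orthonormal frame, is a multiple of the identity, since its eigenspaces are common invariant
subspaces. -/
theorem System.IsIrreducible.schur [IsManifold (𝓡 n) ∞ M] {g : Metric n M} {S : System g}
    (hS : S.IsIrreducible) (hn : 0 < n) {e : OpenPartialHomeomorph M (Model n)}
    (he : e ∈ smoothCharts n M) {q : Model n} (hq : q ∈ e.target)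
    (hδ : ∀ i j, comp2 e g.inner i j q = if i = j then 1 else 0) (X : Fin n → Fin n → ℝ)
    (hX : ∀ i j, X i j = X j i)
    (hcomm : ∀ α i l, ∑ a, comp2 e (S.K α) i a q * X a l = ∑ a, comp2 e (S.K α) l a q * X a i) :
    ∃ c : ℝ, ∀ i j, X i j = if i = j then c else 0 := by
  have hH : (Matrix.of X).IsHermitian := Matrix.IsHermitian.ext fun i j => by simp [hX i j]
  set i₀ : Fin n := ⟨0, hn⟩
  set μ := hH.eigenvalues i₀ with hμ
  set A : Model n →ₗ[ℝ] (Fin n → ℝ) :=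
    ((Matrix.of X).mulVecLin - μ • LinearMap.id) ∘ₗ (WithLp.linearEquiv 2 ℝ (Fin n → ℝ)).toLinearMap
    with hA
  have hAm : ∀ v : Model n, A v = 0 ↔ ∀ i, ∑ a, X i a * v a = μ * v i := by
    intro v
    simp [hA, funext_iff, sub_eq_zero, Matrix.mulVec, dotProduct]
  -- `L` is the eigenspace of `X` for the eigenvalue `μ`
  set L : Submodule ℝ (TS n (e.symm q)) :=
    (LinearMap.ker A).map (frame he hq).toLinearEquiv.toLinearMap with hL
  have hmem : ∀ v, frame he hq v ∈ L ↔ A v = 0 := by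
    intro v
    constructor
    · rintro ⟨w, hw, hwv⟩
      have : w = v := (frame he hq).injective hwv
      rwa [← this]
    · exact fun h => ⟨v, h, rfl⟩
  have hsymm : ∀ α i j, comp2 e (S.K α) i j q = comp2 e (S.K α) j i q := fun α i j =>
    S.symm_K α _ _ _
  have hinv : ∀ α, ∀ v ∈ L, ∃ u ∈ L, ∀ w, g.inner (e.symm q) u w = S.K α (e.symm q) v w := by
    rintro α _ ⟨v, hv, rfl⟩
    have hv' := (hAm v).1 hv
    set u : Model n := WithLp.toLp 2 fun i => ∑ a, comp2 e (S.K α) i a q * v a with hu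
    refine ⟨frame he hq u, (hmem u).2 ((hAm u).2 fun i => ?_), fun w => ?_⟩
    · simp only [hu, Finset.mul_sum]
      calc ∑ a, ∑ b, X i a * (comp2 e (S.K α) a b q * v b)
          = ∑ b, (∑ a, comp2 e (S.K α) b a q * X a i) * v b := by
            rw [Finset.sum_comm]
            simp only [Finset.sum_mul]
            exact Finset.sum_congr rfl fun b _ => Finset.sum_congr rfl fun a _ => by
              rw [hX i a, hsymm α a b]; ring
        _ = ∑ a, comp2 e (S.K α) i a q * ∑ b, X a b * v b := by
            simp only [← hcomm, Finset.sum_mul, Finset.mul_sum]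
            rw [Finset.sum_comm]
            exact Finset.sum_congr rfl fun b _ => Finset.sum_congr rfl fun a _ => by ring
        _ = _ := Finset.sum_congr rfl fun a _ => by rw [hv' a]; ring
    · obtain ⟨w, rfl⟩ := (frame he hq).surjective w
      change _ = S.K α (e.symm q) (frame he hq v) (frame he hq w)
      rw [form_apply_frame he hq g.inner, form_apply_frame he hq (S.K α)]
      simp only [hδ, hu, mul_ite, mul_one, mul_zero, Finset.sum_ite_eq, Finset.mem_univ, if_true,
        Finset.sum_mul]
      rw [Finset.sum_comm]
      exact Finset.sum_congr rfl fun b _ => Finset.sum_congr rfl fun a _ => by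
        rw [hsymm α a b]; ring
  rcases hS (e.symm q) L hinv with h | h
  · exfalso
    have hv := hH.mulVec_eigenvectorBasis i₀
    set v := hH.eigenvectorBasis i₀ with hvdef
    have h1 : frame he hq v ∈ L := (hmem v).2 ((hAm v).2 fun i => by
      have := congrFun hv i
      simpa [Matrix.mulVec, dotProduct] using this)
    rw [h, Submodule.mem_bot, (frame he hq).map_eq_zero_iff] at h1
    exact hH.eigenvectorBasis.orthonormal.ne_zero i₀ h1
  · refine ⟨μ, fun i j => ?_⟩
    have h1 : frame he hq (EuclideanSpace.single j 1) ∈ L := by rw [h]; trivial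
    have := (hAm _).1 ((hmem _).1 h1) i
    simpa [Pi.single_apply] using this

end Orthonormal

/-! ### Coincidence of two systems -/

section Coincidence

variable {n : ℕ} {M : Type*} [TopologicalSpace M] [ChartedSpace (Model n) M]
  [IsManifold (𝓡 n) ∞ M] {g : Metric n M} {e : OpenPartialHomeomorph M (Model n)}

theorem comp2_killing (S : System g) (c : Fin (2 * n - 1) → ℝ) (i j : Fin n) (q : Model n) :
    comp2 e (S.killing c) i j q = ∑ β, c β * comp2 e (S.K β) i j q := by
  simp [comp2, System.killing]

theorem System.killing_apply (S : System g) (c : Fin (2 * n - 1) → ℝ) (x : M) (v w : TS n x) :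
    S.killing c x v w = ∑ β, c β * S.K β x v w := by
  simp [System.killing]

theorem System.killing_single (S : System g) (α : Fin (2 * n - 1)) (x : M) :
    S.killing (Pi.single α 1) x = S.K α x := by
  refine ContinuousLinearMap.ext fun v => ContinuousLinearMap.ext fun w => ?_
  simp [S.killing_apply, Pi.single_apply]

theorem System.killing_sub_eq_zero_iff (S : System g) (c d : Fin (2 * n - 1) → ℝ) (x : M) :
    S.killing (c - d) x = 0 ↔ S.killing c x = S.killing d x := by
  have h : ∀ v w, S.killing (c - d) x v w = S.killing c x v w - S.killing d x v w := fun v w => by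
    simp only [S.killing_apply, Pi.sub_apply, sub_mul, Finset.sum_sub_distrib]
  constructor
  · intro h0
    refine ContinuousLinearMap.ext fun v => ContinuousLinearMap.ext fun w => ?_
    rw [← sub_eq_zero, ← h, h0]
    rfl
  · intro h0
    refine ContinuousLinearMap.ext fun v => ContinuousLinearMap.ext fun w => ?_
    rw [h, h0, sub_self]
    rfl

theorem System.killing_sum (S : System g) (a : Fin (2 * n - 1) → ℝ)
    (b : Fin (2 * n - 1) → Fin (2 * n - 1) → ℝ) (x : M) :
    S.killing (fun β => ∑ α, a α * b α β) x = ∑ α, a α • S.killing (b α) x := by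
  refine ContinuousLinearMap.ext fun v => ContinuousLinearMap.ext fun w => ?_
  simp only [S.killing_apply, sum_apply, smul_apply, smul_eq_mul, Finset.sum_mul, Finset.mul_sum,
    mul_assoc]
  exact Finset.sum_comm

/-- Unique continuation for the Killing tensors of a non-degenerate system. -/
theorem System.killing_eq_zero (S : System g) (hn : 2 ≤ n) {T : ∀ x : M, Form3 n x}
    (hT : S.IsStructureTensor T) (hnd : S.IsNondegenerate T) (he : e ∈ smoothCharts n M)
    {B : Set (Model n)} (hB : IsPreconnected B) (hBe : B ⊆ e.target) {q₀ : Model n} (hq₀ : q₀ ∈ B)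
    {c : Fin (2 * n - 1) → ℝ} (h0 : S.killing c (e.symm q₀) = 0) :
    ∀ q ∈ B, S.killing c (e.symm q) = 0 := by
  have hG := S.isMetricOn he
  have hΓ : ∀ i j m, ContDiffOn ℝ ∞ (gamma e g i j m) e.target :=
    fun i j m => S.contDiffOn_christoffel he m i j
  have h := (S.isLocalSystem hn hT hnd he).linear_combination e.open_target
    (fun _ : Unit => c)
  have key : B ⊆ {q | ∀ i j, ∑ β, c β * comp2 e (S.K β) i j q = 0} := by
    refine hB.subset_of_forall_mem_nhds hq₀ ?_ (fun y hy hyZ =>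
      h.eventually_killing_eq_zero hG hΓ () (hBe hy) hyZ) fun y hy hyZ i j => ?_
    · intro i j
      rw [← comp2_killing, comp2, h0]
      rfl
    · have hc := ((h.smooth_killing () i j).continuousOn.continuousAt
        (e.open_target.mem_nhds (hBe hy))).continuousWithinAt.mem_closure_image hyZ
      have hsub : (fun q => ∑ β, c β * comp2 e (S.K β) i j q) ''
          interior {q | ∀ i j, ∑ β, c β * comp2 e (S.K β) i j q = 0} ⊆ {0} := by
        rintro _ ⟨q, hq, rfl⟩
        exact interior_subset hq i j
      simpa using closure_mono hsub hc
  intro q hq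
  refine form2_ext (K := S.killing c) (K' := fun _ => 0) he (hBe hq) fun i j => ?_
  rw [comp2_killing, key hq i j]
  rfl

/-- Potentials depend only on the structure tensor and on the span of the Killing tensors. -/
theorem System.IsPotentialOn.congr {S S' : System g} {T T' : ∀ x : M, Form3 n x} {O : Set M}
    (hO : IsOpen O) (hT : ∀ x ∈ O, T x = T' x)
    (hK : ∀ α, ∃ c, ∀ x ∈ O, S'.K α x = S.killing c x) {f : M → ℝ}
    (hf : S.IsPotentialOn T O f) : S'.IsPotentialOn T' O f := by
  refine ⟨hf.smooth, fun e he q hq hqO i j => ?_, fun α e he q hq hqO i j => ?_⟩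
  · have h := hf.wilczynski e he q hq hqO i j
    simp only [comp3, hT _ hqO] at h
    exact h
  · obtain ⟨c, hc⟩ := hK α
    have hΩ := isOpen_chart_preimage (e := e) hO
    have hu := fun m => (contDiffOn_comp_symm he hf.smooth).pd hΩ m
    have hγ := fun i j => ((S.isMetricOn he).smooth_inv i j).mono
      (Set.inter_subset_left (t := e.symm ⁻¹' O))
    have hk := fun β i j => (S.smooth_K β e he i j).mono
      (Set.inter_subset_left (t := e.symm ⁻¹' O))
    have hd : ∀ β j, DifferentiableAt ℝ (applyForm e g (S.K β) f j) q := fun β j => by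
      have : ContDiffOn ℝ ∞ (applyForm e g (S.K β) f j) (e.target ∩ e.symm ⁻¹' O) := by
        unfold applyForm
        fun_prop
      exact this.differentiableAt_of_isOpen hΩ ⟨hq, hqO⟩
    have key : ∀ i j, pd i (applyForm e g (S'.K α) f j) q
        = ∑ β, c β * pd i (applyForm e g (S.K β) f j) q := by
      intro i j
      have hev : applyForm e g (S'.K α) f j
          =ᶠ[𝓝 q] fun y => ∑ β, c β * applyForm e g (S.K β) f j y := by
        filter_upwards [hΩ.mem_nhds ⟨hq, hqO⟩] with y hy
        have : ∀ a, comp2 e (S'.K α) j a y = ∑ β, c β * comp2 e (S.K β) j a y := fun a => by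
          rw [← comp2_killing, comp2, hc _ hy.2]; rfl
        simp only [applyForm, this, Finset.mul_sum, Finset.sum_mul]
        symm
        rw [Finset.sum_comm]
        refine Finset.sum_congr rfl fun _ _ => ?_
        rw [Finset.sum_comm]
        exact Finset.sum_congr rfl fun _ _ => Finset.sum_congr rfl fun _ _ => by ring
      rw [pd_congr i hev, pd_sum _ i fun β => (hd β j).const_mul (c β)]
      exact Finset.sum_congr rfl fun β _ => pd_const_mul i (c β) (hd β j)
    rw [key, key]
    exact Finset.sum_congr rfl fun β _ => by rw [hf.bertrand_darboux β e he q hq hqO i j]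

theorem covDerivEqAt_of_eqOn {T T' : ∀ x : M, Form3 n x} {U : Set M} (hU : IsOpen U) {x : M}
    (hx : x ∈ U) (h : ∀ y ∈ U, T y = T' y) : CovDerivEqAt g T T' x := by
  intro e he hxe i j k l
  have hev : ∀ i j k, comp3 e T i j k =ᶠ[𝓝 (e x)] comp3 e T' i j k := fun i j k => by
    have hm : e x ∈ e.target ∩ e.symm ⁻¹' U := ⟨e.map_source hxe, by simpa [e.left_inv hxe] using hx⟩
    filter_upwards [(isOpen_chart_preimage hU).mem_nhds hm] with q hq
    rw [comp3, comp3, h _ hq.2]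
  simp only [covDeriv3, fun i j k => (hev i j k).eq_of_nhds, pd_congr l (hev i j k)]

/-- The gradient of the momentum-free part of a constant of motion. -/
theorem System.pd_scalarPart (S : System g) (he : e ∈ smoothCharts n M) {q : Model n}
    (hq : q ∈ e.target) (a : Fin (2 * n - 1) → ℝ) (l : Fin n) :
    pd l (S.scalarPart a ∘ e.symm) q
      = ∑ b, ∑ m, comp2 e (S.killing a) l b q * ginv e g b m q * pd m (S.V ∘ e.symm) q := by
  have hd : ∀ α, DifferentiableAt ℝ (S.W α ∘ e.symm) q := fun α =>
    (contDiffOn_comp_symm he ((S.smooth_W α).contMDiffOn (s := Set.univ))).differentiableAt_of_isOpen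
      (isOpen_chart_preimage isOpen_univ) ⟨hq, trivial⟩
  rw [show S.scalarPart a = fun x => ∑ α, a α * S.W α x from rfl, pd_linear_combination a hd]
  simp only [(S.killing_eq he hq _).2, comp2_killing, Finset.mul_sum, Finset.sum_mul]
  rw [Finset.sum_comm]
  refine Finset.sum_congr rfl fun _ _ => ?_
  rw [Finset.sum_comm]
  exact Finset.sum_congr rfl fun _ _ => Finset.sum_congr rfl fun _ _ => by ring

end Coincidence

end Superintegrable

end

theorem mainTheorem6 {n : ℕ} (hn : 3 ≤ n) {M : Type*} [TopologicalSpace M]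
    [ChartedSpace (Superintegrable.Model n) M] [IsManifold (𝓡 n) ∞ M]
    (g : Superintegrable.Metric n M) (S₁ S₂ : Superintegrable.System g)
    (T₁ T₂ : ∀ x : M, Superintegrable.Form3 n x)
    (hirr₁ : S₁.IsIrreducible) (hirr₂ : S₂.IsIrreducible)
    (hT₁ : S₁.IsStructureTensor T₁) (hT₂ : S₂.IsStructureTensor T₂)
    (hnd₁ : S₁.IsNondegenerate T₁) (hnd₂ : S₂.IsNondegenerate T₂)
    (x₀ : M) (hK : S₁.killingValues x₀ = S₂.killingValues x₀) (hT : T₁ x₀ = T₂ x₀) :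
    Superintegrable.CovDerivEqAt g T₁ T₂ x₀ ∧
    ∃ U : Set M, IsOpen U ∧ IsConnected U ∧ x₀ ∈ U ∧
      S₁.killingOn U = S₂.killingOn U ∧
      (∀ a b, S₁.killing a x₀ = S₂.killing b x₀ → ∀ x ∈ U, S₁.killing a x = S₂.killing b x) ∧
      (∀ x ∈ U, T₁ x = T₂ x) ∧
      (∀ O ⊆ U, IsOpen O → ∀ f : M → ℝ, S₁.IsPotentialOn T₁ O f ↔ S₂.IsPotentialOn T₂ O f) ∧
      (Superintegrable.SameDataAt g S₁.V S₂.V x₀ →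
        (∀ x ∈ U, S₁.V x = S₂.V x) ∧
        ∀ a b, S₁.killing a x₀ = S₂.killing b x₀ →
          ∃ c : ℝ, ∀ x ∈ U, S₁.scalarPart a x = S₂.scalarPart b x + c) := by
  open Superintegrable Filter in
  obtain ⟨e, he, hx₀, hδ⟩ := exists_orthonormal_chart g x₀
  have hn2 : 2 ≤ n := by omega
  set q₀ := e x₀ with hq₀def
  have hq₀ : q₀ ∈ e.target := e.map_source hx₀
  have hx : e.symm q₀ = x₀ := e.left_inv hx₀
  have hG := S₁.isMetricOn he
  -- Killing tensors of the second system with the same values at `x₀` as those of the first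
  have hbex : ∀ α, ∃ b, S₂.killing b x₀ = S₁.K α x₀ := fun α => by
    have : S₁.K α x₀ ∈ S₂.killingValues x₀ := hK ▸ ⟨Pi.single α 1, S₁.killing_single α x₀⟩
    exact this
  choose b hb using hbex
  have hk0 : ∀ α i j, comp2 e (S₁.K α) i j q₀ = ∑ β, b α β * comp2 e (S₂.K β) i j q₀ := by
    intro α i j
    have : S₁.K α (e.symm q₀) = S₂.killing (b α) (e.symm q₀) := by rw [hx]; exact (hb α).symm
    rw [← comp2_killing, comp2, this]
    rfl
  have hloc := eventually_eq_of_isLocalSystem hn hG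
    (fun i j m => S₁.contDiffOn_christoffel he m i j) (S₁.isLocalSystem hn2 hT₁ hnd₁ he)
    ((S₂.isLocalSystem hn2 hT₂ hnd₂ he).linear_combination e.open_target b) hq₀ hδ
    (fun X hX hc => hirr₁.schur (by omega) he hq₀ hδ X hX fun α i l => by
      simp only [hk0]; exact hc α i l)
    (fun i j a => by
      have : T₁ (e.symm q₀) = T₂ (e.symm q₀) := by rw [hx]; exact hT
      rw [comp3, this]; rfl) hk0
  -- `U` corresponds to a ball on which the components of both systems coincide
  obtain ⟨r, hr, hball⟩ := Metric.eventually_nhds_iff_ball.1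
    (hloc.and (e.open_target.mem_nhds hq₀))
  set B := Metric.ball q₀ r with hBdef
  have hBe : B ⊆ e.target := fun q hq => (hball q hq).2
  have hBc : IsConnected B :=
    (convex_ball q₀ r).isConnected ⟨q₀, Metric.mem_ball_self hr⟩
  set U := e.symm '' B with hU
  have hUo : IsOpen U := e.symm.isOpen_image_of_subset_source Metric.isOpen_ball hBe
  have hxU : x₀ ∈ U := ⟨q₀, Metric.mem_ball_self hr, hx⟩
  have hUT : ∀ x ∈ U, T₁ x = T₂ x := by
    rintro _ ⟨q, hq, rfl⟩
    exact form3_ext he (hBe hq) ((hball q hq).1.1)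
  have hUK : ∀ α, ∀ x ∈ U, S₁.K α x = S₂.killing (b α) x := by
    rintro α _ ⟨q, hq, rfl⟩
    refine form2_ext he (hBe hq) fun i j => ?_
    rw [comp2_killing]
    exact (hball q hq).1.2 α i j
  have hUpair : ∀ a d, S₁.killing a x₀ = S₂.killing d x₀ →
      ∀ x ∈ U, S₁.killing a x = S₂.killing d x := by
    intro a d had
    -- on `U` the first tensor is a Killing tensor of the second system, so the difference of the two
    -- is one as well, and it vanishes at `x₀`
    have hsum : ∀ x ∈ U, S₁.killing a x = S₂.killing (fun β => ∑ α, a α * b α β) x := by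
      intro x hxU
      rw [S₂.killing_sum, System.killing]
      exact Finset.sum_congr rfl fun α _ => by rw [hUK α x hxU]
    rintro _ ⟨q, hq, rfl⟩
    rw [hsum _ ⟨q, hq, rfl⟩, ← S₂.killing_sub_eq_zero_iff]
    refine S₂.killing_eq_zero hn2 hT₂ hnd₂ he hBc.isPreconnected hBe
      (Metric.mem_ball_self hr) ?_ q hq
    rw [hx, S₂.killing_sub_eq_zero_iff, ← hsum _ hxU, had]
  have hUK' : ∀ β, ∃ c, ∀ x ∈ U, S₂.K β x = S₁.killing c x := fun β => by
    have : S₂.K β x₀ ∈ S₁.killingValues x₀ := hK ▸ ⟨Pi.single β 1, S₂.killing_single β x₀⟩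
    obtain ⟨c, hc⟩ := this
    refine ⟨c, fun x hxU => ?_⟩
    rw [← S₂.killing_single]
    exact (hUpair c (Pi.single β 1) (by rw [S₂.killing_single]; exact hc) x hxU).symm
  refine ⟨covDerivEqAt_of_eqOn hUo hxU hUT, U, hUo, ?_, hxU, ?_, hUpair, hUT, ?_, ?_⟩
  · exact hBc.image _ (e.continuousOn_symm.mono hBe)
  · ext φ
    constructor
    · rintro ⟨a, rfl⟩
      obtain ⟨d, hd⟩ : S₁.killing a x₀ ∈ S₂.killingValues x₀ := hK ▸ ⟨a, rfl⟩
      exact ⟨d, funext fun x => (hUpair a d hd.symm x x.2).symm⟩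
    · rintro ⟨d, rfl⟩
      obtain ⟨a, ha⟩ : S₂.killing d x₀ ∈ S₁.killingValues x₀ := hK ▸ ⟨d, rfl⟩
      exact ⟨a, funext fun x => hUpair a d ha x x.2⟩
  · intro O hOU hO f
    constructor
    · exact fun h => h.congr hO (fun x hxO => hUT x (hOU hxO)) fun β => by
        obtain ⟨c, hc⟩ := hUK' β
        exact ⟨c, fun x hxO => hc x (hOU hxO)⟩
    · exact fun h => h.congr hO (fun x hxO => (hUT x (hOU hxO)).symm) fun α =>
        ⟨b α, fun x hxO => hUK α x (hOU hxO)⟩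
  · rintro ⟨hd0, hd1, hd2⟩
    have hchart : chartAt (Model n) x₀ ∈ smoothCharts n M := IsManifold.chart_mem_maximalAtlas x₀
    have hxs : x₀ ∈ (chartAt (Model n) x₀).source := mem_chart_source _ x₀
    have hV : ∀ x ∈ U, S₁.V x = S₂.V x := by
      -- `V₁ - V₂` solves the structure equation, with zero initial values at `x₀`
      have hsm : ∀ a : Fin 2, ContMDiffOn (𝓡 n) 𝓘(ℝ) ∞ (![S₁.V, S₂.V] a) U := by
        intro a
        fin_cases a
        exacts [S₁.smooth_V.contMDiffOn, S₂.smooth_V.contMDiffOn]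
      have hW : ∀ a : Fin 2, WilczynskiOn g T₁ U (![S₁.V, S₂.V] a) := by
        intro a
        fin_cases a
        · exact fun e he q hq _ => hT₁.wilczynski e he q hq trivial
        · intro e he q hq hqU i j
          have h := hT₂.wilczynski e he q hq trivial i j
          simp only [comp3, ← hUT _ hqU] at h
          exact h
      have hdiff : ∀ a : Fin 2, DifferentiableAt ℝ
          (![S₁.V, S₂.V] a ∘ (chartAt (Model n) x₀).symm) (chartAt (Model n) x₀ x₀) := fun a =>
        (contDiffOn_comp_symm hchart (hsm a)).differentiableAt_of_isOpen (isOpen_chart_preimage hUo)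
          ⟨mem_chart_target _ x₀, by simpa using hxU⟩
      have hz := S₁.eqOn_zero hn2 hchart hT₁.smooth hUo
        (hBc.image _ (e.continuousOn_symm.mono hBe)).isPreconnected
        (contMDiffOn_linear_combination ![1, -1] hsm)
        (WilczynskiOn.linear_combination ![1, -1] hUo hsm hW) hxU hxs
        (by simp [Fin.sum_univ_two, hd0])
        (fun i => by
          rw [pd_linear_combination _ hdiff]
          simp [Fin.sum_univ_two, hd1])
        (by
          rw [lap_linear_combination _ hchart hUo hsm
            ⟨mem_chart_target _ x₀, by simpa using hxU⟩]
          simp [Fin.sum_univ_two, hd2])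
      intro x hxU
      have := hz x hxU
      simp only [Fin.sum_univ_two, Matrix.cons_val_zero, Matrix.cons_val_one, one_mul, neg_mul] at this
      linarith
    refine ⟨hV, fun a d had => ⟨S₁.scalarPart a x₀ - S₂.scalarPart d x₀, ?_⟩⟩
    have hVpd : ∀ q ∈ B, ∀ m, pd m (S₁.V ∘ e.symm) q = pd m (S₂.V ∘ e.symm) q := by
      intro q hq m
      refine pd_congr m ?_
      filter_upwards [Metric.isOpen_ball.mem_nhds hq] with y hy using hV _ ⟨y, hy, rfl⟩
    have hsc : ∀ (S : System g) (a : Fin (2 * n - 1) → ℝ), ∀ q ∈ B,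
        DifferentiableAt ℝ (S.scalarPart a ∘ e.symm) q := fun S a q hq =>
      (contDiffOn_comp_symm he (contMDiffOn_linear_combination (O := Set.univ) a
        fun α => (S.smooth_W α).contMDiffOn)).differentiableAt_of_isOpen
        (isOpen_chart_preimage isOpen_univ) ⟨hBe hq, trivial⟩
    have hconst : ∀ q ∈ B, (S₁.scalarPart a ∘ e.symm) q - (S₂.scalarPart d ∘ e.symm) q
        = (S₁.scalarPart a ∘ e.symm) q₀ - (S₂.scalarPart d ∘ e.symm) q₀ := by
      intro q hq
      refine Metric.isOpen_ball.is_const_of_fderiv_eq_zero (𝕜 := ℝ)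
        (f := fun q => (S₁.scalarPart a ∘ e.symm) q - (S₂.scalarPart d ∘ e.symm) q)
        hBc.isPreconnected (fun y hy => ((hsc S₁ a y hy).fun_sub
          (hsc S₂ d y hy)).differentiableWithinAt) (fun y hy => ?_) hq (Metric.mem_ball_self hr)
      refine ContinuousLinearMap.ext fun v => ?_
      rw [fderiv_apply_eq_sum_pd]
      refine Finset.sum_eq_zero fun l _ => ?_
      rw [pd_sub l (hsc S₁ a y hy) (hsc S₂ d y hy), S₁.pd_scalarPart he (hBe hy),
        S₂.pd_scalarPart he (hBe hy)]
      simp only [hVpd y hy, comp2, hUpair a d had _ ⟨y, hy, rfl⟩, sub_self, mul_zero]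
    rintro _ ⟨q, hq, rfl⟩
    have := hconst q hq
    simp only [Function.comp_apply, hx] at this
    linarith
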